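/- **Setting.** Let $d\ge 0$, $q\ge 1$, $\Theta\subseteq\mathbb R^d$. Let $F:\mathbb R^d\times\mathbb R^q\to\mathbb R$ be jointly measurable and, for each $\theta\in\mathbb R^d$, let $X$ be a random vector in $\mathbb R^q$, whose law may depend on $\theta$; for $\theta\in\Theta$ it is simulated as $X=\mu_\theta^{-1}(U)$, where $U$ is uniform on the unit cube $(0,1]^q$ and $(\theta,u)\mapsto\mu_\theta^{-1}(u)$ is measurable. Put $f(\theta)=\mathbb E[F(\theta,X)]$. Assume that $f$ is differentiable at every point of $\Theta$, bounded below on $\Theta$, with Lipschitz gradient on $\Theta$; that $F(\theta,\cdot)$ is $C^1$ for every $\theta\in\Theta$; and that $F(\theta,X)$ has finite second moment for $\theta\in\Theta$ and $\sup_{\theta\in\Theta}\mathrm{Var}\,F(\theta,X)<\infty$. **Specifications.** Let $\delta>0$ and let one of the following hold, all bounds being uniform in $\theta\in\Theta$. 1. (Bounded map) $\mu_\theta^{-1}$ is $C^1$ on $[0,1]^q$ with $\|\nabla\mu_\theta^{-1}\|$ bounded, and $\nabla_xF(\theta,\cdot)$ is bounded on $\mu_\theta^{-1}([0,1]^q)$.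 Then $\lambda_k=k^{(1+\delta)q/(q+2)}$, $\gamma=\frac{2q}{q+2}$. In cases 2–5, $X$ has independent components, $X_j=\mu_{\theta,j}^{-1}(U_j)$, with inverse distribution functions $\mu_{\theta,j}^{-1}$ that are strictly increasing and $C^1$ on $(0,1)$. The components are *sub-exponential* if $\mathbb P(|X_j|\ge y)\le Ce^{-\kappa_jy}$ and *sub-Gaussian* if $\mathbb P(|X_j|\ge y)\le Ce^{-(y/\xi_j)^2}$ for all $y\ge0$, with $\kappa_j,\xi_j>0$. $F$ is *polynomial* with parameter $a\in\mathbb N^q$ if $|F|$ and $\|\nabla_xF\|$ are at most $C(1+\sum_j|x_j|^{a_j})$ on the support $\mu_\theta^{-1}((0,1)^q)$, and *exponential* with parameter $b\in\mathbb R^q$ if they are at most $Ce^{\sum_jb_jx_j}$ there. Let $\kappa_{\min}=\min_j\kappa_j$, $b_{\max}=\max_j|b_j|$, $\varrho>0$. 2. Sub-exponential components, $F$ polynomial: $\lambda_k=k^{(1+\delta)q/(q+1)}$, $\gamma=\frac{(4+\varrho)q}{2(q+1)}$. 3. Sub-exponential components, $F$ exponential, $b\ne0$, $\kappa_{\min}>2b_{\max}$: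 $\lambda_k=k^{\frac{(1+\delta)q\kappa_{\min}}{(q+1)\kappa_{\min}-2b_{\max}}}$, $\gamma=\frac{2q\kappa_{\min}}{(q+1)\kappa_{\min}-2b_{\max}}$. 4. Sub-Gaussian components, $F$ polynomial: $\lambda_k,\gamma$ as in 2. 5. Sub-Gaussian components, $F$ exponential: $\lambda_k,\gamma$ as in 2. **Algorithm (SASTRO-DF).** The constants are $\Delta_0,\Delta_{\max},\tilde\eta,\sigma_{\min}^2,\kappa_{as}>0$, $\eta\in(0,1)$, $0<\underline\gamma<1<\overline\gamma$ and an integer $\overline n\ge2$; the starting point is $\theta_0$. *Estimates.* For $l\ge1$ split the cube into $l^q$ equal cubes (strata) and draw $\overline n$ uniform points in each; the sample size is $n=\overline n\,l^q$. Let $\tilde f(\theta,n)$ be the average over the strata of the sample means of $F(\theta,\mu_\theta^{-1}(\cdot))$ and $\tilde s(\theta,n)$ the average of the sample variances (with divisor $\overline n-1$). At each evaluated point $\theta$ of iteration $k$, the sample size is the least such $n\ge\lambda_k$ with $$\sqrt{\tfrac1n\max(\sigma_{\min}^2,\tilde s(\theta,n))}\le\kappa_{as}\Delta_k^\gamma/\sqrt{\lambda_k}$$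 (the bound being $+\infty$ if $\lambda_k=0$), and the estimate is $\tilde f(\theta,n)$. All draws, over iterations, evaluated points, trial sample sizes and strata, come from independent uniform vectors. *Iteration $k\ge0$.* Evaluate the points $\theta_k$ and $\theta_k\pm\Delta_ke_j$, $j=1,\dots,d$, and let $M_k(x)=c+\sum_jg_j(x-\theta_k)_j+\frac12\sum_jh_j(x-\theta_k)_j^2$ interpolate the estimates at these points. Let $\theta_k^s$ minimize $M_k$ over the ball $\{\|x-\theta_k\|\le\Delta_k\}$ (ties being broken measurably from the draws used so far), and evaluate it. Let $\rho_k$ be the estimate at $\theta_k$ minus the one at $\theta^s_k$, divided by $M_k(\theta_k)-M_k(\theta_k^s)$. If $\rho_k\ge\eta$ and $\Delta_k\le\tilde\eta\|\nabla M_k(\theta_k)\|$, set $\theta_{k+1}=\theta_k^s$, $\Delta_{k+1}=\min(\overline\gamma\Delta_k,\Delta_{\max})$; otherwise set $\theta_{k+1}=\theta_k$, $\Delta_{k+1}=\underline\gamma\Delta_k$. Assume that all the balls $\{\|x-\theta_k\|\le\Delta_k\}$ lie in $\Theta$ (no condition if $\Theta=\mathbb R^d$). **Statement.** Let $T_\epsilon=\inf\{k\ge0:\|\nabla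 f(\theta_k)\|\le\epsilon\}$. Then, almost surely, $T_\epsilon<\infty$ for all sufficiently small $\epsilon>0$ and $$T_\epsilon=\mathcal O(\epsilon^{-2})\qquad\text{as }\epsilon\downarrow0,$$ the constant and the range of $\epsilon$ being allowed to depend on the realization. -/

import Mathlib

open MeasureTheory ProbabilityTheory Filter Topology Asymptotics

namespace SASTRO

/-- The decision space `ℝ^d` with its Euclidean norm. -/
abbrev Vec (d : ℕ) : Type := EuclideanSpace ℝ (Fin d)

/-! ### The optimization problem -/

/-- The uniform distribution on the unit cube `(0,1]^q`. -/
noncomputable def unifCube (q : ℕ) : Measure (Fin q → ℝ) :=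
  volume.restrict (Set.pi Set.univ fun _ => Set.Ioc (0 : ℝ) 1)

/-- The open unit cube `(0,1)^q`. -/
def openCube (q : ℕ) : Set (Fin q → ℝ) := Set.pi Set.univ fun _ => Set.Ioo (0 : ℝ) 1

/-- The data of the problem: minimize `f θ = 𝔼[F(θ, X)]` over `θ ∈ Θ ⊆ ℝ^d`, where the law of the
`q`-dimensional random vector `X` may depend on `θ` and `X` is simulated as `inv θ U` from a
uniform vector `U` (so `inv θ` is the inverse `μ_θ⁻¹` of the map from the support of `X` to the
cube). -/
structure Problem (d q : ℕ) where
  Θ : Set (Vec d)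
  F : Vec d → (Fin q → ℝ) → ℝ
  law : Vec d → Measure (Fin q → ℝ)
  inv : Vec d → (Fin q → ℝ) → (Fin q → ℝ)

/-- The objective function `f θ = 𝔼[F(θ, X)]`. -/
noncomputable def Problem.f {d q : ℕ} (p : Problem d q) (θ : Vec d) : ℝ :=
  ∫ x, p.F θ x ∂(p.law θ)

/-- The standing assumptions: `f` is differentiable and bounded below with Lipschitz gradient on
`Θ`; `F(θ, ·)` is continuously differentiable and `F(θ, X)` has bounded variance; `X` has the law
of `μ_θ⁻¹(U)` with `U` uniform. -/
structure Problem.Standing {d q : ℕ} (p : Problem d q) : Prop where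
  measurable_F : Measurable fun z : Vec d × (Fin q → ℝ) => p.F z.1 z.2
  measurable_inv : Measurable fun z : Vec d × (Fin q → ℝ) => p.inv z.1 z.2
  law_eq : ∀ θ ∈ p.Θ, p.law θ = (unifCube q).map (p.inv θ)
  bddBelow : BddBelow (p.f '' p.Θ)
  differentiable : ∀ θ ∈ p.Θ, DifferentiableAt ℝ p.f θ
  lipschitz_gradient : ∃ K : NNReal, LipschitzOnWith K (gradient p.f) p.Θ
  contDiff_F : ∀ θ ∈ p.Θ, ContDiff ℝ 1 (p.F θ)
  bounded_variance : ∃ σ2 : ℝ, ∀ θ ∈ p.Θ,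
    MemLp (p.F θ) 2 (p.law θ) ∧ variance (p.F θ) (p.law θ) ≤ σ2

/-! ### The five specifications of `F` and of the law of `X` -/

/-- `μ_θ⁻¹` extends to a `C¹` map on the closed cube with bounded gradient, and the gradient of
`F` in `x` is bounded along it; the bounds are uniform in `θ ∈ Θ`. -/
def Problem.BoundedMap {d q : ℕ} (p : Problem d q) : Prop :=
  (∀ θ ∈ p.Θ, ContDiffOn ℝ 1 (p.inv θ) (Set.Icc 0 1)) ∧
  ∃ C : ℝ, ∀ θ ∈ p.Θ, ∀ u ∈ Set.Icc (0 : Fin q → ℝ) 1,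
    ‖fderivWithin ℝ (p.inv θ) (Set.Icc 0 1) u‖ ≤ C ∧ ‖fderiv ℝ (p.F θ) (p.inv θ u)‖ ≤ C

/-- `X` has independent components, the `j`-th one simulated by its inverse distribution function
`Q θ j`, which is increasing and continuously differentiable on `(0,1)`. -/
def Problem.IndepMargins {d q : ℕ} (p : Problem d q) : Prop :=
  ∃ Q : Vec d → Fin q → ℝ → ℝ, ∀ θ ∈ p.Θ,
    (∀ j, StrictMonoOn (Q θ j) (Set.Ioo 0 1) ∧ ContDiffOn ℝ 1 (Q θ j) (Set.Ioo 0 1)) ∧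
    ∀ u ∈ openCube q, ∀ j, p.inv θ u j = Q θ j (u j)

/-- Every component `X_j` is sub-exponential with parameter `κ_j`. -/
def Problem.SubExp {d q : ℕ} (p : Problem d q) (κ : Fin q → ℝ) : Prop :=
  (∀ j, 0 < κ j) ∧ ∃ C : ℝ, ∀ θ ∈ p.Θ, ∀ j, ∀ y : ℝ, 0 ≤ y →
    (p.law θ).real {x | y ≤ |x j|} ≤ C * Real.exp (-(κ j * y))

/-- Every component `X_j` is sub-Gaussian with parameter `ξ_j`. -/
def Problem.SubGauss {d q : ℕ} (p : Problem d q) (ξ : Fin q → ℝ) : Prop :=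
  (∀ j, 0 < ξ j) ∧ ∃ C : ℝ, ∀ θ ∈ p.Θ, ∀ j, ∀ y : ℝ, 0 ≤ y →
    (p.law θ).real {x | y ≤ |x j|} ≤ C * Real.exp (-(y / ξ j) ^ 2)

/-- `F` and its gradient in `x` grow at most polynomially on the support of `X`. -/
def Problem.PolyGrowth {d q : ℕ} (p : Problem d q) (a : Fin q → ℕ) : Prop :=
  ∃ C : ℝ, ∀ θ ∈ p.Θ, ∀ x ∈ p.inv θ '' openCube q,
    |p.F θ x| ≤ C * (1 + ∑ j, |x j| ^ a j) ∧ ‖fderiv ℝ (p.F θ) x‖ ≤ C * (1 + ∑ j, |x j| ^ a j)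

/-- `F` and its gradient in `x` grow at most exponentially on the support of `X`. -/
def Problem.ExpGrowth {d q : ℕ} (p : Problem d q) (b : Fin q → ℝ) : Prop :=
  ∃ C : ℝ, ∀ θ ∈ p.Θ, ∀ x ∈ p.inv θ '' openCube q,
    |p.F θ x| ≤ C * Real.exp (∑ j, b j * x j) ∧
    ‖fderiv ℝ (p.F θ) x‖ ≤ C * Real.exp (∑ j, b j * x j)

/-- The five specifications, with their parameters. -/
inductive Regime (q : ℕ)
  | bounded
  | subExpPoly (κ : Fin q → ℝ) (a : Fin q → ℕ) (rho : ℝ)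
  | subExpExp (κ : Fin q → ℝ) (b : Fin q → ℝ)
  | subGaussPoly (ξ : Fin q → ℝ) (a : Fin q → ℕ) (rho : ℝ)
  | subGaussExp (ξ : Fin q → ℝ) (b : Fin q → ℝ) (rho : ℝ)

/-- `κ_min = min_j κ_j`. -/
noncomputable def kappaMin {q : ℕ} (κ : Fin q → ℝ) : ℝ := ⨅ j, κ j

/-- `b_max = max_j |b_j|`. -/
noncomputable def bMax {q : ℕ} (b : Fin q → ℝ) : ℝ := ⨆ j, |b j|

/-- What a specification requires of the problem. -/
def Regime.Holds {d q : ℕ} (p : Problem d q) : Regime q → Prop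
  | .bounded => p.BoundedMap
  | .subExpPoly κ a rho => 0 < rho ∧ p.IndepMargins ∧ p.SubExp κ ∧ p.PolyGrowth a
  | .subExpExp κ b =>
      b ≠ 0 ∧ 2 * bMax b < kappaMin κ ∧ p.IndepMargins ∧ p.SubExp κ ∧ p.ExpGrowth b
  | .subGaussPoly ξ a rho => 0 < rho ∧ p.IndepMargins ∧ p.SubGauss ξ ∧ p.PolyGrowth a
  | .subGaussExp ξ b rho => 0 < rho ∧ p.IndepMargins ∧ p.SubGauss ξ ∧ p.ExpGrowth b

/-- The deflating sequence `λ_k` of the sampling rule. -/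
noncomputable def Regime.lam {q : ℕ} (δ : ℝ) (k : ℕ) : Regime q → ℝ
  | .bounded => (k : ℝ) ^ ((1 + δ) * q / (q + 2))
  | .subExpPoly _ _ _ => (k : ℝ) ^ ((1 + δ) * q / (q + 1))
  | .subExpExp κ b =>
      (k : ℝ) ^ ((1 + δ) * q * kappaMin κ / ((q + 1) * kappaMin κ - 2 * bMax b))
  | .subGaussPoly _ _ _ => (k : ℝ) ^ ((1 + δ) * q / (q + 1))
  | .subGaussExp _ _ _ => (k : ℝ) ^ ((1 + δ) * q / (q + 1))

/-- The exponent `γ` of the trust-region radius in the sampling rule. -/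
noncomputable def Regime.gam {q : ℕ} : Regime q → ℝ
  | .bounded => 2 * q / (q + 2)
  | .subExpPoly _ _ rho => (4 + rho) * q / (2 * (q + 1))
  | .subExpExp κ b => 2 * q * kappaMin κ / ((q + 1) * kappaMin κ - 2 * bMax b)
  | .subGaussPoly _ _ rho => (4 + rho) * q / (2 * (q + 1))
  | .subGaussExp _ _ rho => (4 + rho) * q / (2 * (q + 1))

/-! ### Stratified sampling with adaptive sample size -/

/-- The points evaluated in one iteration: the center, the interpolation points `θ ± Δ e_j`, and
the candidate solution. -/
inductive Pt (d : ℕ)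
  | center
  | plus (j : Fin d)
  | minus (j : Fin d)
  | cand

/-- The position of a point in `ℝ^d`. -/
noncomputable def Pt.pos {d : ℕ} (θ : Vec d) (Δ : ℝ) (s : Vec d) : Pt d → Vec d
  | .center => θ
  | .plus j => θ + Δ • EuclideanSpace.single j (1 : ℝ)
  | .minus j => θ - Δ • EuclideanSpace.single j (1 : ℝ)
  | .cand => s

/-- The label of one uniform draw: iteration, point, number `split` of splits per dimension (so
that there are `split ^ q` strata), stratum (an element of `{0, …, split - 1}^q`), and number of
the draw in the stratum. -/
structure DrawIdx (d q : ℕ) where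
  iter : ℕ
  pt : Pt d
  split : ℕ
  cell : Fin q → ℕ
  draw : ℕ

/-- The strata `{0, …, l - 1}^q`; the cell `c` is the cube with lower corner `c / l`, side `1 / l`. -/
def cells (q l : ℕ) : Finset (Fin q → ℕ) := Fintype.piFinset fun _ => Finset.range l

/-- The draw `(c + v) / l` in the stratum `c`, for `v` in the unit cube. -/
noncomputable def inCell {q : ℕ} (l : ℕ) (c : Fin q → ℕ) (v : Fin q → ℝ) : Fin q → ℝ :=
  fun j => ((c j : ℝ) + v j) / l

/-- The sample average in the stratum `c` from `m` draws, where `G u` is the value of the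
integrand at the point of the cube `u`. -/
noncomputable def cellMean {q : ℕ} (G : (Fin q → ℝ) → ℝ) (m l : ℕ) (c : Fin q → ℕ)
    (v : ℕ → Fin q → ℝ) : ℝ :=
  (∑ r ∈ Finset.range m, G (inCell l c (v r))) / m

/-- The sample variance in the stratum `c` from `m` draws. -/
noncomputable def cellVar {q : ℕ} (G : (Fin q → ℝ) → ℝ) (m l : ℕ) (c : Fin q → ℕ)
    (v : ℕ → Fin q → ℝ) : ℝ :=
  (∑ r ∈ Finset.range m, (G (inCell l c (v r)) - cellMean G m l c v) ^ 2) / ((m : ℝ) - 1)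

/-- The stratified estimator: the average over the `l ^ q` strata of the sample averages. -/
noncomputable def stratMean {q : ℕ} (G : (Fin q → ℝ) → ℝ) (m l : ℕ)
    (v : (Fin q → ℕ) → ℕ → Fin q → ℝ) : ℝ :=
  (∑ c ∈ cells q l, cellMean G m l c (v c)) / (l : ℝ) ^ q

/-- The average over the `l ^ q` strata of the sample variances. -/
noncomputable def stratVar {q : ℕ} (G : (Fin q → ℝ) → ℝ) (m l : ℕ)
    (v : (Fin q → ℕ) → ℕ → Fin q → ℝ) : ℝ :=
  (∑ c ∈ cells q l, cellVar G m l c (v c)) / (l : ℝ) ^ q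

/-- The constants of the algorithm. -/
structure Params where
  Δ0 : ℝ
  Δmax : ℝ
  η : ℝ
  ηg : ℝ
  shrink : ℝ
  expand : ℝ
  varMin : ℝ
  κas : ℝ
  nbar : ℕ
  Δ0_pos : 0 < Δ0
  Δmax_pos : 0 < Δmax
  η_pos : 0 < η
  η_lt_one : η < 1
  ηg_pos : 0 < ηg
  shrink_pos : 0 < shrink
  shrink_lt_one : shrink < 1
  one_lt_expand : 1 < expand
  varMin_pos : 0 < varMin
  κas_pos : 0 < κas
  two_le_nbar : 2 ≤ nbar

/-- The sampling rule at radius `Δ`: the admissible sample size `n = nbar * l ^ q` satisfies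
`n ≥ λ` and `√(max (σ²_min, stratVar) / n) ≤ κ_as Δ^γ / √λ`, where the last bound is `+∞` for
`λ = 0` (hence the multiplied form). -/
def SamplingRule {q : ℕ} (A : Params) (lam gam Δ : ℝ) (G : (Fin q → ℝ) → ℝ) (l : ℕ)
    (v : (Fin q → ℕ) → ℕ → Fin q → ℝ) : Prop :=
  1 ≤ l ∧ lam ≤ (A.nbar : ℝ) * (l : ℝ) ^ q ∧
  √lam * √(max A.varMin (stratVar G A.nbar l v) / ((A.nbar : ℝ) * (l : ℝ) ^ q)) ≤ A.κas * Δ ^ gam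

/-- The least number of splits per dimension that satisfies the sampling rule, when the draws for
`l` splits are `v l`. -/
noncomputable def splits {q : ℕ} (A : Params) (lam gam Δ : ℝ) (G : (Fin q → ℝ) → ℝ)
    (v : ℕ → (Fin q → ℕ) → ℕ → Fin q → ℝ) : ℕ :=
  sInf {l | SamplingRule A lam gam Δ G l (v l)}

/-- The estimate of the objective obtained with the adaptive sample size. -/
noncomputable def adaptiveEstimate {q : ℕ} (A : Params) (lam gam Δ : ℝ) (G : (Fin q → ℝ) → ℝ)
    (v : ℕ → (Fin q → ℕ) → ℕ → Fin q → ℝ) : ℝ :=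
  stratMean G A.nbar (splits A lam gam Δ G v) (v (splits A lam gam Δ G v))

/-! ### The trust-region algorithm -/

/-- The diagonal quadratic model `c + ∑_j g_j (x - θ)_j + ½ ∑_j h_j (x - θ)_j²`. -/
noncomputable def dqModel {d : ℕ} (θ : Vec d) (c : ℝ) (g h : Fin d → ℝ) (x : Vec d) : ℝ :=
  c + ∑ j, g j * (x j - θ j) + ∑ j, h j * ((x j - θ j) ^ 2 / 2)

/-- The information available when the candidate of iteration `k` is computed: all draws of
earlier iterations, and those of iteration `k` at the center and the interpolation points. -/
abbrev history {Ω : Type*} {d q : ℕ} (V : DrawIdx d q → Ω → Fin q → ℝ) (k : ℕ) :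
    MeasurableSpace Ω :=
  ⨆ t ∈ {t : DrawIdx d q | t.iter < k ∨ (t.iter = k ∧ t.pt ≠ Pt.cand)},
    MeasurableSpace.comap (V t) inferInstance

/-- The random quantities of the algorithm: iterate, radius, candidate, model coefficients. -/
structure Iterates (Ω : Type*) (d : ℕ) where
  θ : ℕ → Ω → Vec d
  Δ : ℕ → Ω → ℝ
  s : ℕ → Ω → Vec d
  c : ℕ → Ω → ℝ
  g : ℕ → Ω → Fin d → ℝ
  h : ℕ → Ω → Fin d → ℝ

/-- The model `M_k`. -/
noncomputable def Iterates.M {Ω : Type*} {d : ℕ} (R : Iterates Ω d) (k : ℕ) (ω : Ω) :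
    Vec d → ℝ :=
  dqModel (R.θ k ω) (R.c k ω) (R.g k ω) (R.h k ω)

/-- The estimate of the objective at the point `i` of iteration `k`. -/
noncomputable def Iterates.est {Ω : Type*} {d q : ℕ} (R : Iterates Ω d) (p : Problem d q)
    (A : Params) (lam : ℕ → ℝ) (gam : ℝ) (V : DrawIdx d q → Ω → Fin q → ℝ)
    (k : ℕ) (i : Pt d) (ω : Ω) : ℝ :=
  adaptiveEstimate A (lam k) gam (R.Δ k ω)
    (fun u => p.F (i.pos (R.θ k ω) (R.Δ k ω) (R.s k ω))
      (p.inv (i.pos (R.θ k ω) (R.Δ k ω) (R.s k ω)) u))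
    (fun l c r => V ⟨k, i, l, c, r⟩ ω)

/-- Iteration `k` is successful: the acceptance ratio is at least `η` and the radius is at most
`ηg` times the norm of the model gradient. -/
def Iterates.Success {Ω : Type*} {d q : ℕ} (R : Iterates Ω d) (p : Problem d q)
    (A : Params) (lam : ℕ → ℝ) (gam : ℝ) (V : DrawIdx d q → Ω → Fin q → ℝ)
    (k : ℕ) (ω : Ω) : Prop :=
  A.η ≤ (R.est p A lam gam V k Pt.center ω - R.est p A lam gam V k Pt.cand ω) /
      (R.M k ω (R.θ k ω) - R.M k ω (R.s k ω)) ∧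
  R.Δ k ω ≤ A.ηg * ‖gradient (R.M k ω) (R.θ k ω)‖

/-- `R` is produced by the algorithm started at `θ0`, from the draws `V`. -/
structure Iterates.IsRun {Ω : Type*} {d q : ℕ} (R : Iterates Ω d) (p : Problem d q)
    (A : Params) (lam : ℕ → ℝ) (gam : ℝ) (V : DrawIdx d q → Ω → Fin q → ℝ) (θ0 : Vec d) :
    Prop where
  θ_zero : ∀ ω, R.θ 0 ω = θ0
  Δ_zero : ∀ ω, R.Δ 0 ω = A.Δ0
  /-- the trust regions lie in `Θ` -/
  region_subset : ∀ k ω, Metric.closedBall (R.θ k ω) (R.Δ k ω) ⊆ p.Θ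
  /-- the model interpolates the estimates at the center and at `θ ± Δ e_j` -/
  interpolates : ∀ k ω, ∀ i : Pt d, i ≠ Pt.cand →
    R.M k ω (i.pos (R.θ k ω) (R.Δ k ω) (R.s k ω)) = R.est p A lam gam V k i ω
  /-- the candidate minimizes the model over the trust region -/
  cand_mem : ∀ k ω, R.s k ω ∈ Metric.closedBall (R.θ k ω) (R.Δ k ω)
  cand_min : ∀ k ω, IsMinOn (R.M k ω) (Metric.closedBall (R.θ k ω) (R.Δ k ω)) (R.s k ω)
  /-- ties between minimizers are broken without knowledge of later draws -/
  cand_measurable : ∀ k, Measurable[history V k] (R.s k)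
  success : ∀ k ω, R.Success p A lam gam V k ω →
    R.θ (k + 1) ω = R.s k ω ∧ R.Δ (k + 1) ω = min (A.expand * R.Δ k ω) A.Δmax
  failure : ∀ k ω, ¬ R.Success p A lam gam V k ω →
    R.θ (k + 1) ω = R.θ k ω ∧ R.Δ (k + 1) ω = A.shrink * R.Δ k ω

/-- `T_ε = inf {k : ‖∇f(θ_k)‖ ≤ ε}`, which is `⊤` if there is no such `k`. -/
noncomputable def firstHit {Ω : Type*} {d q : ℕ} (R : Iterates Ω d) (p : Problem d q) (ε : ℝ)
    (ω : Ω) : ℕ∞ :=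
  sInf ((fun k : ℕ => (k : ℕ∞)) '' {k | ‖gradient p.f (R.θ k ω)‖ ≤ ε})

end SASTRO

/-! The proof has a deterministic half and a probabilistic half.

Deterministic half. Suppose that from some iteration on every estimate is within `a * Δ ^ 2` of `f`,
for a suitable fixed `a`. Then the model is accurate to first order: a radius below a fixed multiple
of the gradient norm forces success, and every success lowers `f` by a multiple of `Δ ^ 2`
(`exists_iteration_constants`). Since `f` is bounded below, the squared radii are summable
(`sum_sq_radius_le`). As long as the gradient norm exceeds `ε`, the radius stays above a multiple of
`ε` (`radius_lower_bound`), so only `O(ε⁻²)` iterations fit into this sum (`hitting_time_isBigO`).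

Probabilistic half. The required accuracy for all late iterations comes from Borel–Cantelli. With
`l` splits the stratified mean has variance `avgVar G l / (nbar * l ^ q)`. If `avgVar` is of order
`l ^ (-r)`, this is of order `n ^ (-s)` with `n = nbar * l ^ q` and `s = (q + r) / q`. The sampling
rule forces `n` to be at least of order `λ_k Δ ^ (-2γ)`, so Chebyshev at level `a Δ ^ 2` gives the
bound `λ_k ^ (-s) Δ ^ (2γs - 4)`. Each specification is tuned so that `λ_k ^ s` is a power of `k`
above the first and `2γs ≥ 4` (`Regime.Holds.exists_rate`). The radius is bounded, so the bound is
summable in `k`.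

The rate `r` is 2 for bounded maps, where the integrand is Lipschitz on the cube. For unbounded
independent margins with tails `e^{-κy}` and gradient growth `e^{β|x|}` it is `1 - 2β/κ`: the
variance is split by resampling one coordinate at a time, and in that coordinate squared increments
of a monotone function telescope over the cells (`sum_lintegral_cell_diff_le`).

Two dependences have to be removed. The sample size depends on the draws; but past a deterministic
number of splits `L` each trial fails with probability at most 1/2, independently of later trials,
which costs only a geometric series (`measure_stopped_le`). The evaluated point is random too; but
its draws are independent of what determines it, so it may be frozen (`measure_fresh_le`). -/

namespace SASTRO

/-! ### The diagonal quadratic model -/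

theorem dqModel_center {d : ℕ} (θ : Vec d) (c : ℝ) (g h : Fin d → ℝ) :
    dqModel θ c g h θ = c := by
  simp [dqModel]

theorem dqModel_plus {d : ℕ} (θ : Vec d) (c : ℝ) (g h : Fin d → ℝ) (t : ℝ) (j : Fin d) :
    dqModel θ c g h (θ + t • EuclideanSpace.single j (1 : ℝ)) = c + t * g j + t ^ 2 / 2 * h j := by
  have e : ∀ i, (θ + t • EuclideanSpace.single j (1 : ℝ)) i - θ i = if i = j then t else 0 := by
    intro i
    by_cases hij : i = j <;> simp [hij]
  simp only [dqModel, e]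
  simp [ite_pow, ite_div]
  ring

theorem dqModel_minus {d : ℕ} (θ : Vec d) (c : ℝ) (g h : Fin d → ℝ) (t : ℝ) (j : Fin d) :
    dqModel θ c g h (θ - t • EuclideanSpace.single j (1 : ℝ)) = c - t * g j + t ^ 2 / 2 * h j := by
  have := dqModel_plus θ c g h (-t) j
  rw [neg_smul, ← sub_eq_add_neg] at this
  rw [this]
  ring

theorem dqModel_eq_inner {d : ℕ} (θ : Vec d) (c : ℝ) (g h : Fin d → ℝ) (x : Vec d) :
    dqModel θ c g h x = c + inner ℝ (WithLp.toLp 2 g : Vec d) (x - θ)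
      + ∑ j, h j * ((x j - θ j) ^ 2 / 2) := by
  simp [dqModel, PiLp.inner_apply, mul_comm]

theorem abs_sum_quadratic_le {d : ℕ} (θ x : Vec d) (h : Fin d → ℝ) {H : ℝ}
    (hH : ∀ j, |h j| ≤ H) :
    |∑ j, h j * ((x j - θ j) ^ 2 / 2)| ≤ H / 2 * ‖x - θ‖ ^ 2 := by
  rw [EuclideanSpace.norm_sq_eq, Finset.mul_sum]
  refine (Finset.abs_sum_le_sum_abs _ _).trans (Finset.sum_le_sum fun j _ => ?_)
  rw [abs_mul, abs_of_nonneg (by positivity : 0 ≤ (x j - θ j) ^ 2 / 2)]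
  have : ‖(x - θ) j‖ ^ 2 = (x j - θ j) ^ 2 := by simp
  rw [this]
  nlinarith [hH j, sq_nonneg (x j - θ j)]

theorem gradient_dqModel {d : ℕ} (θ : Vec d) (c : ℝ) (g h : Fin d → ℝ) :
    gradient (dqModel θ c g h) θ = WithLp.toLp 2 g := by
  apply HasGradientAt.gradient
  rw [hasGradientAt_iff_isLittleO]
  obtain ⟨H, hH⟩ : ∃ H, ∀ j, |h j| ≤ H :=
    ⟨∑ j, |h j|, fun j => Finset.single_le_sum (f := fun j => |h j|)
      (fun _ _ => abs_nonneg _) (Finset.mem_univ j)⟩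
  -- The remainder after the linear part is the diagonal quadratic form, hence `O(‖x - θ‖ ^ 2)`.
  have hO : (fun x : Vec d => dqModel θ c g h x - dqModel θ c g h θ
      - inner ℝ (WithLp.toLp 2 g : Vec d) (x - θ)) =O[𝓝 θ] fun x => ‖x - θ‖ ^ 2 := by
    refine IsBigO.of_bound (H / 2) (Eventually.of_forall fun x => ?_)
    rw [dqModel_center, dqModel_eq_inner]
    have := abs_sum_quadratic_le θ x h hH
    rw [Real.norm_eq_abs, Real.norm_eq_abs, abs_of_nonneg (by positivity : 0 ≤ ‖x - θ‖ ^ 2)]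
    convert this using 2
    ring
  refine hO.trans_isLittleO ?_
  have h1 : Tendsto (fun x : Vec d => x - θ) (𝓝 θ) (𝓝 0) := by
    have : Continuous fun x : Vec d => x - θ := by fun_prop
    simpa using this.tendsto θ
  exact (isLittleO_norm_pow_id (E' := Vec d) one_lt_two).comp_tendsto h1

/-- Decrease of the model at a minimizer over the trust region (Cauchy point). -/
theorem dqModel_decrease {d : ℕ} {θ s : Vec d} {c : ℝ} {g h : Fin d → ℝ} {H D : ℝ} (hH0 : 0 < H)
    (hD : 0 < D) (hH : ∀ j, |h j| ≤ H)
    (hs : IsMinOn (dqModel θ c g h) (Metric.closedBall θ D) s) :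
    ‖(WithLp.toLp 2 g : Vec d)‖ / 2 * min D (‖(WithLp.toLp 2 g : Vec d)‖ / H)
      ≤ dqModel θ c g h θ - dqModel θ c g h s := by
  set gv : Vec d := WithLp.toLp 2 g
  rcases eq_or_ne gv 0 with h0 | h0
  · have : dqModel θ c g h s ≤ dqModel θ c g h θ := hs (Metric.mem_closedBall_self hD.le)
    simp [h0, this]
  have hg : 0 < ‖gv‖ := norm_pos_iff.mpr h0
  -- Cauchy step along `-gv`: `1 / H` minimizes the majorant `-t ‖gv‖² + H t² ‖gv‖² / 2`, and `D /
  -- ‖gv‖` keeps the step in the ball.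
  set t : ℝ := min (D / ‖gv‖) (1 / H)
  have ht : 0 < t := by positivity
  have htD : t * ‖gv‖ ≤ D := by
    have : t ≤ D / ‖gv‖ := min_le_left _ _
    rwa [le_div_iff₀ hg] at this
  have htH : t * H ≤ 1 := by
    have : t ≤ 1 / H := min_le_right _ _
    rwa [le_div_iff₀ hH0] at this
  have hmem : θ - t • gv ∈ Metric.closedBall θ D := by
    rw [Metric.mem_closedBall, dist_eq_norm, sub_sub_cancel_left, norm_neg, norm_smul,
      Real.norm_eq_abs, abs_of_pos ht]
    exact htD
  have h1 : dqModel θ c g h s ≤ dqModel θ c g h (θ - t • gv) := hs hmem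
  have h2 := abs_sum_quadratic_le θ (θ - t • gv) h hH
  have h3 := dqModel_eq_inner θ c g h (θ - t • gv)
  rw [sub_sub_cancel_left] at h2 h3
  rw [norm_neg, norm_smul, Real.norm_eq_abs, abs_of_pos ht] at h2
  rw [inner_neg_right, inner_smul_right, real_inner_self_eq_norm_sq] at h3
  have h4 := le_abs_self (∑ j, h j * (((θ - t • gv) j - θ j) ^ 2 / 2))
  rw [dqModel_center]
  have e : ‖gv‖ / 2 * min D (‖gv‖ / H) = t * ‖gv‖ ^ 2 / 2 := by
    have : min D (‖gv‖ / H) = t * ‖gv‖ := by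
      rw [min_mul_of_nonneg _ _ hg.le]
      congr 1 <;> field_simp
    rw [this]; ring
  rw [e]
  have h5 : H / 2 * (t * ‖gv‖) ^ 2 ≤ t * ‖gv‖ ^ 2 / 2 := by
    have : H / 2 * (t * ‖gv‖) ^ 2 = (t * H) * (t * ‖gv‖ ^ 2 / 2) := by ring
    rw [this]
    exact mul_le_of_le_one_left (by positivity) htH
  linarith

/-! ### One iteration with accurate estimates -/

/-- First-order Taylor bound for a function with Lipschitz gradient. -/
theorem taylor_of_lipschitz_gradient {d : ℕ} {f : Vec d → ℝ} {S : Set (Vec d)} {K : NNReal}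
    (hd : ∀ x ∈ S, DifferentiableAt ℝ f x) (hK : LipschitzOnWith K (gradient f) S)
    {x y : Vec d} {D : ℝ} (hD : 0 ≤ D) (hS : Metric.closedBall x D ⊆ S)
    (hy : y ∈ Metric.closedBall x D) :
    |f y - f x - inner ℝ (gradient f x) (y - x)| ≤ K * D ^ 2 := by
  have hx : x ∈ Metric.closedBall x D := Metric.mem_closedBall_self hD
  have hgrad : ∀ z ∈ S, HasFDerivAt f (InnerProductSpace.toDual ℝ (Vec d) (gradient f z)) z :=
    fun z hz => (hd z hz).hasGradientAt.hasFDerivAt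
  -- Mean value inequality for `f` minus its linear part, whose derivative is at most `K * D` on the
  -- ball. The lost factor 1/2 is harmless.
  have := Convex.norm_image_sub_le_of_norm_hasFDerivWithin_le' (𝕜 := ℝ) (f := f)
    (f' := fun z => InnerProductSpace.toDual ℝ (Vec d) (gradient f z))
    (φ := InnerProductSpace.toDual ℝ (Vec d) (gradient f x)) (C := K * D)
    (s := Metric.closedBall x D) (fun z hz => (hgrad z (hS hz)).hasFDerivWithinAt)
    (fun z hz => ?_) (convex_closedBall x D) hx hy
  · rw [InnerProductSpace.toDual_apply_apply, Real.norm_eq_abs] at this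
    refine this.trans ?_
    have h2 : ‖y - x‖ ≤ D := by rwa [← dist_eq_norm]
    have : (0 : ℝ) ≤ K := K.2
    rw [sq, ← mul_assoc]
    gcongr
  · rw [← map_sub, LinearIsometryEquiv.norm_map, ← dist_eq_norm]
    refine (hK.dist_le_mul z (hS hz) x (hS hx)).trans ?_
    gcongr
    exact hz

theorem Pt.pos_mem_closedBall {d : ℕ} {θ s : Vec d} {D : ℝ} (hD : 0 ≤ D)
    (hs : s ∈ Metric.closedBall θ D) (i : Pt d) : i.pos θ D s ∈ Metric.closedBall θ D := by
  cases i <;> simp [Pt.pos, hD, abs_of_nonneg, norm_smul, dist_eq_norm]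
  simpa [dist_eq_norm] using hs

/-- The outcome of an iteration: the acceptance test of the algorithm. -/
def Accepts {d : ℕ} (A : Params) (θ s : Vec d) (D c : ℝ) (g h : Fin d → ℝ) (E : Pt d → ℝ) : Prop :=
  A.η ≤ (E Pt.center - E Pt.cand) / (dqModel θ c g h θ - dqModel θ c g h s) ∧
    D ≤ A.ηg * ‖gradient (dqModel θ c g h) θ‖

theorem norm_le_of_abs_coord_le {d : ℕ} (x : Vec d) {b : ℝ} (hb : 0 ≤ b) (hx : ∀ j, |x j| ≤ b) :
    ‖x‖ ≤ d * b := by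
  have h1 : ‖x‖ ^ 2 ≤ (d * b) ^ 2 := by
    rw [EuclideanSpace.norm_sq_eq]
    calc ∑ i, ‖x i‖ ^ 2 ≤ ∑ _i : Fin d, b ^ 2 :=
          Finset.sum_le_sum fun i _ => pow_le_pow_left₀ (norm_nonneg _) (hx i) 2
      _ = d * b ^ 2 := by simp
      _ ≤ (d * b) ^ 2 := by
          rw [mul_pow]
          gcongr
          exact_mod_cast Nat.le_self_pow two_ne_zero d
  exact le_of_sq_le_sq h1 (by positivity)

/-- Interpolation errors of the model built from estimates with error `a D²`. -/
theorem model_coeff_bounds {d : ℕ} {f : Vec d → ℝ} {K a D c : ℝ} {θ s : Vec d}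
    {g h : Fin d → ℝ} {E : Pt d → ℝ} (hK : 0 ≤ K) (ha : 0 ≤ a) (hD : 0 < D)
    (hint : ∀ i : Pt d, i ≠ Pt.cand → dqModel θ c g h (i.pos θ D s) = E i)
    (herr : ∀ i : Pt d, |E i - f (i.pos θ D s)| ≤ a * D ^ 2)
    (htay : ∀ y ∈ Metric.closedBall θ D,
      |f y - f θ - inner ℝ (gradient f θ) (y - θ)| ≤ K * D ^ 2)
    (hs : s ∈ Metric.closedBall θ D) :
    c = E Pt.center ∧ (∀ j, |h j| ≤ 2 * K + 4 * a) ∧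
      ‖(WithLp.toLp 2 g : Vec d) - gradient f θ‖ ≤ d * ((K + a) * D) := by
  have h0 := hint Pt.center (by simp)
  simp only [Pt.pos, dqModel_center] at h0
  have e0 := abs_le.mp (herr Pt.center)
  simp only [Pt.pos, ← h0] at e0
  -- Central differences: half the difference of the values at `θ ± D e_j` is `D g_j`, and their sum
  -- minus twice the central value is `D² h_j`.
  have key : ∀ j, |D * g j - D * gradient f θ j| ≤ (K + a) * D ^ 2 ∧
      |D ^ 2 * h j| ≤ (2 * K + 4 * a) * D ^ 2 := by
    intro j
    have hp := hint (Pt.plus j) (by simp)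
    have hm := hint (Pt.minus j) (by simp)
    simp only [Pt.pos, dqModel_plus, dqModel_minus] at hp hm
    have ep := abs_le.mp (herr (Pt.plus j))
    have em := abs_le.mp (herr (Pt.minus j))
    have tp := abs_le.mp (htay _ (Pt.pos_mem_closedBall hD.le hs (Pt.plus j)))
    have tm := abs_le.mp (htay _ (Pt.pos_mem_closedBall hD.le hs (Pt.minus j)))
    simp only [Pt.pos, add_sub_cancel_left, sub_sub_cancel_left, inner_neg_right,
      inner_smul_right, EuclideanSpace.inner_single_right, one_mul, conj_trivial] at ep em tp tm
    rw [← hp] at ep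
    rw [← hm] at em
    constructor <;> rw [abs_le] <;> constructor <;> linarith [ep.1, ep.2, em.1, em.2, tp.1, tp.2, tm.1, tm.2, e0.1, e0.2]
  refine ⟨h0, fun j => ?_, norm_le_of_abs_coord_le _ (by positivity) fun j => ?_⟩
  · have := (key j).2
    rw [abs_mul, abs_of_pos (by positivity : 0 < D ^ 2), mul_comm] at this
    exact le_of_mul_le_mul_right this (by positivity)
  · have := (key j).1
    rw [← mul_sub, abs_mul, abs_of_pos hD, mul_comm, sq, ← mul_assoc] at this
    simpa using le_of_mul_le_mul_right this hD

/-- With accurate estimates, a small radius leads to success and success to decrease of `f`. -/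
theorem exists_iteration_constants {d : ℕ} {f : Vec d → ℝ} {S : Set (Vec d)} {K : NNReal}
    (A : Params) (hd : ∀ x ∈ S, DifferentiableAt ℝ f x) (hK : LipschitzOnWith K (gradient f) S) :
    ∃ a μ c2 : ℝ, 0 < a ∧ 0 < μ ∧ 0 < c2 ∧
      ∀ (θ s : Vec d) (D c : ℝ) (g h : Fin d → ℝ) (E : Pt d → ℝ), 0 < D →
        Metric.closedBall θ D ⊆ S →
        (∀ i : Pt d, i ≠ Pt.cand → dqModel θ c g h (i.pos θ D s) = E i) →
        s ∈ Metric.closedBall θ D → IsMinOn (dqModel θ c g h) (Metric.closedBall θ D) s →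
        (∀ i : Pt d, |E i - f (i.pos θ D s)| ≤ a * D ^ 2) →
        (D ≤ μ * ‖gradient f θ‖ → Accepts A θ s D c g h E) ∧
        (Accepts A θ s D c g h E → c2 * D ^ 2 ≤ f θ - f s) := by
  have hη := A.η_pos
  have hη1 := A.η_lt_one
  have hηg := A.ηg_pos
  have hK0 : (0 : ℝ) ≤ K := K.2
  -- `H` and `B` are the bounds of `model_coeff_bounds` for `a ≤ 1`: curvature at most `H`, gradient
  -- error at most `B * D`.
  set H : ℝ := 2 * K + 4 with hHdef
  have hH : 0 < H := by positivity
  set B : ℝ := d * (K + 1) with hBdef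
  have hB : 0 ≤ B := by positivity
  -- `κf * D ^ 2` bounds the shortfall of the estimated decrease against the model decrease: two
  -- estimates, Taylor remainder, gradient error, quadratic term.
  set κf : ℝ := 2 + K + B + H / 2 with hκdef
  have hκ : 0 < κf := by positivity
  -- On acceptance `‖g‖ ≥ D / ηg`, so the Cauchy decrease times `η` is at least `c1 * D ^ 2`. Two
  -- estimation errors of size `c1 / 4` leave `c1 / 2`.
  set c1 : ℝ := A.η / (2 * A.ηg) * min 1 (1 / (A.ηg * H)) with hc1def
  have hc1 : 0 < c1 := by positivity
  have h1η : 0 < 1 - A.η := by linarith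
  -- The term `B` pays for passing from `∇f` to the model gradient. The other three give, in turn, a
  -- Cauchy step limited only by the ball, the radius test and the ratio test.
  set Z : ℝ := B + H + 1 / A.ηg + 2 * κf / (1 - A.η) with hZdef
  have hZ : 0 < Z := by positivity
  refine ⟨min 1 (c1 / 4), 1 / Z, c1 / 2, by positivity, by positivity, by positivity, ?_⟩
  intro θ s D c g h E hD hball hint hs hmin herr
  set a : ℝ := min 1 (c1 / 4) with hadef
  have ha : 0 < a := by positivity
  have ha1 : a ≤ 1 := min_le_left _ _
  have ha2 : a ≤ c1 / 4 := min_le_right _ _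
  have htay : ∀ y ∈ Metric.closedBall θ D,
      |f y - f θ - inner ℝ (gradient f θ) (y - θ)| ≤ K * D ^ 2 :=
    fun y hy => taylor_of_lipschitz_gradient hd hK hD.le hball hy
  obtain ⟨hc, hh, hg⟩ := model_coeff_bounds hK0 ha.le hD hint herr htay hs
  have hhH : ∀ j, |h j| ≤ H := fun j => (hh j).trans (by linarith)
  have hgB : ‖(WithLp.toLp 2 g : Vec d) - gradient f θ‖ ≤ B * D := by
    refine hg.trans ?_
    rw [hBdef, mul_assoc]
    gcongr
  have hdec := dqModel_decrease hH hD hhH hmin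
  set gv : Vec d := WithLp.toLp 2 g with hgv
  set m : ℝ := dqModel θ c g h θ - dqModel θ c g h s with hm
  have hD2 : 0 < D ^ 2 := by positivity
  have haD : a * D ^ 2 ≤ D ^ 2 := by nlinarith
  have hsn : ‖s - θ‖ ≤ D := by rwa [← dist_eq_norm]
  unfold Accepts
  rw [gradient_dqModel, ← hgv, ← hm]
  clear_value a
  constructor
  · intro hDμ
    have hDZ : D * Z ≤ ‖gradient f θ‖ := by
      rw [one_div, inv_mul_eq_div, le_div_iff₀ hZ] at hDμ
      exact hDμ
    have hgn : ‖gradient f θ‖ ≤ ‖gv‖ + B * D := by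
      have := norm_sub_norm_le (gradient f θ) gv
      rw [norm_sub_rev] at this
      linarith
    have hsum : D * H + D * (1 / A.ηg) + D * (2 * κf / (1 - A.η)) ≤ ‖gv‖ := by
      rw [hZdef] at hDZ
      linarith
    have p1 : 0 < D * H := by positivity
    have p2 : 0 < D * (1 / A.ηg) := by positivity
    have p3 : 0 < D * (2 * κf / (1 - A.η)) := by positivity
    have q1 : D ≤ ‖gv‖ / H := by rw [le_div_iff₀ hH]; linarith
    have q2 : D ≤ A.ηg * ‖gv‖ := by
      have : D * (1 / A.ηg) ≤ ‖gv‖ := by linarith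
      rw [mul_one_div, div_le_iff₀ hηg] at this
      linarith
    have q3 : 2 * κf * D ≤ (1 - A.η) * ‖gv‖ := by
      have : D * (2 * κf / (1 - A.η)) ≤ ‖gv‖ := by linarith
      rw [mul_div_assoc', div_le_iff₀ h1η] at this
      linarith
    refine ⟨?_, q2⟩
    rw [min_eq_left q1] at hdec
    have hgpos : 0 < ‖gv‖ := by linarith
    have hmpos : 0 < m := lt_of_lt_of_le (by positivity) hdec
    rw [le_div_iff₀ hmpos]
    have e1 := abs_le.mp (herr Pt.cand)
    have e0 := abs_le.mp (herr Pt.center)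
    simp only [Pt.pos] at e1 e0
    have t1 := abs_le.mp (htay s hs)
    have e2 := dqModel_eq_inner θ c g h s
    have e3 := abs_le.mp (abs_sum_quadratic_le θ s h hhH)
    have e4 : |inner ℝ (gv - gradient f θ) (s - θ)| ≤ B * D ^ 2 := by
      refine (abs_real_inner_le_norm _ _).trans ?_
      rw [sq, ← mul_assoc]
      gcongr
    rw [inner_sub_left] at e4
    have e4 := abs_le.mp e4
    have e5 : H / 2 * ‖s - θ‖ ^ 2 ≤ H / 2 * D ^ 2 := by gcongr
    have hm2 : m = c - dqModel θ c g h s := by rw [hm, dqModel_center]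
    have hlow : m - κf * D ^ 2 ≤ E Pt.center - E Pt.cand := by
      rw [hm2, e2, hκdef, ← hc]
      rw [← hc] at e0
      linarith [e1.1, e1.2, e0.1, e0.2, t1.1, t1.2, e3.1, e3.2, e4.1, e4.2]
    have : κf * D ^ 2 ≤ (1 - A.η) * m := by
      have h1 : (1 - A.η) * (‖gv‖ / 2 * D) ≤ (1 - A.η) * m := by gcongr
      have h2 : 2 * κf * D * D ≤ (1 - A.η) * ‖gv‖ * D := by gcongr
      linarith
    linarith
  · rintro ⟨hρ, hDg⟩
    have hgD : D / A.ηg ≤ ‖gv‖ := by rw [div_le_iff₀ hηg]; linarith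
    have hgpos : 0 < ‖gv‖ := lt_of_lt_of_le (by positivity) hgD
    have hmpos : 0 < m := lt_of_lt_of_le (by positivity) hdec
    rw [le_div_iff₀ hmpos] at hρ
    have e1 := abs_le.mp (herr Pt.cand)
    have e0 := abs_le.mp (herr Pt.center)
    simp only [Pt.pos] at e1 e0
    have hlow : c1 * D ^ 2 ≤ A.η * m := by
      have h1 : A.η * ((D / A.ηg) / 2 * min D ((D / A.ηg) / H))
          ≤ A.η * (‖gv‖ / 2 * min D (‖gv‖ / H)) := by gcongr
      have h2 : A.η * ((D / A.ηg) / 2 * min D ((D / A.ηg) / H)) = c1 * D ^ 2 := by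
        have : min D ((D / A.ηg) / H) = D * min 1 (1 / (A.ηg * H)) := by
          rw [mul_min_of_nonneg _ _ hD.le]
          congr 1
          · ring
          · field_simp
        rw [this, hc1def]
        field_simp
      have h3 : A.η * (‖gv‖ / 2 * min D (‖gv‖ / H)) ≤ A.η * m := by gcongr
      linarith
    have : a * D ^ 2 ≤ c1 / 4 * D ^ 2 := by gcongr
    linarith [e1.1, e1.2, e0.1, e0.2]

/-! ### Complexity of an abstract trust-region sequence -/

/-- The Lyapunov function `Δ ^ 2 + β * (F - m)` drops by at least `(1 - sh ^ 2) * Δ ^ 2` at each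
step. On failure this is the shrinking of the radius; on success `β = (ex ^ 2 - sh ^ 2) / c2` makes
the decrease of `F` pay for the expansion and as much again as a failure would give. -/
theorem sum_sq_radius_le {Δ F : ℕ → ℝ} {Succ : ℕ → Prop} {K0 : ℕ} {c2 m ex sh : ℝ}
    (hΔ : ∀ k, 0 < Δ k) (hc2 : 0 < c2) (hsh : 0 < sh) (hex : sh ≤ ex) (hm : ∀ k, m ≤ F k)
    (hS : ∀ k, K0 ≤ k → Succ k → c2 * Δ k ^ 2 ≤ F k - F (k + 1) ∧ Δ (k + 1) ≤ ex * Δ k)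
    (hN : ∀ k, K0 ≤ k → ¬ Succ k → F (k + 1) = F k ∧ Δ (k + 1) = sh * Δ k) (n : ℕ) :
    ∑ k ∈ Finset.Ico K0 (K0 + n), (1 - sh ^ 2) * Δ k ^ 2
      ≤ Δ K0 ^ 2 + (ex ^ 2 - sh ^ 2) / c2 * (F K0 - m) := by
  set β : ℝ := (ex ^ 2 - sh ^ 2) / c2 with hβ
  have hβ0 : 0 ≤ β := div_nonneg (by nlinarith) hc2.le
  have hβc : β * c2 = ex ^ 2 - sh ^ 2 := by rw [hβ]; field_simp
  have step : ∀ k, K0 ≤ k → (1 - sh ^ 2) * Δ k ^ 2 + (Δ (k + 1) ^ 2 + β * (F (k + 1) - m))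
      ≤ Δ k ^ 2 + β * (F k - m) := by
    intro k hk
    by_cases h : Succ k
    · obtain ⟨h1, h2⟩ := hS k hk h
      have h3 : Δ (k + 1) ^ 2 ≤ (ex * Δ k) ^ 2 := pow_le_pow_left₀ (hΔ _).le h2 2
      have h4 : β * (c2 * Δ k ^ 2) ≤ β * (F k - F (k + 1)) := by gcongr
      rw [← mul_assoc, hβc] at h4
      linarith
    · obtain ⟨h1, h2⟩ := hN k hk h
      rw [h1, h2]
      linarith
  have main : ∑ k ∈ Finset.Ico K0 (K0 + n), (1 - sh ^ 2) * Δ k ^ 2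
      + (Δ (K0 + n) ^ 2 + β * (F (K0 + n) - m)) ≤ Δ K0 ^ 2 + β * (F K0 - m) := by
    induction n with
    | zero => simp
    | succ n ih =>
      rw [← Nat.add_assoc K0 n 1, Finset.sum_Ico_succ_top (by omega)]
      have := step (K0 + n) (by omega)
      linarith
  have h0 : 0 ≤ β * (F (K0 + n) - m) := mul_nonneg hβ0 (by linarith [hm (K0 + n)])
  have := sq_nonneg (Δ (K0 + n))
  linarith

/-- A radius shrinks only after a failure, and a failure needs `Δ > μ φ > μ ε`. One shrinking step
therefore cannot pass below `sh * (μ * ε)`. -/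
theorem radius_lower_bound {Δ φ : ℕ → ℝ} {Succ : ℕ → Prop} {K0 n : ℕ} {μ ε ex sh Δm : ℝ}
    (hΔ : ∀ k, 0 < Δ k) (hμ : 0 < μ) (hsh : 0 < sh) (hex : 1 < ex)
    (hS : ∀ k, K0 ≤ k → Succ k → Δ (k + 1) = min (ex * Δ k) Δm)
    (hN : ∀ k, K0 ≤ k → ¬ Succ k → Δ (k + 1) = sh * Δ k)
    (hacc : ∀ k, K0 ≤ k → Δ k ≤ μ * φ k → Succ k)
    (hφ : ∀ k, k < n → ε < φ k) (h0 : sh * (μ * ε) ≤ Δ K0) (h1 : sh * (μ * ε) ≤ Δm) :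
    ∀ k, K0 ≤ k → k ≤ n → sh * (μ * ε) ≤ Δ k := by
  intro k hk
  induction k, hk using Nat.le_induction with
  | base => intro _; exact h0
  | succ k hk ih =>
    intro hkn
    have ih := ih (by omega)
    by_cases h : Succ k
    · rw [hS k hk h]
      refine le_min ?_ h1
      nlinarith [hΔ k]
    · rw [hN k hk h]
      have h2 : μ * φ k < Δ k := lt_of_not_ge fun h3 => h (hacc k hk h3)
      have h3 : μ * ε < μ * φ k := by
        have := hφ k (by omega)
        gcongr
      have : μ * ε ≤ Δ k := by linarith
      gcongr

/-- Each iteration after `K0` and before the hitting time adds at least `(1 - sh ^ 2) * (sh * μ * ε)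
^ 2` to a sum bounded by `Ψ`. The first `K0` iterations are uncontrolled and enter only through
their number. -/
theorem hitting_time_isBigO {Δ φ F : ℕ → ℝ} {Succ : ℕ → Prop} {K0 : ℕ} {μ c2 m ex sh Δm : ℝ}
    (hΔ : ∀ k, 0 < Δ k) (hμ : 0 < μ) (hc2 : 0 < c2) (hsh : 0 < sh) (hsh1 : sh < 1) (hex : 1 < ex)
    (hΔm : 0 < Δm) (hm : ∀ k, m ≤ F k)
    (hacc : ∀ k, K0 ≤ k → Δ k ≤ μ * φ k → Succ k)
    (hS : ∀ k, K0 ≤ k → Succ k → c2 * Δ k ^ 2 ≤ F k - F (k + 1) ∧ Δ (k + 1) = min (ex * Δ k) Δm)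
    (hN : ∀ k, K0 ≤ k → ¬ Succ k → F (k + 1) = F k ∧ Δ (k + 1) = sh * Δ k) :
    (∀ᶠ ε in 𝓝[>] (0 : ℝ), sInf ((fun k : ℕ => (k : ℕ∞)) '' {k | φ k ≤ ε}) ≠ ⊤) ∧
      (fun ε : ℝ => ((sInf ((fun k : ℕ => (k : ℕ∞)) '' {k | φ k ≤ ε})).toNat : ℝ))
        =O[𝓝[>] (0 : ℝ)] (fun ε : ℝ => ε ^ (-2 : ℤ)) := by
  set Ψ : ℝ := Δ K0 ^ 2 + (ex ^ 2 - sh ^ 2) / c2 * (F K0 - m)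
  have hsq : 0 < 1 - sh ^ 2 := by nlinarith
  set C : ℝ := Ψ / ((1 - sh ^ 2) * (sh * μ) ^ 2) with hC
  have hsum := sum_sq_radius_le (K0 := K0) hΔ hc2 hsh (hsh1.le.trans hex.le) hm
    (fun k hk hs => ⟨(hS k hk hs).1, (hS k hk hs).2.trans_le (min_le_left _ _)⟩) hN
  have hC0 : 0 ≤ C := by
    refine div_nonneg ?_ (by positivity)
    -- The empty sum shows `0 ≤ Ψ`.
    have := hsum 0
    simpa using this
  -- The radius at `K0` starts the induction for the lower bound, and `ε ≤ 1` lets `ε⁻²` absorb the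
  -- constant `K0`.
  have hev : ∀ᶠ ε in 𝓝[>] (0 : ℝ), 0 < ε ∧ ε ≤ 1 ∧ sh * (μ * ε) ≤ Δ K0 ∧ sh * (μ * ε) ≤ Δm := by
    have hb : 0 < min 1 (min (Δ K0) Δm / (sh * μ)) := by
      have := hΔ K0
      positivity
    filter_upwards [Ioc_mem_nhdsGT hb] with ε hε
    have h1 : ε ≤ min (Δ K0) Δm / (sh * μ) := hε.2.trans (min_le_right _ _)
    rw [le_div_iff₀ (by positivity)] at h1
    have e : sh * (μ * ε) = ε * (sh * μ) := by ring
    rw [e]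
    exact ⟨hε.1, hε.2.trans (min_le_left _ _), h1.trans (min_le_left _ _),
      h1.trans (min_le_right _ _)⟩
  have key : ∀ ε : ℝ, 0 < ε → ε ≤ 1 → sh * (μ * ε) ≤ Δ K0 → sh * (μ * ε) ≤ Δm → ∀ n : ℕ,
      (∀ k, k < n → ε < φ k) → (n : ℝ) ≤ (K0 + C) * ε ^ (-2 : ℤ) := by
    intro ε hε hε1 h0 h1 n hn
    have hε2 : (1 : ℝ) ≤ ε ^ (-2 : ℤ) := by
      rw [zpow_neg]
      exact one_le_inv_iff₀.mpr ⟨by positivity, by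
      exact_mod_cast pow_le_one₀ hε.le hε1 (n := 2)⟩
    rcases le_total n K0 with h | h
    · have : (n : ℝ) ≤ K0 := by exact_mod_cast h
      nlinarith
    · obtain ⟨r, rfl⟩ := Nat.exists_eq_add_of_le h
      have hlow := radius_lower_bound hΔ hμ hsh hex (fun k hk hs => (hS k hk hs).2)
        (fun k hk hs => (hN k hk hs).2) hacc hn h0 h1
      have h2 : ∑ _k ∈ Finset.Ico K0 (K0 + r), (1 - sh ^ 2) * (sh * (μ * ε)) ^ 2 ≤ Ψ := by
        refine le_trans (Finset.sum_le_sum fun k hk => ?_) (hsum r)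
        rw [Finset.mem_Ico] at hk
        have := hlow k hk.1 hk.2.le
        gcongr
      rw [Finset.sum_const, Nat.card_Ico, add_tsub_cancel_left, nsmul_eq_mul] at h2
      have h3 : (r : ℝ) ≤ C * ε ^ (-2 : ℤ) := by
        rw [hC, zpow_neg, ← div_eq_mul_inv, div_div, le_div_iff₀ (by positivity)]
        refine le_trans (le_of_eq ?_) h2
        norm_cast
        ring
      push_cast
      have h4 : (0 : ℝ) ≤ K0 := by positivity
      nlinarith
  have hfin : ∀ᶠ ε in 𝓝[>] (0 : ℝ), {k | φ k ≤ ε}.Nonempty := by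
    filter_upwards [hev] with ε ⟨hε, hε1, h0, h1⟩
    by_contra hne
    rw [Set.not_nonempty_iff_eq_empty, Set.eq_empty_iff_forall_notMem] at hne
    obtain ⟨n, hn⟩ := exists_nat_gt ((K0 + C) * ε ^ (-2 : ℤ))
    exact absurd (key ε hε hε1 h0 h1 n fun k _ => not_le.mp (hne k)) (not_le.mpr hn)
  have hval : ∀ ε : ℝ, {k | φ k ≤ ε}.Nonempty →
      sInf ((fun k : ℕ => (k : ℕ∞)) '' {k | φ k ≤ ε}) = ((sInf {k | φ k ≤ ε} : ℕ) : ℕ∞) := by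
    intro ε hne
    refine le_antisymm (sInf_le ⟨_, Nat.sInf_mem hne, rfl⟩) (le_sInf ?_)
    rintro _ ⟨k, hk, rfl⟩
    exact Nat.cast_le.mpr (Nat.sInf_le hk)
  refine ⟨?_, IsBigO.of_bound (K0 + C) ?_⟩
  · filter_upwards [hfin] with ε hne
    rw [hval ε hne]
    exact ENat.natCast_ne_top _
  · filter_upwards [hfin, hev] with ε hne ⟨hε, hε1, h0, h1⟩
    rw [hval ε hne, ENat.toNat_natCast, Real.norm_eq_abs, Real.norm_eq_abs, Nat.abs_cast,
      abs_of_pos (zpow_pos hε _)]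
    exact key ε hε hε1 h0 h1 _ fun k hk => not_le.mp (Nat.notMem_of_lt_sInf hk)

/-! ### Complexity of a run with eventually accurate estimates -/

theorem Iterates.IsRun.radius_pos {Ω : Type*} {d q : ℕ} {R : Iterates Ω d} {p : Problem d q}
    {A : Params} {lam : ℕ → ℝ} {gam : ℝ} {V : DrawIdx d q → Ω → Fin q → ℝ} {θ0 : Vec d}
    (hR : R.IsRun p A lam gam V θ0) (k : ℕ) (ω : Ω) : 0 < R.Δ k ω := by
  induction k with
  | zero => rw [hR.Δ_zero]; exact A.Δ0_pos
  | succ k ih =>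
    by_cases h : R.Success p A lam gam V k ω
    · rw [(hR.success k ω h).2]
      exact lt_min (mul_pos (zero_lt_one.trans A.one_lt_expand) ih) A.Δmax_pos
    · rw [(hR.failure k ω h).2]
      exact mul_pos A.shrink_pos ih

theorem Iterates.IsRun.radius_le {Ω : Type*} {d q : ℕ} {R : Iterates Ω d} {p : Problem d q}
    {A : Params} {lam : ℕ → ℝ} {gam : ℝ} {V : DrawIdx d q → Ω → Fin q → ℝ} {θ0 : Vec d}
    (hR : R.IsRun p A lam gam V θ0) (k : ℕ) (ω : Ω) : R.Δ k ω ≤ max A.Δ0 A.Δmax := by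
  induction k with
  | zero => rw [hR.Δ_zero]; exact le_max_left _ _
  | succ k ih =>
    by_cases h : R.Success p A lam gam V k ω
    · rw [(hR.success k ω h).2]
      exact (min_le_right _ _).trans (le_max_right _ _)
    · rw [(hR.failure k ω h).2]
      exact (mul_le_of_le_one_left (hR.radius_pos k ω).le A.shrink_lt_one.le).trans ih

theorem Iterates.IsRun.pos_mem {Ω : Type*} {d q : ℕ} {R : Iterates Ω d} {p : Problem d q}
    {A : Params} {lam : ℕ → ℝ} {gam : ℝ} {V : DrawIdx d q → Ω → Fin q → ℝ} {θ0 : Vec d}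
    (hR : R.IsRun p A lam gam V θ0) (k : ℕ) (ω : Ω) (i : Pt d) :
    i.pos (R.θ k ω) (R.Δ k ω) (R.s k ω) ∈ p.Θ :=
  hR.region_subset k ω (Pt.pos_mem_closedBall (hR.radius_pos k ω).le (hR.cand_mem k ω) i)

/-- The pathwise reduction. The accuracy `a` does not depend on `ω`, so Borel–Cantelli can later be
applied with this one value. -/
theorem exists_accuracy_complexity {Ω : Type*} {d q : ℕ} {R : Iterates Ω d} {p : Problem d q}
    (hp : p.Standing) {A : Params} {lam : ℕ → ℝ} {gam : ℝ} {V : DrawIdx d q → Ω → Fin q → ℝ}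
    {θ0 : Vec d} (hR : R.IsRun p A lam gam V θ0) :
    ∃ a : ℝ, 0 < a ∧ ∀ ω : Ω,
      (∀ᶠ k in atTop, ∀ i : Pt d, |R.est p A lam gam V k i ω
        - p.f (i.pos (R.θ k ω) (R.Δ k ω) (R.s k ω))| ≤ a * R.Δ k ω ^ 2) →
      (∀ᶠ ε in 𝓝[>] (0 : ℝ), firstHit R p ε ω ≠ ⊤) ∧
      (fun ε : ℝ => ((firstHit R p ε ω).toNat : ℝ)) =O[𝓝[>] (0 : ℝ)]
        (fun ε : ℝ => ε ^ (-2 : ℤ)) := by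
  obtain ⟨K, hK⟩ := hp.lipschitz_gradient
  obtain ⟨a, μ, c2, ha, hμ, hc2, hit⟩ := exists_iteration_constants A hp.differentiable hK
  refine ⟨a, ha, fun ω hω => ?_⟩
  obtain ⟨K0, hK0⟩ := eventually_atTop.mp hω
  obtain ⟨m, hm⟩ := hp.bddBelow
  have hstep := fun k (hk : K0 ≤ k) => hit (R.θ k ω) (R.s k ω) (R.Δ k ω) (R.c k ω) (R.g k ω)
    (R.h k ω) (fun i => R.est p A lam gam V k i ω) (hR.radius_pos k ω) (hR.region_subset k ω)
    (hR.interpolates k ω) (hR.cand_mem k ω) (hR.cand_min k ω) (hK0 k hk)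
  refine hitting_time_isBigO (Δ := fun k => R.Δ k ω)
    (φ := fun k => ‖gradient p.f (R.θ k ω)‖) (F := fun k => p.f (R.θ k ω))
    (Succ := fun k => R.Success p A lam gam V k ω) (K0 := K0) (m := m)
    (fun k => hR.radius_pos k ω) hμ hc2 A.shrink_pos A.shrink_lt_one A.one_lt_expand A.Δmax_pos
    (fun k => hm ⟨_, hR.pos_mem k ω Pt.center, rfl⟩) (fun k hk => (hstep k hk).1)
    (fun k hk hs => ?_) (fun k hk hs => ?_)
  · obtain ⟨h1, h2⟩ := hR.success k ω hs
    exact ⟨by rw [h1]; exact (hstep k hk).2 hs, h2⟩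
  · obtain ⟨h1, h2⟩ := hR.failure k ω hs
    exact ⟨by rw [h1], h2⟩

/-! ### The uniform distribution and its decomposition into strata -/

/-- The uniform distribution on `(0,1]`. -/
noncomputable def unif1 : Measure ℝ := volume.restrict (Set.Ioc 0 1)

instance : IsProbabilityMeasure unif1 := ⟨by simp [unif1]⟩

theorem unifCube_eq_pi (q : ℕ) : unifCube q = Measure.pi fun _ : Fin q => unif1 := by
  simp only [unifCube, unif1, volume_pi, Measure.restrict_pi_pi]

instance (q : ℕ) : IsProbabilityMeasure (unifCube q) := by
  rw [unifCube_eq_pi]; infer_instance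

theorem ae_unif1_mem : ∀ᵐ v ∂unif1, v ∈ Set.Ioo (0 : ℝ) 1 := by
  rw [unif1, ← Measure.restrict_congr_set (Ioo_ae_eq_Ioc (a := (0 : ℝ)) (b := 1))]
  exact ae_restrict_mem measurableSet_Ioo

theorem ae_unifCube_mem (q : ℕ) : ∀ᵐ v ∂unifCube q, v ∈ openCube q := by
  rw [unifCube_eq_pi]
  have : ∀ᵐ v ∂(Measure.pi fun _ : Fin q => unif1), ∀ j, v j ∈ Set.Ioo (0 : ℝ) 1 := by
    rw [ae_all_iff]
    intro j
    exact (measurePreserving_eval (fun _ : Fin q => unif1) j).quasiMeasurePreserving.ae ae_unif1_mem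
  filter_upwards [this] with v hv
  simpa [openCube] using hv

/-- The affine map of the unit interval onto the `c`-th of `l` cells. -/
noncomputable def inCell1 (l c : ℕ) (v : ℝ) : ℝ := ((c : ℝ) + v) / l

theorem measurable_inCell1 (l c : ℕ) : Measurable (inCell1 l c) := by
  unfold inCell1; fun_prop

theorem measurable_inCell {q : ℕ} (l : ℕ) (c : Fin q → ℕ) : Measurable (inCell l c) := by
  unfold inCell; fun_prop

theorem map_inCell1 {l : ℕ} (hl : 1 ≤ l) (c : ℕ) :
    unif1.map (inCell1 l c)
      = (l : ENNReal) • volume.restrict (Set.Ioc ((c : ℝ) / l) (((c + 1 : ℕ) : ℝ) / l)) := by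
  have hl0 : (0 : ℝ) < l := by exact_mod_cast hl
  have hpre : inCell1 l c ⁻¹' (Set.Ioc ((c : ℝ) / l) (((c + 1 : ℕ) : ℝ) / l)) = Set.Ioc 0 1 := by
    ext v
    simp only [inCell1, Set.mem_preimage, Set.mem_Ioc, Nat.cast_add, Nat.cast_one,
      div_lt_div_iff_of_pos_right hl0, div_le_div_iff_of_pos_right hl0]
    constructor <;> rintro ⟨h1, h2⟩ <;> constructor <;> linarith
  rw [unif1, ← hpre, ← Measure.restrict_map (measurable_inCell1 l c) measurableSet_Ioc,
    ← Measure.restrict_smul]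
  congr 1
  have e : inCell1 l c = (fun x : ℝ => x * (l : ℝ)⁻¹) ∘ (fun x : ℝ => (c : ℝ) + x) := by
    ext v; simp [inCell1, div_eq_mul_inv]
  rw [e, ← Measure.map_map (by fun_prop) (by fun_prop), map_add_left_eq_self,
    Real.map_volume_mul_right (by positivity)]
  simp

theorem sum_restrict_cells {l : ℕ} (hl : 1 ≤ l) (n : ℕ) :
    ∑ c ∈ Finset.range n, (volume : Measure ℝ).restrict
      (Set.Ioc ((c : ℝ) / l) (((c + 1 : ℕ) : ℝ) / l))
      = volume.restrict (Set.Ioc 0 ((n : ℝ) / l)) := by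
  have hl0 : (0 : ℝ) < l := by exact_mod_cast hl
  induction n with
  | zero => simp
  | succ n ih =>
    rw [Finset.sum_range_succ, ih, ← Measure.restrict_union
      (Set.Ioc_disjoint_Ioc_of_le le_rfl) measurableSet_Ioc, Set.Ioc_union_Ioc_eq_Ioc]
    · positivity
    · push_cast
      gcongr
      linarith

theorem sum_map_inCell1 {l : ℕ} (hl : 1 ≤ l) :
    ∑ c ∈ Finset.range l, unif1.map (inCell1 l c) = (l : ENNReal) • unif1 := by
  have hl0 : (l : ℝ) ≠ 0 := by positivity
  simp_rw [map_inCell1 hl]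
  rw [← Finset.smul_sum, sum_restrict_cells hl, div_self hl0, unif1]

theorem map_inCell {q : ℕ} (l : ℕ) (c : Fin q → ℕ) :
    (unifCube q).map (inCell l c) = Measure.pi fun j => unif1.map (inCell1 l (c j)) := by
  have : ∀ j, SigmaFinite (unif1.map (inCell1 l (c j))) := fun j =>
    have := Measure.isProbabilityMeasure_map (μ := unif1) (measurable_inCell1 l (c j)).aemeasurable
    inferInstance
  rw [unifCube_eq_pi]
  exact Measure.pi_map_pi (μ := fun _ : Fin q => unif1)
    (fun j => (measurable_inCell1 l (c j)).aemeasurable)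

/-- This identity makes the stratified mean unbiased. On a box, the sum over multi-indices of
products factors into one-dimensional sums, so the one-dimensional identity and uniqueness of
product measures suffice. -/
theorem sum_map_inCell {q l : ℕ} (hl : 1 ≤ l) :
    ∑ c ∈ cells q l, (unifCube q).map (inCell l c) = ((l : ENNReal) ^ q) • unifCube q := by
  have hl0 : (l : ENNReal) ^ q ≠ 0 := by
    have : (l : ENNReal) ≠ 0 := by exact_mod_cast (by omega : l ≠ 0)
    exact pow_ne_zero _ this
  have hl1 : (l : ENNReal) ^ q ≠ ⊤ := ENNReal.pow_ne_top (ENNReal.natCast_ne_top l)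
  have key : (Measure.pi fun _ : Fin q => unif1)
      = ((l : ENNReal) ^ q)⁻¹ • ∑ c ∈ cells q l, (unifCube q).map (inCell l c) := by
    apply Measure.pi_eq
    intro s hs
    have : ∀ c : Fin q → ℕ, ∀ j, SigmaFinite (unif1.map (inCell1 l (c j))) := fun c j =>
      have := Measure.isProbabilityMeasure_map (μ := unif1)
        (measurable_inCell1 l (c j)).aemeasurable
      inferInstance
    simp_rw [map_inCell]
    rw [Measure.smul_apply, Measure.finsetSum_apply]
    simp_rw [Measure.pi_pi]
    rw [cells, ← Finset.prod_univ_sum (fun _ => Finset.range l)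
      (fun j c => (unif1.map (inCell1 l c)) (s j))]
    simp_rw [← Measure.finsetSum_apply, sum_map_inCell1 hl]
    simp only [Measure.smul_apply, smul_eq_mul, Finset.prod_mul_distrib, Finset.prod_const,
      Finset.card_univ, Fintype.card_fin]
    rw [← mul_assoc, ENNReal.inv_mul_cancel hl0 hl1, one_mul]
  rw [unifCube_eq_pi] at *
  conv_rhs => rw [key]
  rw [smul_smul, ENNReal.mul_inv_cancel hl0 hl1, one_smul]

theorem card_cells (q l : ℕ) : (cells q l).card = l ^ q := by
  simp [cells]

/-- Passes square integrability from the cube to each stratum. -/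
theorem map_inCell_le {q l : ℕ} (hl : 1 ≤ l) {c : Fin q → ℕ} (hc : c ∈ cells q l) :
    (unifCube q).map (inCell l c) ≤ ((l : ENNReal) ^ q) • unifCube q := by
  rw [← sum_map_inCell hl]
  intro s
  rw [Measure.finsetSum_apply]
  exact Finset.single_le_sum (f := fun c => ((unifCube q).map (inCell l c)) s)
    (fun _ _ => bot_le) hc

theorem memLp_comp_inCell {q l : ℕ} (hl : 1 ≤ l) {c : Fin q → ℕ} (hc : c ∈ cells q l)
    {G : (Fin q → ℝ) → ℝ} (hG : MemLp G 2 (unifCube q)) :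
    MemLp (fun v => G (inCell l c v)) 2 (unifCube q) := by
  have h1 : MemLp G 2 ((unifCube q).map (inCell l c)) :=
    hG.of_measure_le_smul (ENNReal.pow_ne_top (ENNReal.natCast_ne_top l)) (map_inCell_le hl hc)
  exact h1.comp_of_map (measurable_inCell l c).aemeasurable

theorem sum_integral_inCell {q l : ℕ} (hl : 1 ≤ l) {G : (Fin q → ℝ) → ℝ}
    (hG : MemLp G 2 (unifCube q)) :
    (∑ c ∈ cells q l, ∫ v, G (inCell l c v) ∂unifCube q) / (l : ℝ) ^ q
      = ∫ u, G u ∂unifCube q := by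
  have hl0 : (0 : ℝ) < (l : ℝ) ^ q := by
    have : (0 : ℝ) < l := by exact_mod_cast hl
    positivity
  have h1 : ∀ c ∈ cells q l, Integrable G ((unifCube q).map (inCell l c)) := fun c hc =>
    have := Measure.isProbabilityMeasure_map (μ := unifCube q)
      (measurable_inCell l c).aemeasurable
    memLp_one_iff_integrable.mp ((hG.of_measure_le_smul
      (ENNReal.pow_ne_top (ENNReal.natCast_ne_top l)) (map_inCell_le hl hc)).mono_exponent
        one_le_two)
  have h2 : ∑ c ∈ cells q l, ∫ v, G (inCell l c v) ∂unifCube q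
      = ∑ c ∈ cells q l, ∫ u, G u ∂((unifCube q).map (inCell l c)) :=
    Finset.sum_congr rfl fun c hc => (integral_map (measurable_inCell l c).aemeasurable
      (h1 c hc).aestronglyMeasurable).symm
  rw [h2, ← integral_finsetSum_measure h1, sum_map_inCell hl, integral_smul_measure]
  simp
  field_simp

/-! ### Variance over a product measure by coordinatewise resampling -/

/-- The law of a pair of independent uniform vectors, coordinate by coordinate. -/
noncomputable def pairCube (q : ℕ) : Measure (Fin q → ℝ × ℝ) :=
  Measure.pi fun _ => unif1.prod unif1

instance (q : ℕ) : IsProbabilityMeasure (pairCube q) := by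
  unfold pairCube; infer_instance

theorem measurePreserving_pairCube (q : ℕ) :
    MeasurePreserving (MeasurableEquiv.arrowProdEquivProdArrow ℝ ℝ (Fin q)) (pairCube q)
      ((unifCube q).prod (unifCube q)) := by
  rw [unifCube_eq_pi]
  exact measurePreserving_arrowProdEquivProdArrow ℝ ℝ (Fin q) (fun _ => unif1) (fun _ => unif1)

/-- For fixed `v`, Jensen bounds `(g v - μ[g]) ^ 2` by the mean of `(g v - g v') ^ 2` over an
independent copy `v'`. The exact identity has a factor 1/2, which is not needed. -/
theorem evariance_le_lintegral_pair {α : Type*} [MeasurableSpace α] {μ : Measure α}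
    [IsProbabilityMeasure μ] {g : α → ℝ} (hg : MemLp g 2 μ) (hgm : Measurable g) :
    evariance g μ ≤ ∫⁻ z, ENNReal.ofReal ((g z.1 - g z.2) ^ 2) ∂(μ.prod μ) := by
  have hgi : Integrable g μ := hg.integrable one_le_two
  rw [evariance_eq_lintegral_ofReal, lintegral_prod _ (by fun_prop)]
  refine lintegral_mono fun v => ?_
  have h2 : MemLp (fun v' => g v - g v') 2 μ := (memLp_const (g v)).sub hg
  rw [← ofReal_integral_eq_lintegral_ofReal h2.integrable_sq
    (Eventually.of_forall fun _ => sq_nonneg _)]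
  refine ENNReal.ofReal_le_ofReal ?_
  have h3 : ∫ v', (g v - g v') ∂μ = g v - μ[g] := by
    rw [integral_sub (integrable_const _) hgi]; simp
  have h4 := variance_eq_sub h2
  have h5 := variance_nonneg (fun v' => g v - g v') μ
  simp only [Pi.pow_apply, h3] at h4
  linarith

/-- An Efron–Stein type bound: pass from one vector to its copy by replacing one coordinate at a
time, telescope, and apply Cauchy–Schwarz, which costs the factor `q`. -/
theorem lintegral_pair_le_sum_resample {q : ℕ} {g : (Fin q → ℝ) → ℝ} (hg : Measurable g) :
    ∫⁻ z, ENNReal.ofReal ((g (fun i => (z i).1) - g (fun i => (z i).2)) ^ 2) ∂pairCube q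
      ≤ q * ∑ j, ∫⁻ z, ENNReal.ofReal ((g (fun i => (z i).1)
        - g (Function.update (fun i => (z i).1) j (z j).2)) ^ 2) ∂pairCube q := by
  have hupd : ∀ j : Fin q, Measurable fun z : Fin q → ℝ × ℝ =>
      Function.update (fun i => (z i).1) j (z j).2 := by
    intro j
    rw [measurable_pi_iff]
    intro i
    by_cases hij : i = j
    · subst hij; simp only [Function.update_self]; fun_prop
    · simp only [Function.update_of_ne hij]; fun_prop
  have hfst : Measurable fun z : Fin q → ℝ × ℝ => fun i => (z i).1 := by fun_prop
  -- `sw n` exchanges the two copies in the coordinates below `n`. It preserves `pairCube q`, so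
  -- each telescoping term has the law of a single resampling at the original vector.
  let sw : ℕ → (Fin q → ℝ × ℝ) → (Fin q → ℝ × ℝ) :=
    fun n z i => (if (i : ℕ) < n then Prod.swap else id) (z i)
  have hsw : ∀ n, MeasurePreserving (sw n) (pairCube q) (pairCube q) := by
    intro n
    refine measurePreserving_pi _ _ (f := fun i : Fin q => if (i : ℕ) < n then Prod.swap else id)
      fun i => ?_
    by_cases h : (i : ℕ) < n
    · simp only [h, if_true]; exact Measure.measurePreserving_swap
    · simp only [h, if_false]; exact MeasurePreserving.id _
  let a : ℕ → (Fin q → ℝ × ℝ) → ℝ := fun n z => g (fun i => (sw n z i).1)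
  have hupdate : ∀ (j : Fin q) z, a (j + 1) z
      = g (Function.update (fun i => (sw j z i).1) j (sw j z j).2) := by
    intro j z
    simp only [a]
    congr 1
    ext i
    by_cases hij : i = j
    · subst hij; simp [sw]
    · have : (i : ℕ) ≠ j := fun h => hij (Fin.ext h)
      have h2 : ((i : ℕ) < j + 1) ↔ ((i : ℕ) < j) := by omega
      simp [Function.update_of_ne hij, sw, h2]
  have h0 : ∀ z, g (fun i => (z i).1) - g (fun i => (z i).2)
      = ∑ j : Fin q, (a j z - a (j + 1) z) := by
    intro z
    rw [Fin.sum_univ_eq_sum_range (fun n => a n z - a (n + 1) z) q, Finset.sum_range_sub']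
    simp [a, sw]
  calc ∫⁻ z, ENNReal.ofReal ((g (fun i => (z i).1) - g (fun i => (z i).2)) ^ 2) ∂pairCube q
      ≤ ∫⁻ z, q * ∑ j : Fin q, ENNReal.ofReal ((a j z - a (j + 1) z) ^ 2) ∂pairCube q := by
        refine lintegral_mono fun z => ?_
        rw [h0 z, ← ENNReal.ofReal_sum_of_nonneg fun _ _ => sq_nonneg _,
          ← ENNReal.ofReal_natCast, ← ENNReal.ofReal_mul (by positivity)]
        refine ENNReal.ofReal_le_ofReal ?_
        simpa using sq_sum_le_card_mul_sum_sq (s := Finset.univ)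
          (f := fun j : Fin q => a j z - a (j + 1) z)
    _ = q * ∑ j : Fin q, ∫⁻ z, ENNReal.ofReal ((a j z - a (j + 1) z) ^ 2) ∂pairCube q := by
        have ham : ∀ n, Measurable (a n) := fun n =>
          hg.comp (hfst.comp (hsw n).measurable)
        rw [lintegral_const_mul _ (by fun_prop), lintegral_finsetSum _ fun j _ => by fun_prop]
    _ = _ := by
        congr 1
        refine Finset.sum_congr rfl fun j _ => ?_
        simp_rw [hupdate j]
        exact (hsw j).lintegral_comp (f := fun z => ENNReal.ofReal ((g (fun i => (z i).1)
          - g (Function.update (fun i => (z i).1) j (z j).2)) ^ 2))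
          (((hg.comp hfst).sub (hg.comp (hupd j))).pow_const 2).ennreal_ofReal

theorem lintegral_pairCube_prod {q : ℕ} {F : Fin q → ℝ × ℝ → ENNReal}
    (hF : ∀ i, Measurable (F i)) :
    ∫⁻ z, ∏ i, F i (z i) ∂pairCube q = ∏ i, ∫⁻ x, F i x ∂(unif1.prod unif1) := by
  have hind : iIndepFun (fun i (z : Fin q → ℝ × ℝ) => F i (z i)) (pairCube q) :=
    iIndepFun_pi fun i => (hF i).aemeasurable
  have h := lintegral_prod_eq_prod_lintegral_of_indepFun (μ := pairCube q) Finset.univ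
    (fun i (z : Fin q → ℝ × ℝ) => F i (z i)) hind (fun i => (hF i).comp (measurable_pi_apply i))
  rw [h]
  refine Finset.prod_congr rfl fun i _ => ?_
  exact (measurePreserving_eval (fun _ : Fin q => unif1.prod unif1) i).lintegral_comp (hF i)

theorem evariance_unifCube_le {q : ℕ} {g : (Fin q → ℝ) → ℝ} (hg : MemLp g 2 (unifCube q))
    (hgm : Measurable g) :
    evariance g (unifCube q) ≤ q * ∑ j, ∫⁻ z, ENNReal.ofReal ((g (fun i => (z i).1)
        - g (Function.update (fun i => (z i).1) j (z j).2)) ^ 2) ∂pairCube q := by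
  refine (evariance_le_lintegral_pair hg hgm).trans ?_
  rw [← (measurePreserving_pairCube q).lintegral_comp (by fun_prop)]
  exact lintegral_pair_le_sum_resample hgm

/-- The average over the strata of the variances of the integrand. -/
noncomputable def avgVar {q : ℕ} (G : (Fin q → ℝ) → ℝ) (l : ℕ) : ℝ :=
  (∑ c ∈ cells q l, variance (fun v => G (inCell l c v)) (unifCube q)) / (l : ℝ) ^ q

/-! ### One-dimensional sums over cells -/

/-- The weight `u^{-s} + (1-u)^{-s}`, singular at the ends of the unit interval. -/
noncomputable def endWeight (s u : ℝ) : ℝ := u ^ (-s) + (1 - u) ^ (-s)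

theorem measurable_endWeight (s : ℝ) : Measurable (endWeight s) := by
  unfold endWeight; fun_prop

/-- The second moment of the weight. -/
noncomputable def endMoment (s : ℝ) : ENNReal := ∫⁻ u, ENNReal.ofReal (endWeight s u ^ 2) ∂unif1

/-- The square of the weight is at most twice the sum of the two powers of exponent `-2s`, which are
integrable because `2s < 1`. -/
theorem endMoment_lt_top {s : ℝ} (hs : s < 1 / 2) : endMoment s < ⊤ := by
  have h1 : IntervalIntegrable (fun x : ℝ => x ^ (-(2 * s))) volume 0 1 :=
    intervalIntegral.intervalIntegrable_rpow' (by linarith)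
  have h2 : IntervalIntegrable (fun x : ℝ => (1 - x) ^ (-(2 * s))) volume 0 1 := by
    have := (h1.comp_sub_left 1).symm
    simpa using this
  have h3 : Integrable (fun x : ℝ => 2 * (x ^ (-(2 * s)) + (1 - x) ^ (-(2 * s)))) unif1 := by
    rw [intervalIntegrable_iff_integrableOn_Ioc_of_le zero_le_one] at h1 h2
    exact (h1.add h2).const_mul 2
  refine lt_of_le_of_lt ?_ h3.lintegral_lt_top
  refine lintegral_mono_ae ?_
  filter_upwards [ae_unif1_mem] with u hu
  refine ENNReal.ofReal_le_ofReal ?_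
  have e : ∀ x : ℝ, 0 < x → x ^ (-(2 * s)) = (x ^ (-s)) ^ 2 := by
    intro x hx
    rw [← Real.rpow_natCast, ← Real.rpow_mul hx.le]
    congr 1; push_cast; ring
  rw [e u hu.1, e (1 - u) (by linarith [hu.2]), endWeight]
  nlinarith [sq_nonneg (u ^ (-s) - (1 - u) ^ (-s))]

theorem inCell1_mem {l c : ℕ} (hc : c < l) {v : ℝ} (hv : v ∈ Set.Ioo (0 : ℝ) 1) :
    inCell1 l c v ∈ Set.Ioo (0 : ℝ) 1 := by
  have hl : (0 : ℝ) < l := by exact_mod_cast (by omega : 0 < l)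
  have h1 : (c : ℝ) + 1 ≤ l := by exact_mod_cast hc
  have h2 : (0 : ℝ) ≤ c := by positivity
  obtain ⟨hv0, hv1⟩ := hv
  rw [inCell1]
  refine ⟨by positivity, ?_⟩
  rw [div_lt_one hl]
  linarith

/-- The point `(c + v) / l` has distance at least `v / l` from 0 and at least `(1 - v) / l` from 1.
-/
theorem endWeight_inCell1_le {s : ℝ} (hs : 0 ≤ s) {l c : ℕ} (hc : c < l) {v : ℝ}
    (hv : v ∈ Set.Ioo (0 : ℝ) 1) :
    endWeight s (inCell1 l c v) ≤ (l : ℝ) ^ s * endWeight s v := by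
  have hl : (0 : ℝ) < l := by exact_mod_cast (by omega : 0 < l)
  have h1 : (c : ℝ) + 1 ≤ l := by exact_mod_cast hc
  have h2 : (0 : ℝ) ≤ c := by positivity
  obtain ⟨hv0, hv1⟩ := hv
  have e : ∀ x : ℝ, 0 < x → (l : ℝ) ^ s * x ^ (-s) = (x / l) ^ (-s) := by
    intro x hx
    rw [Real.div_rpow hx.le hl.le, Real.rpow_neg hl.le s, div_inv_eq_mul, mul_comm]
  rw [endWeight, endWeight, mul_add, e v hv0, e (1 - v) (by linarith)]
  have a1 : 0 < v / l := by positivity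
  have a2 : 0 < (1 - v) / l := div_pos (by linarith) hl
  refine add_le_add (Real.rpow_le_rpow_of_nonpos a1 ?_ (by linarith))
    (Real.rpow_le_rpow_of_nonpos a2 ?_ (by linarith))
  · rw [inCell1]; gcongr; linarith
  · rw [inCell1, le_sub_iff_add_le, ← add_div, div_le_one hl]; linarith

theorem sum_lintegral_endWeight (s : ℝ) {l : ℕ} (hl : 1 ≤ l) :
    ∑ c ∈ Finset.range l, ∫⁻ v, ENNReal.ofReal (endWeight s (inCell1 l c v) ^ 2) ∂unif1
      = l * endMoment s := by
  have hm : Measurable fun u => ENNReal.ofReal (endWeight s u ^ 2) :=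
    ((measurable_endWeight s).pow_const 2).ennreal_ofReal
  have h : ∀ c, ∫⁻ v, ENNReal.ofReal (endWeight s (inCell1 l c v) ^ 2) ∂unif1
      = ∫⁻ u, ENNReal.ofReal (endWeight s u ^ 2) ∂(unif1.map (inCell1 l c)) :=
    fun c => (lintegral_map hm (measurable_inCell1 l c)).symm
  simp_rw [h]
  rw [← lintegral_finsetSum_measure, sum_map_inCell1 hl, lintegral_smul_measure, smul_eq_mul,
    endMoment]

/-- Crude, as it ignores cancellation inside the cell. It serves for the two extreme cells, where
`ψ` may be unbounded. -/
theorem lintegral_cell_diff_le {s : ℝ} (hs : 0 ≤ s) {ψ : ℝ → ℝ}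
    (hψ : ∀ u ∈ Set.Ioo (0 : ℝ) 1, |ψ u| ≤ endWeight s u) {l c : ℕ} (hc : c < l) :
    ∫⁻ x, ENNReal.ofReal ((ψ (inCell1 l c x.1) - ψ (inCell1 l c x.2)) ^ 2) ∂(unif1.prod unif1)
      ≤ 4 * endMoment s * ENNReal.ofReal ((l : ℝ) ^ (2 * s)) := by
  have hl : (0 : ℝ) < l := by exact_mod_cast (by omega : 0 < l)
  have hae : ∀ᵐ x ∂(unif1.prod unif1), x.1 ∈ Set.Ioo (0 : ℝ) 1 ∧ x.2 ∈ Set.Ioo (0 : ℝ) 1 := by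
    filter_upwards [Measure.quasiMeasurePreserving_fst.ae ae_unif1_mem,
      Measure.quasiMeasurePreserving_snd.ae ae_unif1_mem] with x h1 h2
    exact ⟨h1, h2⟩
  have hw := measurable_endWeight s
  have e2 : (l : ℝ) ^ (2 * s) = ((l : ℝ) ^ s) ^ 2 := by
    rw [← Real.rpow_natCast, ← Real.rpow_mul hl.le]
    congr 1; push_cast; ring
  set B : ENNReal := ENNReal.ofReal (2 * (l : ℝ) ^ (2 * s)) with hB
  calc _ ≤ ∫⁻ x, (B * ENNReal.ofReal (endWeight s x.1 ^ 2)
        + B * ENNReal.ofReal (endWeight s x.2 ^ 2)) ∂(unif1.prod unif1) := by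
        refine lintegral_mono_ae ?_
        filter_upwards [hae] with x hx
        rw [hB, ← ENNReal.ofReal_mul (by positivity), ← ENNReal.ofReal_mul (by positivity),
          ← ENNReal.ofReal_add (by positivity) (by positivity)]
        refine ENNReal.ofReal_le_ofReal ?_
        have key : ∀ v ∈ Set.Ioo (0 : ℝ) 1, ψ (inCell1 l c v) ^ 2
            ≤ (l : ℝ) ^ (2 * s) * endWeight s v ^ 2 := by
          intro v hv
          rw [e2, ← mul_pow, ← sq_abs]
          exact pow_le_pow_left₀ (abs_nonneg _) ((hψ _ (inCell1_mem hc hv)).trans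
            (endWeight_inCell1_le hs hc hv)) 2
        have k1 := key _ hx.1
        have k2 := key _ hx.2
        nlinarith [sq_nonneg (ψ (inCell1 l c x.1) + ψ (inCell1 l c x.2))]
    _ = B * endMoment s + B * endMoment s := by
        have m1 : Measurable fun u => ENNReal.ofReal (endWeight s u ^ 2) := by fun_prop
        have i1 : ∫⁻ x, ENNReal.ofReal (endWeight s x.1 ^ 2) ∂(unif1.prod unif1) = endMoment s :=
          measurePreserving_fst.lintegral_comp m1
        have i2 : ∫⁻ x, ENNReal.ofReal (endWeight s x.2 ^ 2) ∂(unif1.prod unif1) = endMoment s :=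
          measurePreserving_snd.lintegral_comp m1
        rw [lintegral_add_left (by fun_prop), lintegral_const_mul _ (by fun_prop),
          lintegral_const_mul _ (by fun_prop), i1, i2]
    _ = 4 * endMoment s * ENNReal.ofReal ((l : ℝ) ^ (2 * s)) := by
        rw [hB, ENNReal.ofReal_mul (by norm_num)]
        simp only [ENNReal.ofReal_ofNat]
        ring

/-- A closed interior cell stays inside `(0,1)`, so by monotonicity the oscillation of `ψ` is at
most its increment between the cell's ends. -/
theorem lintegral_interior_cell_diff_le {ψ : ℝ → ℝ} (hmono : MonotoneOn ψ (Set.Ioo 0 1))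
    {l c : ℕ} (hc : 1 ≤ c) (hcl : c + 1 < l) :
    ∫⁻ x, ENNReal.ofReal ((ψ (inCell1 l c x.1) - ψ (inCell1 l c x.2)) ^ 2) ∂(unif1.prod unif1)
      ≤ ENNReal.ofReal ((ψ (((c + 1 : ℕ) : ℝ) / l) - ψ ((c : ℝ) / l)) ^ 2) := by
  have hl : (0 : ℝ) < l := by exact_mod_cast (by omega : 0 < l)
  have hc' : (0 : ℝ) < c := by exact_mod_cast hc
  have hcl' : (c : ℝ) + 1 < l := by exact_mod_cast hcl
  have hae : ∀ᵐ x ∂(unif1.prod unif1), x.1 ∈ Set.Ioo (0 : ℝ) 1 ∧ x.2 ∈ Set.Ioo (0 : ℝ) 1 := by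
    filter_upwards [Measure.quasiMeasurePreserving_fst.ae ae_unif1_mem,
      Measure.quasiMeasurePreserving_snd.ae ae_unif1_mem] with x h1 h2
    exact ⟨h1, h2⟩
  have m1 : (c : ℝ) / l ∈ Set.Ioo (0 : ℝ) 1 := ⟨by positivity, by rw [div_lt_one hl]; linarith⟩
  have m2 : ((c + 1 : ℕ) : ℝ) / l ∈ Set.Ioo (0 : ℝ) 1 :=
    ⟨by positivity, by rw [div_lt_one hl]; push_cast; linarith⟩
  have key : ∀ v ∈ Set.Ioo (0 : ℝ) 1, ψ ((c : ℝ) / l) ≤ ψ (inCell1 l c v) ∧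
      ψ (inCell1 l c v) ≤ ψ (((c + 1 : ℕ) : ℝ) / l) := by
    intro v hv
    have m := inCell1_mem (by omega : c < l) hv
    refine ⟨hmono m1 m ?_, hmono m m2 ?_⟩
    · rw [inCell1]; gcongr; linarith [hv.1]
    · rw [inCell1]; push_cast; gcongr; exact hv.2.le
  refine (lintegral_mono_ae (g := fun _ => ENNReal.ofReal
    ((ψ (((c + 1 : ℕ) : ℝ) / l) - ψ ((c : ℝ) / l)) ^ 2)) ?_).trans (by simp)
  filter_upwards [hae] with x hx
  refine ENNReal.ofReal_le_ofReal (sq_le_sq' ?_ ?_) <;>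
    linarith [(key _ hx.1).1, (key _ hx.1).2, (key _ hx.2).1, (key _ hx.2).2]

/-- The gain of stratification: the sum over all `l` cells is no larger in order than one extreme
cell. Interior increments are nonnegative, so their squares sum to at most the square of the total
increment, and both ends of that increment are within `2 * l ^ s` of 0. -/
theorem sum_lintegral_cell_diff_le {s : ℝ} (hs : 0 ≤ s) {ψ : ℝ → ℝ}
    (hmono : MonotoneOn ψ (Set.Ioo 0 1)) (hψ : ∀ u ∈ Set.Ioo (0 : ℝ) 1, |ψ u| ≤ endWeight s u)
    {l : ℕ} (hl : 1 ≤ l) :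
    ∑ c ∈ Finset.range l, ∫⁻ x, ENNReal.ofReal
      ((ψ (inCell1 l c x.1) - ψ (inCell1 l c x.2)) ^ 2) ∂(unif1.prod unif1)
      ≤ (8 * endMoment s + 16) * ENNReal.ofReal ((l : ℝ) ^ (2 * s)) := by
  set I : ℕ → ENNReal := fun c => ∫⁻ x, ENNReal.ofReal
      ((ψ (inCell1 l c x.1) - ψ (inCell1 l c x.2)) ^ 2) ∂(unif1.prod unif1) with hI
  have hb : ∀ c, c < l → I c ≤ 4 * endMoment s * ENNReal.ofReal ((l : ℝ) ^ (2 * s)) :=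
    fun c hc => lintegral_cell_diff_le hs hψ hc
  have hl0 : (0 : ℝ) < l := by exact_mod_cast hl
  rcases Nat.lt_or_ge l 2 with h2 | h2
  · obtain rfl : l = 1 := by omega
    rw [Finset.sum_range_one]
    refine (hb 0 one_pos).trans ?_
    gcongr
    refine le_trans ?_ le_self_add
    gcongr
    norm_num
  obtain ⟨n, hn⟩ : ∃ n, l = n + 1 + 1 := ⟨l - 2, by omega⟩
  rw [show Finset.range l = Finset.range (n + 1 + 1) by rw [hn], Finset.sum_range_succ,
    Finset.sum_range_succ']
  have hint : ∑ c ∈ Finset.range n, I (c + 1) ≤ 16 * ENNReal.ofReal ((l : ℝ) ^ (2 * s)) := by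
    have mem : ∀ c : ℕ, 1 ≤ c → c < l → (c : ℝ) / l ∈ Set.Ioo (0 : ℝ) 1 := by
      intro c h1 h2
      have : (0 : ℝ) < c := by exact_mod_cast h1
      exact ⟨by positivity, by rw [div_lt_one hl0]; exact_mod_cast h2⟩
    -- With `l = n + 2`, the interior cells `1, …, n` have end values `y 0, …, y n`.
    set y : ℕ → ℝ := fun c => ψ (((c + 1 : ℕ) : ℝ) / l) with hy
    have hinc : ∀ c ∈ Finset.range n, 0 ≤ y (c + 1) - y c := by
      intro c hc
      rw [Finset.mem_range] at hc
      refine sub_nonneg.mpr (hmono (mem (c + 1) (by omega) (by omega))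
        (mem (c + 1 + 1) (by omega) (by omega)) ?_)
      have : ((c + 1 : ℕ) : ℝ) ≤ ((c + 1 + 1 : ℕ) : ℝ) := by exact_mod_cast Nat.le_succ _
      gcongr
    have hyb : ∀ c : ℕ, c ≤ n → |y c| ≤ 2 * (l : ℝ) ^ s := by
      intro c hc
      refine (hψ _ (mem (c + 1) (by omega) (by omega))).trans ?_
      have e : (l : ℝ) ^ s = (1 / (l : ℝ)) ^ (-s) := by
        rw [one_div, Real.inv_rpow hl0.le, Real.rpow_neg hl0.le, inv_inv]
      rw [endWeight, two_mul, e]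
      have h1 : (0 : ℝ) < 1 / l := by positivity
      have hcl : ((c + 1 : ℕ) : ℝ) + 1 ≤ l := by exact_mod_cast (by omega : c + 1 + 1 ≤ l)
      refine add_le_add (Real.rpow_le_rpow_of_nonpos h1 ?_ (by linarith))
        (Real.rpow_le_rpow_of_nonpos h1 ?_ (by linarith))
      · gcongr
        push_cast
        linarith [(Nat.cast_nonneg c : (0 : ℝ) ≤ c)]
      · rw [le_sub_iff_add_le, ← add_div, div_le_one hl0]
        linarith
    calc ∑ c ∈ Finset.range n, I (c + 1)
        ≤ ∑ c ∈ Finset.range n, ENNReal.ofReal ((y (c + 1) - y c) ^ 2) := by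
          refine Finset.sum_le_sum fun c hc => ?_
          rw [Finset.mem_range] at hc
          exact lintegral_interior_cell_diff_le hmono (by omega) (by omega)
      _ = ENNReal.ofReal (∑ c ∈ Finset.range n, (y (c + 1) - y c) ^ 2) :=
          (ENNReal.ofReal_sum_of_nonneg fun _ _ => sq_nonneg _).symm
      _ ≤ ENNReal.ofReal (16 * (l : ℝ) ^ (2 * s)) := by
          refine ENNReal.ofReal_le_ofReal ((Finset.sum_sq_le_sq_sum_of_nonneg hinc).trans ?_)
          rw [Finset.sum_range_sub]
          have e2 : (l : ℝ) ^ (2 * s) = ((l : ℝ) ^ s) ^ 2 := by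
            rw [← Real.rpow_natCast, ← Real.rpow_mul hl0.le]
            congr 1; push_cast; ring
          rw [e2, show (16 : ℝ) * ((l : ℝ) ^ s) ^ 2 = (4 * (l : ℝ) ^ s) ^ 2 by ring]
          have b1 := abs_le.mp (hyb n le_rfl)
          have b2 := abs_le.mp (hyb 0 (Nat.zero_le _))
          exact sq_le_sq' (by linarith [b1.1, b2.2]) (by linarith [b1.2, b2.1])
      _ = _ := by rw [ENNReal.ofReal_mul (by norm_num)]; simp
  calc _ ≤ 16 * ENNReal.ofReal ((l : ℝ) ^ (2 * s))
        + 4 * endMoment s * ENNReal.ofReal ((l : ℝ) ^ (2 * s))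
        + 4 * endMoment s * ENNReal.ofReal ((l : ℝ) ^ (2 * s)) :=
        add_le_add (add_le_add hint (hb 0 (by omega))) (hb (n + 1) (by omega))
    _ = _ := by ring

/-! ### Average variance over the strata -/

theorem inCell_apply {q : ℕ} (l : ℕ) (c : Fin q → ℕ) (v : Fin q → ℝ) (i : Fin q) :
    inCell l c v i = inCell1 l (c i) (v i) := rfl

theorem inCell_update {q : ℕ} (l : ℕ) (c : Fin q → ℕ) (v : Fin q → ℝ) (j : Fin q) (t : ℝ) :
    inCell l c (Function.update v j t) = Function.update (inCell l c v) j (inCell1 l (c j) t) := by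
  ext i
  by_cases hij : i = j
  · subst hij; simp [inCell_apply]
  · simp [inCell_apply, Function.update_of_ne hij]

theorem ae_pairCube_mem (q : ℕ) : ∀ᵐ z ∂pairCube q, ∀ i,
    (z i).1 ∈ Set.Ioo (0 : ℝ) 1 ∧ (z i).2 ∈ Set.Ioo (0 : ℝ) 1 := by
  rw [ae_all_iff]
  intro i
  have hae : ∀ᵐ x ∂(unif1.prod unif1), x.1 ∈ Set.Ioo (0 : ℝ) 1 ∧ x.2 ∈ Set.Ioo (0 : ℝ) 1 := by
    filter_upwards [Measure.quasiMeasurePreserving_fst.ae ae_unif1_mem,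
      Measure.quasiMeasurePreserving_snd.ae ae_unif1_mem] with x h1 h2
    exact ⟨h1, h2⟩
  exact (measurePreserving_eval (fun _ : Fin q => unif1.prod unif1) i).quasiMeasurePreserving.ae hae

theorem inCell_mem_openCube {q l : ℕ} {c : Fin q → ℕ} (hc : c ∈ cells q l) {v : Fin q → ℝ}
    (hv : ∀ i, v i ∈ Set.Ioo (0 : ℝ) 1) : inCell l c v ∈ openCube q := by
  simp only [cells, Fintype.mem_piFinset, Finset.mem_range] at hc
  exact fun i _ => inCell1_mem (hc i) (hv i)

/-- Resampling coordinate `j` leaves `q - 1` weights, whose squares sum over the cells to order `l`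
each, and one monotone increment, of order `l ^ (2s)`. Division by `l ^ q` leaves `l ^ (2s - 1)`.
The constant is chosen before `G`, which gives uniformity in `θ`. -/
theorem exists_avgVar_bound (q : ℕ) {s C : ℝ} (hs : 0 ≤ s) (hs2 : s < 1 / 2) :
    ∃ C' : ℝ, ∀ (G : (Fin q → ℝ) → ℝ) (ψ : Fin q → ℝ → ℝ), Measurable G →
      MemLp G 2 (unifCube q) → (∀ j, Measurable (ψ j)) →
      (∀ j, MonotoneOn (ψ j) (Set.Ioo 0 1)) →
      (∀ j, ∀ u ∈ Set.Ioo (0 : ℝ) 1, |ψ j u| ≤ endWeight s u) →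
      (∀ u ∈ openCube q, ∀ j, ∀ t ∈ Set.Ioo (0 : ℝ) 1, |G u - G (Function.update u j t)|
        ≤ C * (∏ i ∈ Finset.univ.erase j, endWeight s (u i)) * |ψ j (u j) - ψ j t|) →
      ∀ l : ℕ, 1 ≤ l → avgVar G l ≤ C' * (l : ℝ) ^ (-(1 - 2 * s)) := by
  have hD := endMoment_lt_top hs2
  set K : ENNReal := q * (q * (ENNReal.ofReal (C ^ 2) *
    (endMoment s ^ (q - 1) * (8 * endMoment s + 16)))) with hK
  have hKtop : K ≠ ⊤ := by
    rw [hK]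
    finiteness
  refine ⟨K.toReal, fun G ψ hG hG2 hψm hψmono hψ hdiff l hl => ?_⟩
  have hl0 : (0 : ℝ) < l := by exact_mod_cast hl
  have hlq : (0 : ℝ) < (l : ℝ) ^ q := by positivity
  have hw := measurable_endWeight s
  -- The squared bound on the increment is a product of functions of single coordinates, so its
  -- integral over `pairCube q` factors.
  have hcell : ∀ c ∈ cells q l, ∀ j, ∫⁻ z, ENNReal.ofReal ((G (inCell l c fun i => (z i).1)
        - G (inCell l c (Function.update (fun i => (z i).1) j (z j).2))) ^ 2) ∂pairCube q
      ≤ ENNReal.ofReal (C ^ 2) * ∏ i, (if i = j then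
          ∫⁻ x, ENNReal.ofReal ((ψ j (inCell1 l (c i) x.1) - ψ j (inCell1 l (c i) x.2)) ^ 2)
            ∂(unif1.prod unif1)
          else ∫⁻ v, ENNReal.ofReal (endWeight s (inCell1 l (c i) v) ^ 2) ∂unif1) := by
    intro c hc j
    let F : Fin q → ℝ × ℝ → ENNReal := fun i x => if i = j then
      ENNReal.ofReal ((ψ j (inCell1 l (c i) x.1) - ψ j (inCell1 l (c i) x.2)) ^ 2)
      else ENNReal.ofReal (endWeight s (inCell1 l (c i) x.1) ^ 2)
    have hin : ∀ i, Measurable (inCell1 l (c i)) := fun i => measurable_inCell1 _ _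
    have hF : ∀ i, Measurable (F i) := by
      intro i
      have := hψm j
      have := hin i
      by_cases hij : i = j
      · simp only [F, hij, if_true]; fun_prop
      · simp only [F, hij, if_false]; fun_prop
    have hFi : ∀ i, ∫⁻ x, F i x ∂(unif1.prod unif1) = if i = j then
          ∫⁻ x, ENNReal.ofReal ((ψ j (inCell1 l (c i) x.1) - ψ j (inCell1 l (c i) x.2)) ^ 2)
            ∂(unif1.prod unif1)
          else ∫⁻ v, ENNReal.ofReal (endWeight s (inCell1 l (c i) v) ^ 2) ∂unif1 := by
      intro i
      have := hin i
      by_cases hij : i = j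
      · simp only [F, hij, if_true]
      · simp only [F, hij, if_false]
        exact measurePreserving_fst.lintegral_comp
          (f := fun v => ENNReal.ofReal (endWeight s (inCell1 l (c i) v) ^ 2)) (by fun_prop)
    simp_rw [← hFi]
    have hFm : Measurable fun z : Fin q → ℝ × ℝ => ∏ i, F i (z i) := by fun_prop
    rw [← lintegral_pairCube_prod hF, ← lintegral_const_mul _ hFm]
    refine lintegral_mono_ae ?_
    filter_upwards [ae_pairCube_mem q] with z hz
    have hu := inCell_mem_openCube hc fun i => (hz i).1
    have hcj : c j < l := by
      simp only [cells, Fintype.mem_piFinset, Finset.mem_range] at hc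
      exact hc j
    have h1 := hdiff _ hu j _ (inCell1_mem hcj (hz j).2)
    rw [← inCell_update] at h1
    have h2 : ∏ i, F i (z i) = ENNReal.ofReal ((∏ i ∈ Finset.univ.erase j,
        endWeight s (inCell1 l (c i) (z i).1)) ^ 2 *
        (ψ j (inCell1 l (c j) (z j).1) - ψ j (inCell1 l (c j) (z j).2)) ^ 2) := by
      rw [← Finset.prod_erase_mul _ _ (Finset.mem_univ j), ENNReal.ofReal_mul (sq_nonneg _),
        ← Finset.prod_pow, ENNReal.ofReal_prod_of_nonneg fun _ _ => sq_nonneg _]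
      congr 1
      · refine Finset.prod_congr rfl fun i hi => ?_
        simp [F, Finset.ne_of_mem_erase hi]
      · simp [F]
    rw [h2, ← ENNReal.ofReal_mul (sq_nonneg _)]
    refine ENNReal.ofReal_le_ofReal ?_
    rw [← sq_abs (G _ - G _)]
    refine (pow_le_pow_left₀ (abs_nonneg _) h1 2).trans (le_of_eq ?_)
    rw [mul_pow, mul_pow, sq_abs, mul_assoc]
    rfl
  -- Over the product grid the sum of products is the product over `i` of the sums over `range l`.
  have hsum : ∀ j, ∑ c ∈ cells q l, ∏ i, (if i = j then
          ∫⁻ x, ENNReal.ofReal ((ψ j (inCell1 l (c i) x.1) - ψ j (inCell1 l (c i) x.2)) ^ 2)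
            ∂(unif1.prod unif1)
          else ∫⁻ v, ENNReal.ofReal (endWeight s (inCell1 l (c i) v) ^ 2) ∂unif1)
      ≤ (l * endMoment s) ^ (q - 1)
        * ((8 * endMoment s + 16) * ENNReal.ofReal ((l : ℝ) ^ (2 * s))) := by
    intro j
    rw [cells, ← Finset.prod_univ_sum (fun _ => Finset.range l) (fun i c => if i = j then
          ∫⁻ x, ENNReal.ofReal ((ψ j (inCell1 l c x.1) - ψ j (inCell1 l c x.2)) ^ 2)
            ∂(unif1.prod unif1)
          else ∫⁻ v, ENNReal.ofReal (endWeight s (inCell1 l c v) ^ 2) ∂unif1),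
      ← Finset.prod_erase_mul _ _ (Finset.mem_univ j)]
    simp only [if_true]
    gcongr
    · rw [Finset.prod_congr rfl (g := fun _ => (l : ENNReal) * endMoment s) fun i hi => by
        simp only [Finset.ne_of_mem_erase hi, if_false]
        exact sum_lintegral_endWeight s hl]
      simp [Finset.card_erase_of_mem]
    · exact sum_lintegral_cell_diff_le hs (hψmono j) (hψ j) hl
  have htotal : ∑ c ∈ cells q l, evariance (fun v => G (inCell l c v)) (unifCube q)
      ≤ K * ((l : ENNReal) ^ (q - 1) * ENNReal.ofReal ((l : ℝ) ^ (2 * s))) := by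
    calc _ ≤ ∑ c ∈ cells q l, q * ∑ j, ENNReal.ofReal (C ^ 2) * ∏ i, (if i = j then
          ∫⁻ x, ENNReal.ofReal ((ψ j (inCell1 l (c i) x.1) - ψ j (inCell1 l (c i) x.2)) ^ 2)
            ∂(unif1.prod unif1)
          else ∫⁻ v, ENNReal.ofReal (endWeight s (inCell1 l (c i) v) ^ 2) ∂unif1) := by
          refine Finset.sum_le_sum fun c hc => ?_
          refine (evariance_unifCube_le (memLp_comp_inCell hl hc hG2)
            (hG.comp (measurable_inCell l c))).trans ?_
          gcongr with j _
          exact hcell c hc j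
      _ ≤ q * ∑ j : Fin q, ENNReal.ofReal (C ^ 2) * ((l * endMoment s) ^ (q - 1)
        * ((8 * endMoment s + 16) * ENNReal.ofReal ((l : ℝ) ^ (2 * s)))) := by
          rw [← Finset.mul_sum, Finset.sum_comm]
          gcongr with j _
          rw [← Finset.mul_sum]
          gcongr
          exact hsum j
      _ = _ := by
          rw [Finset.sum_const, Finset.card_univ, Fintype.card_fin, nsmul_eq_mul, hK, mul_pow]
          ring
  have hval : ∑ c ∈ cells q l, variance (fun v => G (inCell l c v)) (unifCube q)
      ≤ K.toReal * ((l : ℝ) ^ (q - 1) * (l : ℝ) ^ (2 * s)) := by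
    clear_value K
    have h1 : ENNReal.ofReal (∑ c ∈ cells q l, variance (fun v => G (inCell l c v)) (unifCube q))
        ≤ K * ((l : ENNReal) ^ (q - 1) * ENNReal.ofReal ((l : ℝ) ^ (2 * s))) := by
      rw [ENNReal.ofReal_sum_of_nonneg fun _ _ => variance_nonneg _ _]
      refine le_trans (le_of_eq (Finset.sum_congr rfl fun c hc => ?_)) htotal
      exact ofReal_variance (memLp_comp_inCell hl hc hG2)
    have h2 := ENNReal.toReal_mono (by finiteness) h1
    rw [ENNReal.toReal_ofReal (Finset.sum_nonneg fun _ _ => variance_nonneg _ _)] at h2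
    refine h2.trans (le_of_eq ?_)
    rw [ENNReal.toReal_mul, ENNReal.toReal_mul, ENNReal.toReal_pow, ENNReal.toReal_natCast,
      ENNReal.toReal_ofReal (by positivity)]
  rw [avgVar, div_le_iff₀ hlq]
  refine hval.trans ?_
  -- For `q = 0` the exponent `q - 1` is truncated, but then `K = 0`.
  rcases Nat.eq_zero_or_pos q with rfl | hq
  · simp [hK]
  refine le_of_eq ?_
  rw [mul_assoc]
  congr 1
  rw [← Real.rpow_natCast, ← Real.rpow_natCast, ← Real.rpow_add hl0, ← Real.rpow_add hl0]
  congr 1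
  rw [Nat.cast_sub hq]
  push_cast
  ring

/-! ### The integrand on the cube -/

/-- The integrand `u ↦ F(θ, μ_θ⁻¹(u))` on the cube. -/
def Problem.G {d q : ℕ} (p : Problem d q) (θ : Vec d) (u : Fin q → ℝ) : ℝ := p.F θ (p.inv θ u)

theorem Problem.Standing.measurable_G2 {d q : ℕ} {p : Problem d q} (hp : p.Standing) :
    Measurable fun z : Vec d × (Fin q → ℝ) => p.G z.1 z.2 :=
  hp.measurable_F.comp (measurable_fst.prodMk hp.measurable_inv)

theorem Problem.Standing.measurable_G {d q : ℕ} {p : Problem d q} (hp : p.Standing) (θ : Vec d) :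
    Measurable (p.G θ) :=
  hp.measurable_G2.comp measurable_prodMk_left

theorem Problem.Standing.measurable_inv_at {d q : ℕ} {p : Problem d q} (hp : p.Standing)
    (θ : Vec d) : Measurable (p.inv θ) :=
  hp.measurable_inv.comp measurable_prodMk_left

theorem Problem.Standing.memLp_G {d q : ℕ} {p : Problem d q} (hp : p.Standing) {θ : Vec d}
    (hθ : θ ∈ p.Θ) : MemLp (p.G θ) 2 (unifCube q) := by
  obtain ⟨σ2, h⟩ := hp.bounded_variance
  have h1 := (h θ hθ).1
  rw [hp.law_eq θ hθ] at h1
  exact h1.comp_of_map (hp.measurable_inv_at θ).aemeasurable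

theorem Problem.Standing.integral_G {d q : ℕ} {p : Problem d q} (hp : p.Standing) {θ : Vec d}
    (hθ : θ ∈ p.Θ) : ∫ u, p.G θ u ∂unifCube q = p.f θ := by
  obtain ⟨σ2, h⟩ := hp.bounded_variance
  have h1 := (h θ hθ).1.aestronglyMeasurable
  rw [Problem.f, hp.law_eq θ hθ] at *
  rw [integral_map (hp.measurable_inv_at θ).aemeasurable h1]
  rfl

/-! ### Bounded maps -/

theorem inCell_mem_Icc {q l : ℕ} {c : Fin q → ℕ} (hc : c ∈ cells q l) {v : Fin q → ℝ}
    (hv : ∀ i, v i ∈ Set.Icc (0 : ℝ) 1) : inCell l c v ∈ Set.Icc (0 : Fin q → ℝ) 1 := by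
  simp only [cells, Fintype.mem_piFinset, Finset.mem_range] at hc
  have key : ∀ i, 0 ≤ inCell l c v i ∧ inCell l c v i ≤ 1 := by
    intro i
    have hl : (0 : ℝ) < l := by exact_mod_cast (Nat.zero_le _).trans_lt (hc i)
    have h1 : (c i : ℝ) + 1 ≤ l := by exact_mod_cast hc i
    have h2 := (hv i).1
    have h3 := (hv i).2
    rw [inCell]
    exact ⟨by positivity, by rw [div_le_one hl]; linarith⟩
  exact ⟨fun i => (key i).1, fun i => (key i).2⟩

/-- A cell has sup-norm diameter `1 / l`, so `G` stays within `B / l` of its value at the lower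
corner. -/
theorem avgVar_le_of_lipschitzOn {q : ℕ} {G : (Fin q → ℝ) → ℝ} (hG : Measurable G) {B : ℝ}
    (hB : 0 ≤ B) (hLip : ∀ u ∈ Set.Icc (0 : Fin q → ℝ) 1, ∀ u' ∈ Set.Icc (0 : Fin q → ℝ) 1,
      |G u - G u'| ≤ B * ‖u - u'‖) {l : ℕ} (hl : 1 ≤ l) :
    avgVar G l ≤ B ^ 2 * (l : ℝ) ^ (-2 : ℝ) := by
  have hl0 : (0 : ℝ) < l := by exact_mod_cast hl
  have hcell : ∀ c ∈ cells q l, variance (fun v => G (inCell l c v)) (unifCube q)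
      ≤ (B / l) ^ 2 := by
    intro c hc
    have h0 := inCell_mem_Icc hc (v := 0) fun i => ⟨le_rfl, zero_le_one⟩
    have hb : ∀ᵐ v ∂unifCube q, G (inCell l c v)
        ∈ Set.Icc (G (inCell l c 0) - B / l) (G (inCell l c 0) + B / l) := by
      filter_upwards [ae_unifCube_mem q] with v hv
      have hv' : ∀ i, v i ∈ Set.Ioo (0 : ℝ) 1 := fun i => hv i (Set.mem_univ i)
      have h1 := inCell_mem_Icc hc fun i => Set.Ioo_subset_Icc_self (hv' i)
      have h2 := hLip _ h1 _ h0
      have h3 : ‖inCell l c v - inCell l c 0‖ ≤ 1 / l := by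
        rw [pi_norm_le_iff_of_nonneg (by positivity)]
        intro i
        have : (inCell l c v - inCell l c 0) i = v i / l := by
          simp [inCell]; ring
        rw [this, Real.norm_eq_abs, abs_of_nonneg (div_nonneg (hv' i).1.le hl0.le)]
        have := (hv' i).2.le
        gcongr
      have h4 : |G (inCell l c v) - G (inCell l c 0)| ≤ B / l := by
        refine h2.trans ?_
        rw [div_eq_mul_one_div]
        gcongr
      have := abs_le.mp h4
      exact ⟨by linarith, by linarith⟩
    refine (variance_le_sq_of_bounded hb (hG.comp (measurable_inCell l c)).aemeasurable).trans
      (le_of_eq ?_)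
    ring
  rw [avgVar, div_le_iff₀ (by positivity)]
  refine (Finset.sum_le_card_nsmul _ _ _ hcell).trans (le_of_eq ?_)
  rw [card_cells, nsmul_eq_mul, Real.rpow_neg hl0.le]
  push_cast
  norm_cast
  field_simp
  push_cast
  ring

theorem Problem.BoundedMap.exists_avgVar_bound {d q : ℕ} {p : Problem d q} (hp : p.Standing)
    (h : p.BoundedMap) : ∃ C : ℝ, ∀ θ ∈ p.Θ, ∀ l : ℕ, 1 ≤ l →
      avgVar (p.G θ) l ≤ C * (l : ℝ) ^ (-2 : ℝ) := by
  obtain ⟨hinv, C, hC⟩ := h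
  refine ⟨(C * C) ^ 2, fun θ hθ l hl => ?_⟩
  have hC0 : 0 ≤ C := (norm_nonneg _).trans (hC θ hθ 0 ⟨le_rfl, zero_le_one⟩).1
  refine avgVar_le_of_lipschitzOn (hp.measurable_G θ) (by positivity) (fun u hu u' hu' => ?_) hl
  have hder : ∀ x ∈ Set.Icc (0 : Fin q → ℝ) 1, HasFDerivWithinAt (p.G θ)
      ((fderiv ℝ (p.F θ) (p.inv θ x)).comp (fderivWithin ℝ (p.inv θ) (Set.Icc 0 1) x))
      (Set.Icc 0 1) x := by
    intro x hx
    have h1 := ((hinv θ hθ).differentiableOn one_ne_zero x hx).hasFDerivWithinAt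
    have h2 := ((hp.contDiff_F θ hθ).differentiable one_ne_zero (p.inv θ x)).hasFDerivAt
    exact h2.comp_hasFDerivWithinAt x h1
  have := Convex.norm_image_sub_le_of_norm_hasFDerivWithin_le (𝕜 := ℝ) (C := C * C) hder
    (fun x hx => ?_) (convex_Icc 0 1) hu' hu
  · simpa using this
  · obtain ⟨h1, h2⟩ := hC θ hθ x hx
    refine (ContinuousLinearMap.opNorm_comp_le _ _).trans ?_
    gcongr

/-! ### Unbounded maps with independent components -/

/-- `2 * sinh` serves as a smooth increasing primitive: its derivative dominates `exp |x|`, while it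
is itself bounded by `exp |x|`. -/
theorem exp_abs_le_two_mul_cosh (x : ℝ) : Real.exp |x| ≤ 2 * Real.cosh x := by
  rw [← Real.cosh_abs, Real.cosh_eq]
  linarith [Real.exp_pos (-|x|)]

theorem abs_two_mul_sinh_le (x : ℝ) : |2 * Real.sinh x| ≤ Real.exp |x| := by
  have : |Real.sinh x| = Real.sinh |x| := Real.abs_sinh x
  rw [abs_mul, this, Real.sinh_eq, abs_two]
  linarith [Real.exp_pos (-|x|)]

/-- Increment of a function in one coordinate under an exponential bound on its gradient. -/
theorem abs_sub_update_le {q : ℕ} {F : (Fin q → ℝ) → ℝ} (hF : ContDiff ℝ 1 F) {C β : ℝ}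
    (hC : 0 ≤ C) (hβ : 0 < β) (x : Fin q → ℝ) (j : Fin q) {a b : ℝ} (hab : a ≤ b)
    (hgrad : ∀ y ∈ Set.Icc a b, ‖fderiv ℝ F (Function.update x j y)‖
      ≤ C * Real.exp (β * ∑ i, |Function.update x j y i|)) :
    |F (Function.update x j b) - F (Function.update x j a)|
      ≤ C * (∏ i ∈ Finset.univ.erase j, Real.exp (β * |x i|))
        * (2 / β * (Real.sinh (β * b) - Real.sinh (β * a))) := by
  set W : ℝ := C * ∏ i ∈ Finset.univ.erase j, Real.exp (β * |x i|) with hW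
  have hW0 : 0 ≤ W := mul_nonneg hC (Finset.prod_nonneg fun _ _ => (Real.exp_pos _).le)
  set φ : ℝ → ℝ := fun y => F (Function.update x j y) with hφ
  set φ' : ℝ → ℝ := fun y => fderiv ℝ F (Function.update x j y) (Pi.single j 1) with hφ'
  have hder : ∀ y, HasDerivAt φ (φ' y) y := fun y =>
    ((hF.differentiable one_ne_zero _).hasFDerivAt).comp_hasDerivAt y (hasDerivAt_update x j y)
  have hbound : ∀ y ∈ Set.Icc a b, |φ' y| ≤ W * (2 * Real.cosh (β * y)) := by
    intro y hy
    have h1 : |φ' y| ≤ ‖fderiv ℝ F (Function.update x j y)‖ := by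
      have := (fderiv ℝ F (Function.update x j y)).le_opNorm (Pi.single j 1)
      simpa [Pi.norm_single] using this
    refine (h1.trans (hgrad y hy)).trans ?_
    have h2 : Real.exp (β * ∑ i, |Function.update x j y i|)
        = (∏ i ∈ Finset.univ.erase j, Real.exp (β * |x i|)) * Real.exp |β * y| := by
      rw [Finset.mul_sum, Real.exp_sum, ← Finset.prod_erase_mul _ _ (Finset.mem_univ j)]
      congr 1
      · exact Finset.prod_congr rfl fun i hi => by
          rw [Function.update_of_ne (Finset.ne_of_mem_erase hi)]
      · rw [Function.update_self, abs_mul, abs_of_pos hβ]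
    rw [h2, ← mul_assoc, ← hW]
    exact mul_le_mul_of_nonneg_left (exp_abs_le_two_mul_cosh _) hW0
  have hE : ∀ y, HasDerivAt (fun y => W * (2 / β * Real.sinh (β * y)))
      (W * (2 * Real.cosh (β * y))) y := by
    intro y
    have h1 : HasDerivAt (fun y => Real.sinh (β * y)) (Real.cosh (β * y) * (β * 1)) y :=
      ((hasDerivAt_id y).const_mul β).sinh
    convert! (h1.const_mul (2 / β)).const_mul W using 1
    field_simp
  -- The primitive of the bound plus `± φ` has nonnegative derivative; the two signs give the
  -- two-sided estimate.
  have mono : ∀ σ : ℝ, |σ| ≤ 1 →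
      MonotoneOn (fun y => W * (2 / β * Real.sinh (β * y)) + σ * φ y) (Set.Icc a b) := by
    intro σ hσ
    have hd : ∀ y, HasDerivAt (fun y => W * (2 / β * Real.sinh (β * y)) + σ * φ y)
        (W * (2 * Real.cosh (β * y)) + σ * φ' y) y := fun y => (hE y).add ((hder y).const_mul σ)
    refine monotoneOn_of_hasDerivWithinAt_nonneg (convex_Icc a b)
      (fun y _ => (hd y).continuousAt.continuousWithinAt) (fun y _ => (hd y).hasDerivWithinAt)
      fun y hy => ?_
    have h1 := hbound y (interior_subset hy)
    have h2 : |σ * φ' y| ≤ |φ' y| := by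
      rw [abs_mul]; exact mul_le_of_le_one_left (abs_nonneg _) hσ
    linarith [neg_abs_le (σ * φ' y)]
  have h1 := mono 1 (by simp) (Set.left_mem_Icc.mpr hab) (Set.right_mem_Icc.mpr hab) hab
  have h2 := mono (-1) (by simp) (Set.left_mem_Icc.mpr hab) (Set.right_mem_Icc.mpr hab) hab
  simp only at h1 h2
  change |φ b - φ a| ≤ _
  rw [abs_le]
  constructor <;> linarith

/-- `X` has tails of order `e^{-κ y}` in every component, uniformly in `θ ∈ Θ`. -/
def Problem.ExpTails {d q : ℕ} (p : Problem d q) (κ : ℝ) : Prop :=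
  ∃ C : ℝ, ∀ θ ∈ p.Θ, ∀ j, ∀ y : ℝ, 0 ≤ y →
    (p.law θ).real {x | y ≤ |x j|} ≤ C * Real.exp (-(κ * y))

/-- The gradient of `F` in `x` is of order `e^{β ∑ |x_j|}` on the support, uniformly in `θ`. -/
def Problem.ExpGradient {d q : ℕ} (p : Problem d q) (β : ℝ) : Prop :=
  ∃ C : ℝ, ∀ θ ∈ p.Θ, ∀ x ∈ p.inv θ '' openCube q,
    ‖fderiv ℝ (p.F θ) x‖ ≤ C * Real.exp (β * ∑ j, |x j|)

/-! ### From tails to quantiles -/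

theorem unifCube_real_slab {q : ℕ} (j : Fin q) {a b : ℝ} (ha : 0 ≤ a) (hab : a ≤ b) (hb : b ≤ 1) :
    (unifCube q).real {v | v j ∈ Set.Ioc a b} = b - a := by
  have h1 := (measurePreserving_eval (fun _ : Fin q => unif1) j).measureReal_preimage
    (s := Set.Ioc a b) measurableSet_Ioc.nullMeasurableSet
  rw [unifCube_eq_pi]
  refine h1.trans ?_
  rw [unif1, measureReal_restrict_apply measurableSet_Ioc,
    Set.inter_eq_left.mpr (Set.Ioc_subset_Ioc ha hb), Real.volume_real_Ioc_of_le hab]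

theorem tail_lower_bound {d q : ℕ} {p : Problem d q} (hp : p.Standing) {θ : Vec d} (hθ : θ ∈ p.Θ)
    {Q : Fin q → ℝ → ℝ} (hinv : ∀ u ∈ openCube q, ∀ j, p.inv θ u j = Q j (u j)) (j : Fin q)
    {a b y : ℝ} (ha : 0 ≤ a) (hab : a ≤ b) (hb : b ≤ 1)
    (hy : ∀ v ∈ Set.Ioo (0 : ℝ) 1, v ∈ Set.Ioc a b → y ≤ |Q j v|) :
    b - a ≤ (p.law θ).real {x | y ≤ |x j|} := by
  have hm : MeasurableSet {x : Fin q → ℝ | y ≤ |x j|} :=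
    measurableSet_le measurable_const (by fun_prop)
  rw [hp.law_eq θ hθ, map_measureReal_apply (hp.measurable_inv_at θ) hm,
    ← unifCube_real_slab j ha hab hb]
  refine ENNReal.toReal_mono (measure_ne_top _ _) (measure_mono_ae ?_)
  filter_upwards [ae_unifCube_mem q] with v hv hvj
  change y ≤ |p.inv θ v j|
  rw [hinv v hv j]
  exact hy _ (hv j (Set.mem_univ j)) hvj

/-- Tail inversion: if `Q j u ≥ 0`, then `|Q j v| ≥ |Q j u|` for all `v > u`, so `1 - u` is at most
the tail at `|Q j u|`. Solving for the exponential gives the power `(1 - u) ^ (-β/κ)`; for `Q j u ≤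
0` the slab below `u` plays the same role. -/
theorem exp_quantile_le {d q : ℕ} {p : Problem d q} (hp : p.Standing) {θ : Vec d} (hθ : θ ∈ p.Θ)
    {Q : Fin q → ℝ → ℝ} (hinv : ∀ u ∈ openCube q, ∀ j, p.inv θ u j = Q j (u j)) (j : Fin q)
    (hQ : StrictMonoOn (Q j) (Set.Ioo 0 1)) {C κ β : ℝ} (hκ : 0 < κ) (hβ : 0 < β) (hC : 0 < C)
    (htail : ∀ y : ℝ, 0 ≤ y → (p.law θ).real {x | y ≤ |x j|} ≤ C * Real.exp (-(κ * y)))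
    {u : ℝ} (hu : u ∈ Set.Ioo (0 : ℝ) 1) :
    Real.exp (β * |Q j u|) ≤ C ^ (β / κ) * endWeight (β / κ) u := by
  set s := β / κ with hs
  have hs0 : 0 < s := by positivity
  have key : ∀ m : ℝ, 0 < m → m ≤ C * Real.exp (-(κ * |Q j u|)) →
      Real.exp (β * |Q j u|) ≤ C ^ s * m ^ (-s) := by
    intro m hm h
    have h1 : Real.exp (κ * |Q j u|) ≤ C * m⁻¹ := by
      rw [Real.exp_neg] at h
      rw [← div_eq_mul_inv, le_div_iff₀ hm]
      rwa [← div_eq_mul_inv, le_div_iff₀ (Real.exp_pos _), mul_comm] at h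
    have h2 : Real.exp (β * |Q j u|) = Real.exp (κ * |Q j u|) ^ s := by
      rw [← Real.exp_mul, hs]
      congr 1
      field_simp
    rw [h2, Real.rpow_neg hm.le, ← Real.inv_rpow hm.le, ← Real.mul_rpow hC.le (by positivity)]
    exact Real.rpow_le_rpow (Real.exp_pos _).le h1 hs0.le
  have hCs : 0 ≤ C ^ s := by positivity
  have hu1 : 0 < 1 - u := by linarith [hu.2]
  have p1 : 0 ≤ u ^ (-s) := Real.rpow_nonneg hu.1.le _
  have p2 : 0 ≤ (1 - u) ^ (-s) := Real.rpow_nonneg hu1.le _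
  rw [endWeight, mul_add]
  rcases le_total 0 (Q j u) with h | h
  · have h1 := tail_lower_bound hp hθ hinv j (y := |Q j u|) hu.1.le hu.2.le le_rfl
      fun v hv hvu => by
        have := hQ hu hv hvu.1
        rw [abs_of_nonneg h, abs_of_nonneg (h.trans this.le)]
        exact this.le
    have := key (1 - u) hu1 (h1.trans (htail _ (abs_nonneg _)))
    have := mul_nonneg hCs p1
    linarith
  · have h1 := tail_lower_bound hp hθ hinv j (y := |Q j u|) le_rfl hu.1.le hu.2.le
      fun v hv hvu => by
        have := hQ.monotoneOn hv hu hvu.2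
        rw [abs_of_nonpos h, abs_of_nonpos (this.trans h)]
        linarith
    rw [sub_zero] at h1
    have := key u hu.1 (h1.trans (htail _ (abs_nonneg _)))
    have := mul_nonneg hCs p2
    linarith

/-- In cube coordinates each factor `e^{β|x_i|}` becomes an end weight with `s = β / κ`, and the
increment in `x_j` becomes one of `sinh (β Q_j)`, monotone in `u_j`. The condition `2β < κ` is `s <
1/2`. -/
theorem Problem.IndepMargins.exists_avgVar_bound {d q : ℕ} {p : Problem d q} (hp : p.Standing)
    (h : p.IndepMargins) {κ β : ℝ} (hβ : 0 < β) (hκ : 2 * β < κ) (htail : p.ExpTails κ)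
    (hgrad : p.ExpGradient β) : ∃ C : ℝ, ∀ θ ∈ p.Θ, ∀ l : ℕ, 1 ≤ l →
      avgVar (p.G θ) l ≤ C * (l : ℝ) ^ (-(1 - 2 * β / κ)) := by
  classical
  obtain ⟨Q, hQ⟩ := h
  obtain ⟨Ct, hCt⟩ := htail
  obtain ⟨Cg, hCg⟩ := hgrad
  have hκ0 : 0 < κ := by linarith
  set K : ℝ := max Ct 1 ^ (β / κ) with hK
  have hCt1 : 0 < max Ct 1 := lt_max_of_lt_right one_pos
  have hK0 : 0 < K := by positivity
  -- One `K` for each of the other `q - 1` coordinates, and `K / β` from normalizing the `sinh`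
  -- increment in coordinate `j`.
  set B : ℝ := |Cg| * K ^ (q - 1) * (1 / β * K) with hB
  obtain ⟨C', hC'⟩ := SASTRO.exists_avgVar_bound q (s := β / κ) (C := B) (by positivity)
    (by rw [div_lt_div_iff₀ hκ0 two_pos]; linarith)
  refine ⟨C', fun θ hθ l hl => ?_⟩
  obtain ⟨hQθ, hinv⟩ := hQ θ hθ
  have hquant : ∀ j, ∀ u ∈ Set.Ioo (0 : ℝ) 1,
      Real.exp (β * |Q θ j u|) ≤ K * endWeight (β / κ) u := fun j u hu =>
    exp_quantile_le hp hθ hinv j (hQθ j).1 hκ0 hβ hCt1 (fun y hy => (hCt θ hθ j y hy).trans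
      (by gcongr; exact le_max_left _ _)) hu
  have hcont : ∀ j, ContinuousOn (Q θ j) (Set.Ioo 0 1) := fun j => (hQθ j).2.continuousOn
  -- The quantile function is only known on `(0,1)`; extension by 0 makes `ψ j` measurable on the
  -- line.
  set ψ : Fin q → ℝ → ℝ := fun j => (Set.Ioo (0 : ℝ) 1).piecewise
    (fun u => 2 * Real.sinh (β * Q θ j u) / K) 0 with hψ
  have hψ_eq : ∀ j, ∀ u ∈ Set.Ioo (0 : ℝ) 1, ψ j u = 2 * Real.sinh (β * Q θ j u) / K :=
    fun j u hu => Set.piecewise_eq_of_mem _ _ _ hu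
  have hmul : 2 * β / κ = 2 * (β / κ) := by ring
  rw [hmul]
  refine hC' (p.G θ) ψ (hp.measurable_G θ) (hp.memLp_G hθ) (fun j => ?_) (fun j => ?_)
    (fun j u hu => ?_) (fun u hu j t ht => ?_) l hl
  · refine ContinuousOn.measurable_piecewise ?_ continuousOn_const measurableSet_Ioo
    exact (continuousOn_const.mul (Real.continuous_sinh.comp_continuousOn
      (continuousOn_const.mul (hcont j)))).div_const K
  · intro a ha b hb hab
    rw [hψ_eq j a ha, hψ_eq j b hb]
    have := (hQθ j).1.monotoneOn ha hb hab
    have : Real.sinh (β * Q θ j a) ≤ Real.sinh (β * Q θ j b) :=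
      Real.sinh_le_sinh.mpr (by gcongr)
    gcongr
  · rw [hψ_eq j u hu, abs_div, abs_of_pos hK0, div_le_iff₀ hK0, mul_comm (endWeight _ _)]
    refine (abs_two_mul_sinh_le _).trans ?_
    rw [abs_mul, abs_of_pos hβ]
    exact hquant j u hu
  · have hu' : ∀ i, u i ∈ Set.Ioo (0 : ℝ) 1 := fun i => hu i (Set.mem_univ i)
    have hupd : ∀ v ∈ Set.Ioo (0 : ℝ) 1, Function.update u j v ∈ openCube q := by
      intro v hv i _
      by_cases hij : i = j
      · subst hij; simpa using hv
      · simpa [Function.update_of_ne hij] using hu' i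
    have hinv_upd : ∀ v ∈ Set.Ioo (0 : ℝ) 1, p.inv θ (Function.update u j v)
        = Function.update (p.inv θ u) j (Q θ j v) := by
      intro v hv
      ext i
      rw [hinv _ (hupd v hv)]
      by_cases hij : i = j
      · subst hij; simp
      · simp [Function.update_of_ne hij, hinv u hu]
    have hmain : ∀ a ∈ Set.Ioo (0 : ℝ) 1, ∀ b ∈ Set.Ioo (0 : ℝ) 1, a ≤ b →
        |p.G θ (Function.update u j b) - p.G θ (Function.update u j a)|
          ≤ B * (∏ i ∈ Finset.univ.erase j, endWeight (β / κ) (u i)) * |ψ j b - ψ j a| := by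
      intro a ha b hb hab
      have hQab := (hQθ j).1.monotoneOn ha hb hab
      have hdiff := abs_sub_update_le (hp.contDiff_F θ hθ) (abs_nonneg Cg) hβ (p.inv θ u) j
        hQab (fun y hy => ?_)
      · rw [← hinv_upd a ha, ← hinv_upd b hb] at hdiff
        refine hdiff.trans ?_
        have hsinh : Real.sinh (β * Q θ j a) ≤ Real.sinh (β * Q θ j b) :=
          Real.sinh_le_sinh.mpr (by gcongr)
        have e1 : 2 / β * (Real.sinh (β * Q θ j b) - Real.sinh (β * Q θ j a))
            = 1 / β * K * |ψ j b - ψ j a| := by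
          rw [hψ_eq j a ha, hψ_eq j b hb, ← sub_div, ← mul_sub, abs_of_nonneg]
          · field_simp
          · exact div_nonneg (mul_nonneg two_pos.le (sub_nonneg.mpr hsinh)) hK0.le
        have e2 : ∏ i ∈ Finset.univ.erase j, Real.exp (β * |p.inv θ u i|)
            ≤ K ^ (q - 1) * ∏ i ∈ Finset.univ.erase j, endWeight (β / κ) (u i) := by
          have : K ^ (q - 1) = ∏ _i ∈ Finset.univ.erase j, K := by
            simp [Finset.card_erase_of_mem]
          rw [this, ← Finset.prod_mul_distrib]
          refine Finset.prod_le_prod (fun _ _ => (Real.exp_pos _).le) fun i _ => ?_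
          rw [hinv u hu]
          exact hquant i _ (hu' i)
        rw [e1, hB]
        calc _ ≤ |Cg| * (K ^ (q - 1) * ∏ i ∈ Finset.univ.erase j, endWeight (β / κ) (u i))
              * (1 / β * K * |ψ j b - ψ j a|) := by gcongr
          _ = _ := by ring
      -- The growth bound holds only on the support. By continuity of the quantile function every
      -- value between two quantiles is a quantile, so the whole segment lies there.
      · obtain ⟨v, hv, rfl⟩ : y ∈ Q θ j '' Set.Ioo 0 1 := by
          have hpc := (isPreconnected_Ioo.image _ (hcont j)).ordConnected
          exact hpc.out ⟨a, ha, rfl⟩ ⟨b, hb, rfl⟩ hy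
        refine (hCg θ hθ _ ⟨_, hupd v hv, hinv_upd v hv⟩).trans ?_
        gcongr
        exact le_abs_self Cg
    rw [show p.G θ u = p.G θ (Function.update u j (u j)) by rw [Function.update_eq_self]]
    rcases le_total (u j) t with hle | hle
    · rw [abs_sub_comm, abs_sub_comm (ψ j (u j))]
      exact hmain _ (hu' j) _ ht hle
    · exact hmain _ ht _ (hu' j) hle

/-! ### The five specifications -/

theorem Problem.SubExp.expTails {d q : ℕ} {p : Problem d q} {κ : Fin q → ℝ} (h : p.SubExp κ) :
    p.ExpTails (kappaMin κ) := by
  obtain ⟨-, C, hC⟩ := h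
  refine ⟨|C|, fun θ hθ j y hy => (hC θ hθ j y hy).trans ?_⟩
  have : kappaMin κ ≤ κ j := ciInf_le (Set.finite_range κ).bddBelow j
  gcongr
  exact le_abs_self C

theorem kappaMin_pos {q : ℕ} (hq : 1 ≤ q) {κ : Fin q → ℝ} (h : ∀ j, 0 < κ j) :
    0 < kappaMin κ := by
  have : Nonempty (Fin q) := ⟨⟨0, hq⟩⟩
  obtain ⟨j, hj⟩ := exists_eq_ciInf_of_finite (f := κ)
  rw [kappaMin, ← hj]
  exact h j

/-- Gaussian tails beat every exponential rate: `κ y ≤ (y / ξ)² + (κ ξ)²`. -/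
theorem Problem.SubGauss.expTails {d q : ℕ} {p : Problem d q} {ξ : Fin q → ℝ} (h : p.SubGauss ξ)
    (κ : ℝ) : p.ExpTails κ := by
  obtain ⟨hξ, C, hC⟩ := h
  refine ⟨|C| * Real.exp (∑ i, (κ * ξ i) ^ 2), fun θ hθ j y hy => (hC θ hθ j y hy).trans ?_⟩
  rw [mul_assoc, ← Real.exp_add]
  have h1 : (κ * ξ j) ^ 2 ≤ ∑ i, (κ * ξ i) ^ 2 :=
    Finset.single_le_sum (f := fun i => (κ * ξ i) ^ 2) (fun _ _ => sq_nonneg _)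
      (Finset.mem_univ j)
  have h2 : κ * y ≤ (y / ξ j) ^ 2 + (κ * ξ j) ^ 2 := by
    have e : κ * y = (y / ξ j) * (κ * ξ j) := by
      have := (hξ j).ne'
      field_simp
    rw [e]
    nlinarith [sq_nonneg (y / ξ j - κ * ξ j), sq_nonneg (y / ξ j), sq_nonneg (κ * ξ j)]
  gcongr
  · exact le_abs_self C
  · linarith

theorem Problem.ExpGrowth.expGradient {d q : ℕ} {p : Problem d q} {b : Fin q → ℝ}
    (h : p.ExpGrowth b) {β : ℝ} (hβ : bMax b ≤ β) : p.ExpGradient β := by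
  obtain ⟨C, hC⟩ := h
  refine ⟨|C|, fun θ hθ x hx => (hC θ hθ x hx).2.trans ?_⟩
  have : ∑ j, b j * x j ≤ β * ∑ j, |x j| := by
    rw [Finset.mul_sum]
    refine Finset.sum_le_sum fun j _ => ?_
    have h1 : |b j| ≤ β := (le_ciSup (f := fun j => |b j|) (Set.finite_range _).bddAbove j).trans hβ
    calc b j * x j ≤ |b j * x j| := le_abs_self _
      _ = |b j| * |x j| := abs_mul _ _
      _ ≤ β * |x j| := by gcongr
  gcongr
  exact le_abs_self C

/-- Any positive rate `β` works, since `(β x) ^ a / a! ≤ e^{β x}` for `x ≥ 0`. -/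
theorem Problem.PolyGrowth.expGradient {d q : ℕ} {p : Problem d q} {a : Fin q → ℕ}
    (h : p.PolyGrowth a) {β : ℝ} (hβ : 0 < β) : p.ExpGradient β := by
  obtain ⟨C, hC⟩ := h
  refine ⟨|C| * (1 + ∑ j, (a j).factorial / β ^ a j), fun θ hθ x hx =>
    (hC θ hθ x hx).2.trans ?_⟩
  rw [mul_assoc, add_mul, one_mul, Finset.sum_mul]
  have hS : ∀ j, |x j| ≤ ∑ i, |x i| := fun j =>
    Finset.single_le_sum (f := fun i => |x i|) (fun _ _ => abs_nonneg _) (Finset.mem_univ j)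
  have h1 : 1 ≤ Real.exp (β * ∑ i, |x i|) :=
    Real.one_le_exp (mul_nonneg hβ.le (Finset.sum_nonneg fun _ _ => abs_nonneg _))
  have h2 : ∀ j, |x j| ^ a j ≤ (a j).factorial / β ^ a j * Real.exp (β * ∑ i, |x i|) := by
    intro j
    have h3 := Real.pow_div_factorial_le_exp (x := β * |x j|) (by positivity) (a j)
    have h4 : Real.exp (β * |x j|) ≤ Real.exp (β * ∑ i, |x i|) := by
      gcongr
      exact hS j
    have h5 := h3.trans h4
    rw [mul_pow, div_le_iff₀ (by positivity)] at h5
    rw [div_mul_eq_mul_div, le_div_iff₀ (by positivity)]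
    linarith
  have h6 : 0 ≤ 1 + ∑ j, |x j| ^ a j :=
    add_nonneg zero_le_one (Finset.sum_nonneg fun _ _ => by positivity)
  refine (mul_le_mul_of_nonneg_right (le_abs_self C) h6).trans ?_
  gcongr with j _
  exact h2 j

/-- What a specification provides: the average variance over the strata of a sample with `l` splits
is of order `l^{-r}`, the deflating sequence is `k^e`, and the exponents balance. -/
theorem Regime.Holds.exists_rate {d q : ℕ} (hq : 1 ≤ q) {p : Problem d q} (hp : p.Standing)
    {reg : Regime q} (hreg : reg.Holds p) {δ : ℝ} (hδ : 0 < δ) :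
    ∃ r e C : ℝ, 0 < r ∧ 0 < e ∧ (∀ k : ℕ, reg.lam δ k = (k : ℝ) ^ e) ∧
      1 < e * ((q + r) / q) ∧ 2 ≤ reg.gam * ((q + r) / q) ∧
      ∀ θ ∈ p.Θ, ∀ l : ℕ, 1 ≤ l → avgVar (p.G θ) l ≤ C * (l : ℝ) ^ (-r) := by
  have hq1 : (1 : ℝ) ≤ q := by exact_mod_cast hq
  have hq0 : (0 : ℝ) < q := by linarith
  -- In three of the unbounded cases `2β/κ` can be any small `τ`, giving `r = 1 - τ`. The loss `τ`
  -- is absorbed by `δ` in the exponent of `λ_k` and by `rho` in `γ`.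
  have slack : ∀ rho : ℝ, 0 < rho → ∃ τ : ℝ, 0 < τ ∧ τ < 1 ∧
      1 < (1 + δ) * q / (q + 1) * ((q + (1 - τ)) / q) ∧
      2 ≤ (4 + rho) * q / (2 * (q + 1)) * ((q + (1 - τ)) / q) := by
    intro rho hrho
    refine ⟨min (1 / 2) (min (δ / (1 + δ)) (rho / (4 + rho))), by positivity,
      (min_le_left _ _).trans_lt (by norm_num), ?_, ?_⟩
    · set τ := min (1 / 2) (min (δ / (1 + δ)) (rho / (4 + rho)))
      have h1 : τ ≤ δ / (1 + δ) := (min_le_right _ _).trans (min_le_left _ _)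
      rw [le_div_iff₀ (by positivity)] at h1
      have e : (1 + δ) * q / (q + 1) * ((q + (1 - τ)) / q)
          = (1 + δ) * (q + (1 - τ)) / (q + 1) := by field_simp
      rw [e, one_lt_div (by positivity)]
      nlinarith
    · set τ := min (1 / 2) (min (δ / (1 + δ)) (rho / (4 + rho)))
      have h1 : τ ≤ rho / (4 + rho) := (min_le_right _ _).trans (min_le_right _ _)
      rw [le_div_iff₀ (by positivity)] at h1
      have e : (4 + rho) * q / (2 * (q + 1)) * ((q + (1 - τ)) / q)
          = (4 + rho) * (q + (1 - τ)) / (2 * (q + 1)) := by field_simp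
      rw [e, le_div_iff₀ (by positivity)]
      nlinarith
  cases reg with
  | bounded =>
    obtain ⟨C, hC⟩ := Problem.BoundedMap.exists_avgVar_bound hp hreg
    refine ⟨2, (1 + δ) * q / (q + 2), C, two_pos, by positivity, fun k => rfl, ?_, ?_, hC⟩
    · have e : (1 + δ) * q / (q + 2) * ((q + 2) / q) = 1 + δ := by field_simp
      rw [e]; linarith
    · refine le_of_eq ?_
      simp only [Regime.gam]
      field_simp
  | subExpPoly κ a rho =>
    obtain ⟨hrho, hind, hsub, hgrow⟩ := hreg
    obtain ⟨τ, hτ0, hτ1, h1, h2⟩ := slack rho hrho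
    have hκ := kappaMin_pos hq hsub.1
    -- Polynomial growth leaves `β` free; this value makes `2β/κ = τ`.
    obtain ⟨C, hC⟩ := hind.exists_avgVar_bound hp (β := τ * kappaMin κ / 2) (by positivity)
      (by nlinarith) hsub.expTails (hgrow.expGradient (by positivity))
    have e : 2 * (τ * kappaMin κ / 2) / kappaMin κ = τ := by field_simp
    rw [e] at hC
    exact ⟨1 - τ, _, C, by linarith, by positivity, fun k => rfl, h1, h2, hC⟩
  | subExpExp κ b =>
    obtain ⟨hb, hbκ, hind, hsub, hgrow⟩ := hreg
    have hb0 : 0 < bMax b := by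
      obtain ⟨j, hj⟩ := Function.ne_iff.mp hb
      exact (abs_pos.mpr hj).trans_le
        (le_ciSup (f := fun j => |b j|) (Set.finite_range _).bddAbove j)
    have hκ := kappaMin_pos hq hsub.1
    obtain ⟨C, hC⟩ := hind.exists_avgVar_bound hp hb0 hbκ hsub.expTails (hgrow.expGradient le_rfl)
    have hden : 0 < (q + 1) * kappaMin κ - 2 * bMax b := by nlinarith
    have er : (q + (1 - 2 * bMax b / kappaMin κ)) / q
        = ((q + 1) * kappaMin κ - 2 * bMax b) / (kappaMin κ * q) := by
      field_simp
      ring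
    refine ⟨1 - 2 * bMax b / kappaMin κ, _, C, ?_, by positivity, fun k => rfl, ?_, ?_, hC⟩
    · rw [sub_pos, div_lt_one hκ]; exact hbκ
    · rw [er]
      have : (1 + δ) * q * kappaMin κ / ((q + 1) * kappaMin κ - 2 * bMax b)
          * (((q + 1) * kappaMin κ - 2 * bMax b) / (kappaMin κ * q)) = 1 + δ := by
        generalize (q + 1) * kappaMin κ - 2 * bMax b = D at hden ⊢
        field_simp
      rw [this]; linarith
    · rw [er]
      refine le_of_eq ?_
      simp only [Regime.gam]
      generalize (q + 1) * kappaMin κ - 2 * bMax b = D at hden ⊢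
      field_simp
  | subGaussPoly ξ a rho =>
    obtain ⟨hrho, hind, hsub, hgrow⟩ := hreg
    obtain ⟨τ, hτ0, hτ1, h1, h2⟩ := slack rho hrho
    obtain ⟨C, hC⟩ := hind.exists_avgVar_bound hp (κ := 1) (β := τ / 2) (by positivity)
      (by linarith) (hsub.expTails 1) (hgrow.expGradient (by positivity))
    have e : 2 * (τ / 2) / 1 = τ := by ring
    rw [e] at hC
    exact ⟨1 - τ, _, C, by linarith, by positivity, fun k => rfl, h1, h2, hC⟩
  | subGaussExp ξ b rho =>
    obtain ⟨hrho, hind, hsub, hgrow⟩ := hreg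
    obtain ⟨τ, hτ0, hτ1, h1, h2⟩ := slack rho hrho
    have hb0 : 0 < |bMax b| + 1 := by positivity
    -- Here `β` is dictated by `b`, but the tail rate `κ` is free and is taken so large that `2β/κ =
    -- τ`.
    obtain ⟨C, hC⟩ := hind.exists_avgVar_bound hp (κ := 2 * (|bMax b| + 1) / τ) hb0
      (by rw [lt_div_iff₀ hτ0]; nlinarith) (hsub.expTails _)
      (hgrow.expGradient ((le_abs_self _).trans (by linarith)))
    have e : 2 * (|bMax b| + 1) / (2 * (|bMax b| + 1) / τ) = τ := by field_simp
    rw [e] at hC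
    exact ⟨1 - τ, _, C, by linarith, by positivity, fun k => rfl, h1, h2, hC⟩

/-! ### Measurability of the stratified estimators -/

/-- Draws for all numbers of splits, strata and repetitions. -/
abbrev CellIdx (q : ℕ) : Type := ℕ × (Fin q → ℕ) × ℕ

section Measurability

variable {α : Type*} [MeasurableSpace α] {q : ℕ} {H : α → (Fin q → ℝ) → ℝ}

theorem measurable_apply_inCell (hH : Measurable fun z : α × (Fin q → ℝ) => H z.1 z.2) (l : ℕ)
    (c : Fin q → ℕ) {w : α → Fin q → ℝ} (hw : Measurable w) :
    Measurable fun a => H a (inCell l c (w a)) :=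
  hH.comp (measurable_id.prodMk ((measurable_inCell l c).comp hw))

theorem measurable_cellMean (hH : Measurable fun z : α × (Fin q → ℝ) => H z.1 z.2) (m l : ℕ)
    (c : Fin q → ℕ) {w : ℕ → α → Fin q → ℝ} (hw : ∀ r, Measurable (w r)) :
    Measurable fun a => cellMean (H a) m l c fun r => w r a := by
  have := fun r => measurable_apply_inCell hH l c (hw r)
  unfold cellMean
  exact (Finset.measurable_sum _ fun r _ => this r).div_const _

theorem measurable_stratMean (hH : Measurable fun z : α × (Fin q → ℝ) => H z.1 z.2) (m l : ℕ)
    {w : (Fin q → ℕ) → ℕ → α → Fin q → ℝ} (hw : ∀ c r, Measurable (w c r)) :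
    Measurable fun a => stratMean (H a) m l fun c r => w c r a := by
  have := fun c => measurable_cellMean hH m l c (hw c)
  unfold stratMean
  fun_prop

theorem measurable_stratVar (hH : Measurable fun z : α × (Fin q → ℝ) => H z.1 z.2) (m l : ℕ)
    {w : (Fin q → ℕ) → ℕ → α → Fin q → ℝ} (hw : ∀ c r, Measurable (w c r)) :
    Measurable fun a => stratVar (H a) m l fun c r => w c r a := by
  have h1 := fun c => measurable_cellMean hH m l c (hw c)
  have h2 := fun c r => measurable_apply_inCell hH l c (hw c r)
  unfold stratVar cellVar
  exact (Finset.measurable_sum _ fun c _ => (Finset.measurable_sum _ fun r _ =>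
    ((h2 c r).sub (h1 c)).pow_const 2).div_const _).div_const _

theorem measurableSet_samplingRule (A : Params) (lam gam : ℝ) {Δ : α → ℝ} (hΔ : Measurable Δ)
    (hH : Measurable fun z : α × (Fin q → ℝ) => H z.1 z.2) (l : ℕ)
    {w : (Fin q → ℕ) → ℕ → α → Fin q → ℝ} (hw : ∀ c r, Measurable (w c r)) :
    MeasurableSet {a | SamplingRule A lam gam (Δ a) (H a) l fun c r => w c r a} := by
  have := measurable_stratVar hH A.nbar l hw
  simp only [SamplingRule, Set.ofPred_and]
  refine (MeasurableSet.const _).inter ((MeasurableSet.const _).inter ?_)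
  refine measurableSet_le (f := fun a => √lam * √(max A.varMin
    (stratVar (H a) A.nbar l fun c r => w c r a) / ((A.nbar : ℝ) * (l : ℝ) ^ q)))
    (g := fun a => A.κas * Δ a ^ gam) ?_ ?_ <;> fun_prop

theorem measurable_sInf_nat {S : α → Set ℕ} (hS : ∀ l, MeasurableSet {a | l ∈ S a}) :
    Measurable fun a => sInf (S a) := by
  refine measurable_to_countable' fun n => ?_
  -- The second set accounts for `sInf ∅ = 0`.
  have : (fun a => sInf (S a)) ⁻¹' {n}
      = ({a | n ∈ S a} ∩ ⋂ m ∈ Set.Iio n, {a | m ∈ S a}ᶜ)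
        ∪ ({a | n = 0} ∩ ⋂ m, {a | m ∈ S a}ᶜ) := by
    ext a
    simp only [Set.mem_preimage, Set.mem_singleton_iff, Set.mem_union, Set.mem_inter_iff,
      Set.mem_ofPred_eq, Set.mem_iInter, Set.mem_compl_iff, Set.mem_Iio]
    constructor
    · rintro rfl
      rcases (S a).eq_empty_or_nonempty with h | h
      · exact Or.inr ⟨by simp [h], by simp [h]⟩
      · exact Or.inl ⟨Nat.sInf_mem h, fun m hm => Nat.notMem_of_lt_sInf hm⟩
    · rintro (⟨h1, h2⟩ | ⟨rfl, h2⟩)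
      · exact le_antisymm (Nat.sInf_le h1)
          (le_csInf ⟨n, h1⟩ fun m hm => not_lt.mp fun hlt => h2 m hlt hm)
      · rw [Set.eq_empty_iff_forall_notMem.mpr h2, Nat.sInf_empty]
  rw [this]
  exact ((hS n).inter (MeasurableSet.biInter (Set.to_countable _) fun m _ => (hS m).compl)).union
    ((MeasurableSet.const _).inter (MeasurableSet.iInter fun m => (hS m).compl))

theorem measurable_adaptiveEstimate (A : Params) (lam gam : ℝ) {Δ : α → ℝ} (hΔ : Measurable Δ)
    (hH : Measurable fun z : α × (Fin q → ℝ) => H z.1 z.2)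
    {w : ℕ → (Fin q → ℕ) → ℕ → α → Fin q → ℝ} (hw : ∀ l c r, Measurable (w l c r)) :
    Measurable fun a => adaptiveEstimate A lam gam (Δ a) (H a) fun l c r => w l c r a := by
  have h1 : Measurable fun a => splits A lam gam (Δ a) (H a) fun l c r => w l c r a :=
    measurable_sInf_nat (S := fun a => {l | SamplingRule A lam gam (Δ a) (H a) l
      fun c r => w l c r a}) fun l => measurableSet_samplingRule A lam gam hΔ hH l (hw l)
  have h2 : Measurable fun z : ℕ × α => stratMean (H z.2) A.nbar z.1 fun c r => w z.1 c r z.2 :=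
    -- The random number of splits takes countably many values, so measurability for each fixed `l`
    -- suffices.
    measurable_from_prod_countable_right fun l => measurable_stratMean hH A.nbar l (hw l)
  have h3 := h2.comp (h1.prodMk measurable_id)
  simpa only [adaptiveEstimate, Function.comp_def, id] using h3

end Measurability

/-! ### Moments of the stratified estimators -/

section Fixed

variable {Ω : Type*} [MeasurableSpace Ω] {P : Measure Ω} {q : ℕ}
  {W : CellIdx q → Ω → Fin q → ℝ} {G : (Fin q → ℝ) → ℝ}

theorem memLp_draw (hW : ∀ t, Measurable (W t)) (hWu : ∀ t, P.map (W t) = unifCube q)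
    (hG : MemLp G 2 (unifCube q)) {l : ℕ} (hl : 1 ≤ l) {c : Fin q → ℕ} (hc : c ∈ cells q l)
    (t : CellIdx q) : MemLp (fun ω => G (inCell l c (W t ω))) 2 P := by
  have h := memLp_comp_inCell hl hc hG
  rw [← hWu t] at h
  exact h.comp_of_map (hW t).aemeasurable

theorem integral_draw (hW : ∀ t, Measurable (W t)) (hWu : ∀ t, P.map (W t) = unifCube q)
    (hGm : Measurable G) (l : ℕ) (c : Fin q → ℕ) (t : CellIdx q) :
    ∫ ω, G (inCell l c (W t ω)) ∂P = ∫ v, G (inCell l c v) ∂unifCube q := by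
  rw [← hWu t]
  exact (integral_map (hW t).aemeasurable
    (hGm.comp (measurable_inCell l c)).aestronglyMeasurable).symm

theorem variance_draw (hW : ∀ t, Measurable (W t)) (hWu : ∀ t, P.map (W t) = unifCube q)
    (hGm : Measurable G) (l : ℕ) (c : Fin q → ℕ) (t : CellIdx q) :
    variance (fun ω => G (inCell l c (W t ω))) P
      = variance (fun v => G (inCell l c v)) (unifCube q) := by
  rw [← hWu t]
  exact (variance_map (hGm.comp (measurable_inCell l c)).aemeasurable (hW t).aemeasurable).symm

theorem stratMean_eq_sum (m l : ℕ) (v : (Fin q → ℕ) → ℕ → Fin q → ℝ) :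
    stratMean G m l v = ((m : ℝ) * (l : ℝ) ^ q)⁻¹ *
      ∑ x ∈ cells q l ×ˢ Finset.range m, G (inCell l x.1 (v x.1 x.2)) := by
  rw [Finset.sum_product, stratMean]
  simp only [cellMean]
  rw [← Finset.sum_div, div_div, div_eq_inv_mul]

theorem integral_stratMean [IsProbabilityMeasure P] (hW : ∀ t, Measurable (W t))
    (hWu : ∀ t, P.map (W t) = unifCube q)
    (hGm : Measurable G) (hG : MemLp G 2 (unifCube q)) {m l : ℕ} (hm : 1 ≤ m) (hl : 1 ≤ l) :
    ∫ ω, stratMean G m l (fun c r => W (l, c, r) ω) ∂P = ∫ u, G u ∂unifCube q := by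
  simp_rw [stratMean_eq_sum]
  rw [integral_const_mul, integral_finsetSum]
  · simp_rw [integral_draw hW hWu hGm]
    rw [← sum_integral_inCell hl hG, Finset.sum_product]
    have : (0 : ℝ) < m := by exact_mod_cast hm
    simp only [Finset.sum_const, Finset.card_range, nsmul_eq_mul, ← Finset.mul_sum]
    field_simp
  · rintro ⟨c, r⟩ hx
    exact (memLp_draw hW hWu hG hl (Finset.mem_product.mp hx).1 _).integrable one_le_two

theorem memLp_stratMean [IsProbabilityMeasure P] (hW : ∀ t, Measurable (W t))
    (hWu : ∀ t, P.map (W t) = unifCube q)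
    (hG : MemLp G 2 (unifCube q)) {m l : ℕ} (hl : 1 ≤ l) :
    MemLp (fun ω => stratMean G m l (fun c r => W (l, c, r) ω)) 2 P := by
  simp_rw [stratMean_eq_sum]
  exact (memLp_finsetSum _ fun x hx =>
    memLp_draw hW hWu hG hl (Finset.mem_product.mp hx).1 _).const_mul _

theorem variance_stratMean [IsProbabilityMeasure P] (hW : ∀ t, Measurable (W t))
    (hWu : ∀ t, P.map (W t) = unifCube q)
    (hWi : iIndepFun W P) (hGm : Measurable G) (hG : MemLp G 2 (unifCube q)) {m l : ℕ}
    (hm : 1 ≤ m) (hl : 1 ≤ l) :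
    variance (fun ω => stratMean G m l (fun c r => W (l, c, r) ω)) P
      = avgVar G l / (m * (l : ℝ) ^ q) := by
  simp_rw [stratMean_eq_sum]
  rw [variance_const_mul]
  set X : (Fin q → ℕ) × ℕ → Ω → ℝ := fun x ω => G (inCell l x.1 (W (l, x.1, x.2) ω)) with hX
  have hpair : ∀ x y, x ≠ y → IndepFun (X x) (X y) P := by
    intro x y hxy
    have hne : ((l, x.1, x.2) : CellIdx q) ≠ (l, y.1, y.2) := fun h => hxy (by
      simp only [Prod.mk.injEq, true_and] at h
      exact Prod.ext h.1 h.2)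
    have h1 : Measurable fun v => G (inCell l x.1 v) := hGm.comp (measurable_inCell l x.1)
    have h2 : Measurable fun v => G (inCell l y.1 v) := hGm.comp (measurable_inCell l y.1)
    exact (hWi.indepFun hne).comp h1 h2
  have h := IndepFun.variance_sum (μ := P) (s := cells q l ×ˢ Finset.range m) (X := X)
    (fun x hx => memLp_draw hW hWu hG hl (Finset.mem_product.mp hx).1 _)
    (fun x _ y _ hxy => hpair x y hxy)
  rw [Finset.sum_fn] at h
  simp only [hX] at h
  rw [h]
  simp_rw [variance_draw hW hWu hGm]
  rw [Finset.sum_product, avgVar]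
  simp only [Finset.sum_const, Finset.card_range, nsmul_eq_mul, ← Finset.mul_sum]
  have : (0 : ℝ) < m := by exact_mod_cast hm
  have : (0 : ℝ) < l := by exact_mod_cast hl
  field_simp

theorem prob_stratMean_error_le [IsProbabilityMeasure P] (hW : ∀ t, Measurable (W t))
    (hWu : ∀ t, P.map (W t) = unifCube q) (hWi : iIndepFun W P) (hGm : Measurable G)
    (hG : MemLp G 2 (unifCube q)) {m l : ℕ} (hm : 1 ≤ m) (hl : 1 ≤ l) {t : ℝ} (ht : 0 < t) :
    P {ω | t < |stratMean G m l (fun c r => W (l, c, r) ω) - ∫ u, G u ∂unifCube q|}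
      ≤ ENNReal.ofReal (avgVar G l / (m * (l : ℝ) ^ q) / t ^ 2) := by
  have h := meas_ge_le_variance_div_sq (memLp_stratMean (m := m) hW hWu hG hl) ht
  rw [variance_stratMean hW hWu hWi hGm hG hm hl, integral_stratMean hW hWu hGm hG hm hl] at h
  refine le_trans (measure_mono ?_) h
  intro ω hω
  simp only [Set.mem_ofPred_eq] at hω ⊢
  exact hω.le

theorem sum_sq_sub_mean_le (m : ℕ) (x : ℕ → ℝ) (μ : ℝ) :
    ∑ r ∈ Finset.range m, (x r - (∑ i ∈ Finset.range m, x i) / m) ^ 2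
      ≤ ∑ r ∈ Finset.range m, (x r - μ) ^ 2 := by
  rcases Nat.eq_zero_or_pos m with rfl | hm
  · simp
  have hm0 : (0 : ℝ) < m := by exact_mod_cast hm
  set M := (∑ i ∈ Finset.range m, x i) / m with hM
  have h1 : ∑ i ∈ Finset.range m, x i = m * M := by rw [hM]; field_simp
  have h2 : ∑ r ∈ Finset.range m, (x r - μ) ^ 2
      = ∑ r ∈ Finset.range m, (x r - M) ^ 2 + m * (M - μ) ^ 2 := by
    have : ∀ r, (x r - μ) ^ 2 = (x r - M) ^ 2 + (2 * (M - μ) * x r + (μ ^ 2 - M ^ 2)) := by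
      intro r; ring
    simp_rw [this]
    rw [Finset.sum_add_distrib, Finset.sum_add_distrib, ← Finset.mul_sum, h1]
    simp only [Finset.sum_const, Finset.card_range, nsmul_eq_mul]
    ring
  rw [h2]
  linarith [mul_nonneg hm0.le (sq_nonneg (M - μ))]

/-- Markov's inequality. Centering at the true stratum means instead of the sample means only
increases the sum of squares, and `m / (m - 1) ≤ 2`. -/
theorem prob_stratVar_gt_le [IsProbabilityMeasure P] (hW : ∀ t, Measurable (W t))
    (hWu : ∀ t, P.map (W t) = unifCube q)
    (hGm : Measurable G) (hG : MemLp G 2 (unifCube q)) {m l : ℕ} (hm : 2 ≤ m) (hl : 1 ≤ l)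
    {σ2 : ℝ} (hσ : 0 < σ2) :
    P {ω | σ2 < stratVar G m l (fun c r => W (l, c, r) ω)}
      ≤ ENNReal.ofReal (2 * avgVar G l / σ2) := by
  have hm2 : (2 : ℝ) ≤ m := by exact_mod_cast hm
  have hm1 : (0 : ℝ) < (m : ℝ) - 1 := by linarith
  have hl0 : (0 : ℝ) < (l : ℝ) ^ q := by
    have : (0 : ℝ) < l := by exact_mod_cast hl
    positivity
  set μ : (Fin q → ℕ) → ℝ := fun c => ∫ v, G (inCell l c v) ∂unifCube q with hμ
  set S : Ω → ℝ := fun ω => (∑ c ∈ cells q l, (∑ r ∈ Finset.range m,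
    (G (inCell l c (W (l, c, r) ω)) - μ c) ^ 2) / ((m : ℝ) - 1)) / (l : ℝ) ^ q with hS
  have hle : ∀ ω, stratVar G m l (fun c r => W (l, c, r) ω) ≤ S ω := by
    intro ω
    simp only [stratVar, cellVar, cellMean, hS]
    exact div_le_div_of_nonneg_right (Finset.sum_le_sum fun c _ => div_le_div_of_nonneg_right
      (sum_sq_sub_mean_le m (fun r => G (inCell l c (W (l, c, r) ω))) (μ c)) hm1.le) hl0.le
  have hS0 : ∀ ω, 0 ≤ S ω := fun ω => div_nonneg (Finset.sum_nonneg fun c _ =>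
    div_nonneg (Finset.sum_nonneg fun _ _ => sq_nonneg _) hm1.le) hl0.le
  have hint : ∀ c ∈ cells q l, ∀ r, Integrable
      (fun ω => (G (inCell l c (W (l, c, r) ω)) - μ c) ^ 2) P := fun c hc r =>
    ((memLp_draw hW hWu hG hl hc _).sub (memLp_const (μ c))).integrable_sq
  have hval : ∀ c ∈ cells q l, ∀ r, ∫ ω, (G (inCell l c (W (l, c, r) ω)) - μ c) ^ 2 ∂P
      = variance (fun v => G (inCell l c v)) (unifCube q) := by
    intro c hc r
    rw [← variance_draw hW hWu hGm l c (l, c, r),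
      variance_eq_integral (memLp_draw hW hWu hG hl hc _).aestronglyMeasurable.aemeasurable,
      integral_draw hW hWu hGm]
  have hSint : Integrable S P :=
    (integrable_finsetSum _ fun c hc =>
      (integrable_finsetSum _ fun r _ => hint c hc r).div_const _).div_const _
  have hES : ∫ ω, S ω ∂P ≤ 2 * avgVar G l := by
    have e : ∫ ω, S ω ∂P = (m / ((m : ℝ) - 1)) * avgVar G l := by
      simp only [hS]
      rw [integral_div, integral_finsetSum _ fun c hc =>
        (integrable_finsetSum _ fun r _ => hint c hc r).div_const _, avgVar, mul_div_assoc',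
        Finset.mul_sum]
      congr 1
      refine Finset.sum_congr rfl fun c hc => ?_
      rw [integral_div, integral_finsetSum _ fun r _ => hint c hc r,
        Finset.sum_congr rfl fun r _ => hval c hc r]
      simp only [Finset.sum_const, Finset.card_range, nsmul_eq_mul]
      ring
    rw [e]
    have h0 : 0 ≤ avgVar G l :=
      div_nonneg (Finset.sum_nonneg fun _ _ => variance_nonneg _ _) hl0.le
    refine mul_le_mul_of_nonneg_right ?_ h0
    rw [div_le_iff₀ hm1]
    linarith
  have hmarkov := mul_meas_ge_le_integral_of_nonneg (Eventually.of_forall hS0) hSint σ2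
  have h1 : P.real {ω | σ2 ≤ S ω} ≤ 2 * avgVar G l / σ2 := by
    rw [le_div_iff₀ hσ]; linarith
  calc P {ω | σ2 < stratVar G m l (fun c r => W (l, c, r) ω)} ≤ P {ω | σ2 ≤ S ω} :=
        measure_mono fun ω hω => le_trans (le_of_lt hω) (hle ω)
    _ = ENNReal.ofReal (P.real {ω | σ2 ≤ S ω}) := (ofReal_measureReal (measure_ne_top _ _)).symm
    _ ≤ _ := ENNReal.ofReal_le_ofReal h1

end Fixed

/-! ### The error at the adaptive sample size -/

section SplitSigma

variable {Ω : Type*} {q : ℕ} {W : CellIdx q → Ω → Fin q → ℝ} {G : (Fin q → ℝ) → ℝ}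

/-- The information in the draws for `l` splits. -/
abbrev splitSigma (W : CellIdx q → Ω → Fin q → ℝ) (l : ℕ) : MeasurableSpace Ω :=
  ⨆ t ∈ {t : CellIdx q | t.1 = l}, MeasurableSpace.comap (W t) inferInstance

theorem measurable_splitSigma (W : CellIdx q → Ω → Fin q → ℝ) (l : ℕ) (c : Fin q → ℕ) (i : ℕ) :
    Measurable[splitSigma W l] (W (l, c, i)) := by
  refine Measurable.mono (comap_measurable (W (l, c, i))) ?_ le_rfl
  exact le_iSup₂_of_le (f := fun (t : CellIdx q) (_ : t ∈ {t : CellIdx q | t.1 = l}) =>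
    MeasurableSpace.comap (W t) inferInstance) (l, c, i) rfl le_rfl

theorem measurableSet_splitSigma_error (hGm : Measurable G) (m l : ℕ) (t f0 : ℝ) :
    MeasurableSet[splitSigma W l]
      {ω | t < |stratMean G m l (fun c i => W (l, c, i) ω) - f0|} := by
  have h1 := @measurable_stratMean Ω (splitSigma W l) q (fun _ => G)
    (hGm.comp measurable_snd) m l (fun c i => W (l, c, i)) (measurable_splitSigma W l)
  have h2 : Measurable fun x : ℝ => |x - f0| := by fun_prop
  exact (h2.comp h1) (measurableSet_Ioi (a := t))

theorem measurableSet_splitSigma_var (hGm : Measurable G) (m l : ℕ) (σ2 : ℝ) :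
    MeasurableSet[splitSigma W l]
      {ω | σ2 < stratVar G m l (fun c i => W (l, c, i) ω)} := by
  have h1 := @measurable_stratVar Ω (splitSigma W l) q (fun _ => G)
    (hGm.comp measurable_snd) m l (fun c i => W (l, c, i)) (measurable_splitSigma W l)
  exact h1 (measurableSet_Ioi (a := σ2))

end SplitSigma

section Stopping

variable {Ω : Type*} [mΩ : MeasurableSpace Ω] {P : Measure Ω} {q : ℕ}
  {W : CellIdx q → Ω → Fin q → ℝ} {G : (Fin q → ℝ) → ℝ}

/-- Events from different numbers of splits are independent. -/
theorem measure_inter_biInter_splits (hW : ∀ t, Measurable (W t)) (hWi : iIndepFun W P)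
    {B D : ℕ → Set Ω}
    (hB : ∀ l, MeasurableSet[⨆ t ∈ {t : CellIdx q | t.1 = l},
      MeasurableSpace.comap (W t) inferInstance] (B l))
    (hD : ∀ l, MeasurableSet[⨆ t ∈ {t : CellIdx q | t.1 = l},
      MeasurableSpace.comap (W t) inferInstance] (D l)) (L j : ℕ) :
    P (B (L + j) ∩ ⋂ i ∈ Set.Iio j, D (L + i)) = P (B (L + j)) * P (⋂ i ∈ Set.Iio j, D (L + i)) := by
  have hle : ∀ t, MeasurableSpace.comap (W t) inferInstance ≤ mΩ := fun t => (hW t).comap_le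
  have hdisj : Disjoint {t : CellIdx q | t.1 = L + j} {t : CellIdx q | t.1 < L + j} := by
    rw [Set.disjoint_left]
    intro t h1 h2
    simp only [Set.mem_ofPred_eq] at h1 h2
    omega
  have hind := indep_iSup_of_disjoint hle hWi.iIndep hdisj
  refine (Indep_iff _ _ P).mp hind _ _ (hB _) ?_
  refine MeasurableSet.biInter (Set.to_countable _) fun i hi => ?_
  have hmono : (⨆ t ∈ {t : CellIdx q | t.1 = L + i}, MeasurableSpace.comap (W t) inferInstance)
      ≤ ⨆ t ∈ {t : CellIdx q | t.1 < L + j}, MeasurableSpace.comap (W t) inferInstance := by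
    refine biSup_mono fun t ht => ?_
    simp only [Set.mem_ofPred_eq, Set.mem_Iio] at ht hi ⊢
    omega
  exact hmono _ (hD _)

theorem measure_biInter_splits_le [IsProbabilityMeasure P] (hW : ∀ t, Measurable (W t)) (hWi : iIndepFun W P)
    {D : ℕ → Set Ω}
    (hD : ∀ l, MeasurableSet[⨆ t ∈ {t : CellIdx q | t.1 = l},
      MeasurableSpace.comap (W t) inferInstance] (D l)) {L : ℕ}
    (hDle : ∀ l, L ≤ l → P (D l) ≤ 2⁻¹) (j : ℕ) :
    P (⋂ i ∈ Set.Iio j, D (L + i)) ≤ 2⁻¹ ^ j := by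
  induction j with
  | zero => simp
  | succ j ih =>
    have h1 : (⋂ i ∈ Set.Iio (j + 1), D (L + i)) = D (L + j) ∩ ⋂ i ∈ Set.Iio j, D (L + i) := by
      ext ω
      simp only [Set.mem_iInter, Set.mem_Iio, Set.mem_inter_iff, Nat.lt_succ_iff_lt_or_eq]
      constructor
      · exact fun h => ⟨h j (Or.inr rfl), fun i hi => h i (Or.inl hi)⟩
      · rintro ⟨h1, h2⟩ i (hi | rfl)
        · exact h2 i hi
        · exact h1
    rw [h1, measure_inter_biInter_splits hW hWi hD hD, pow_succ']
    exact mul_le_mul' (hDle _ (by omega)) ih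

/-- `D` is failure of a trial and `B` inaccuracy. Stopping at `L + j` requires `j` independent
failures, of probability at most `2⁻¹ ^ j`, independent of `B (L + j)`; never stopping has
probability 0. Summing over `j` gives the factor 2. -/
theorem measure_stopped_le [IsProbabilityMeasure P] (hW : ∀ t, Measurable (W t)) (hWi : iIndepFun W P)
    {B D : ℕ → Set Ω}
    (hB : ∀ l, MeasurableSet[⨆ t ∈ {t : CellIdx q | t.1 = l},
      MeasurableSpace.comap (W t) inferInstance] (B l))
    (hD : ∀ l, MeasurableSet[⨆ t ∈ {t : CellIdx q | t.1 = l},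
      MeasurableSpace.comap (W t) inferInstance] (D l)) {L : ℕ} {b : ENNReal}
    (hDle : ∀ l, L ≤ l → P (D l) ≤ 2⁻¹) (hBle : ∀ l, L ≤ l → P (B l) ≤ b) {E : Set Ω}
    (hE : ∀ ω ∈ E, (∀ i, ω ∈ D (L + i)) ∨ ∃ j, ω ∈ B (L + j) ∧ ∀ i < j, ω ∈ D (L + i)) :
    P E ≤ 2 * b := by
  have h0 : P (⋂ i, D (L + i)) = 0 := by
    refine le_antisymm (ge_of_tendsto' (ENNReal.tendsto_pow_atTop_nhds_zero_of_lt_one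
      (r := 2⁻¹) (by norm_num)) fun j => ?_) bot_le
    refine le_trans (measure_mono ?_) (measure_biInter_splits_le hW hWi hD hDle j)
    exact Set.iInter_mono fun i => Set.subset_iInter fun _ => subset_rfl
  have h1 : E ⊆ (⋂ i, D (L + i)) ∪ ⋃ j, (B (L + j) ∩ ⋂ i ∈ Set.Iio j, D (L + i)) := by
    intro ω hω
    rcases hE ω hω with h | ⟨j, hj, h⟩
    · exact Or.inl (Set.mem_iInter.mpr h)
    · exact Or.inr (Set.mem_iUnion.mpr ⟨j, hj, Set.mem_iInter₂.mpr h⟩)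
  calc P E ≤ P (⋂ i, D (L + i)) + P (⋃ j, (B (L + j) ∩ ⋂ i ∈ Set.Iio j, D (L + i))) :=
        (measure_mono h1).trans (measure_union_le _ _)
    _ ≤ 0 + ∑' j, P (B (L + j) ∩ ⋂ i ∈ Set.Iio j, D (L + i)) :=
        add_le_add h0.le (measure_iUnion_le _)
    _ ≤ ∑' j : ℕ, b * 2⁻¹ ^ j := by
        rw [zero_add]
        refine ENNReal.tsum_le_tsum fun j => ?_
        rw [measure_inter_biInter_splits hW hWi hB hD]
        exact mul_le_mul' (hBle _ (by omega)) (measure_biInter_splits_le hW hWi hD hDle j)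
    _ = 2 * b := by
        rw [ENNReal.tsum_mul_left, ENNReal.tsum_geometric, ENNReal.one_sub_inv_two, inv_inv,
          mul_comm]

/-! ### The deterministic part of the sampling rule -/

/-- The sampling rule with the sample variance replaced by its lower bound. -/
def BaseRule (A : Params) (q : ℕ) (lam gam Δ : ℝ) (l : ℕ) : Prop :=
  1 ≤ l ∧ lam ≤ (A.nbar : ℝ) * (l : ℝ) ^ q ∧
  √lam * √(A.varMin / ((A.nbar : ℝ) * (l : ℝ) ^ q)) ≤ A.κas * Δ ^ gam

theorem SamplingRule.baseRule {A : Params} {lam gam Δ : ℝ} {l : ℕ}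
    {v : (Fin q → ℕ) → ℕ → Fin q → ℝ} (h : SamplingRule A lam gam Δ G l v) :
    BaseRule A q lam gam Δ l := by
  refine ⟨h.1, h.2.1, le_trans ?_ h.2.2⟩
  gcongr
  exact le_max_left _ _

theorem BaseRule.mono {A : Params} {lam gam Δ : ℝ} {l l' : ℕ} (h : BaseRule A q lam gam Δ l)
    (hl : l ≤ l') : BaseRule A q lam gam Δ l' := by
  obtain ⟨h1, h2, h3⟩ := h
  have hl0 : (0 : ℝ) < l := by exact_mod_cast h1
  have hll : (l : ℝ) ≤ l' := by exact_mod_cast hl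
  have hn : (0 : ℝ) < A.nbar := by exact_mod_cast (by have := A.two_le_nbar; omega : 0 < A.nbar)
  have := A.varMin_pos
  refine ⟨h1.trans hl, h2.trans (by gcongr), le_trans ?_ h3⟩
  gcongr

theorem BaseRule.samplingRule {A : Params} {lam gam Δ : ℝ} {l : ℕ}
    {v : (Fin q → ℕ) → ℕ → Fin q → ℝ} (h : BaseRule A q lam gam Δ l)
    (hv : stratVar G A.nbar l v ≤ A.varMin) : SamplingRule A lam gam Δ G l v := by
  refine ⟨h.1, h.2.1, ?_⟩
  rw [max_eq_left hv]
  exact h.2.2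

theorem exists_baseRule (A : Params) (hq : 1 ≤ q) {lam gam Δ : ℝ} (hΔ : 0 < Δ) :
    ∃ l, BaseRule A q lam gam Δ l := by
  have hn : (0 : ℝ) < A.nbar := by exact_mod_cast (by have := A.two_le_nbar; omega : 0 < A.nbar)
  have hb : 0 < A.κas * Δ ^ gam := mul_pos A.κas_pos (Real.rpow_pos_of_pos hΔ _)
  have h1 : Tendsto (fun l : ℕ => (A.nbar : ℝ) * (l : ℝ) ^ q) atTop atTop :=
    ((tendsto_pow_atTop (by omega)).comp tendsto_natCast_atTop_atTop).const_mul_atTop hn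
  have h2 : Tendsto (fun l : ℕ => √lam * √(A.varMin / ((A.nbar : ℝ) * (l : ℝ) ^ q))) atTop
      (𝓝 0) := by
    have := ((h1.const_div_atTop A.varMin).sqrt).const_mul √lam
    simpa using this
  obtain ⟨l, h3, h4, h5⟩ := ((eventually_ge_atTop 1).and
    ((h1.eventually_ge_atTop lam).and (h2.eventually_le_const hb))).exists
  exact ⟨l, h3, h4, h5⟩

/-- The squared rule: this is how the radius forces a large sample. -/
theorem BaseRule.le_pow {A : Params} {lam gam Δ : ℝ} (hlam : 0 < lam) (hΔ : 0 < Δ) {l : ℕ}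
    (h : BaseRule A q lam gam Δ l) :
    lam * A.varMin / (A.nbar * (A.κas * Δ ^ gam) ^ 2) ≤ (l : ℝ) ^ q := by
  obtain ⟨h1, -, h3⟩ := h
  have hl0 : (0 : ℝ) < l := by exact_mod_cast h1
  have hn : (0 : ℝ) < A.nbar := by exact_mod_cast (by have := A.two_le_nbar; omega : 0 < A.nbar)
  have hb : 0 < A.κas * Δ ^ gam := mul_pos A.κas_pos (Real.rpow_pos_of_pos hΔ _)
  have hv := A.varMin_pos
  rw [← Real.sqrt_mul hlam.le, Real.sqrt_le_left hb.le] at h3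
  rw [div_le_iff₀ (by positivity)]
  rw [mul_div_assoc', div_le_iff₀ (by positivity)] at h3
  linarith

/-- If the adaptive estimate is inaccurate, then either the rule fails for all numbers of splits, or
it fails up to some number of splits at which the estimate is inaccurate. -/
theorem adaptiveEstimate_error_cases {A : Params} {lam gam Δ t f0 : ℝ} {L : ℕ}
    {v : ℕ → (Fin q → ℕ) → ℕ → Fin q → ℝ} (hL : BaseRule A q lam gam Δ L)
    (hLmin : ∀ l, BaseRule A q lam gam Δ l → L ≤ l)
    (h : t < |adaptiveEstimate A lam gam Δ G v - f0|) :
    (∀ i, A.varMin < stratVar G A.nbar (L + i) (v (L + i))) ∨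
      ∃ j, t < |stratMean G A.nbar (L + j) (v (L + j)) - f0| ∧
        ∀ i < j, A.varMin < stratVar G A.nbar (L + i) (v (L + i)) := by
  have key : ∀ i, ¬ SamplingRule A lam gam Δ G (L + i) (v (L + i)) →
      A.varMin < stratVar G A.nbar (L + i) (v (L + i)) := fun i h =>
    not_le.mp fun hle => h ((hL.mono (Nat.le_add_right L i)).samplingRule hle)
  -- Without an admissible `l`, `splits` has the meaningless value 0; this case falls under the
  -- first alternative.
  by_cases hne : ∃ l, SamplingRule A lam gam Δ G l (v l)
  · right
    have hmem : SamplingRule A lam gam Δ G (splits A lam gam Δ G v)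
      (v (splits A lam gam Δ G v)) := Nat.sInf_mem hne
    obtain ⟨j, hj⟩ := Nat.exists_eq_add_of_le (hLmin _ hmem.baseRule)
    rw [adaptiveEstimate, hj] at h
    refine ⟨j, h, fun i hi => key i fun hrule => ?_⟩
    have h1 : splits A lam gam Δ G v ≤ L + i := Nat.sInf_le hrule
    omega
  · exact Or.inl fun i => key i fun h => hne ⟨_, h⟩

/-- Deviation probability of the adaptive estimate when `L` is the least number of splits allowed
by the base rule and the strata are fine enough. -/
theorem prob_adaptiveEstimate_error_le [IsProbabilityMeasure P] (hq : 1 ≤ q)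
    (hW : ∀ t, Measurable (W t))
    (hWu : ∀ t, P.map (W t) = unifCube q) (hWi : iIndepFun W P) (hGm : Measurable G)
    (hG : MemLp G 2 (unifCube q)) {C r : ℝ} (hC : 0 ≤ C) (hr : 0 < r)
    (hvar : ∀ l : ℕ, 1 ≤ l → avgVar G l ≤ C * (l : ℝ) ^ (-r)) (A : Params) {lam gam Δ t : ℝ}
    (ht : 0 < t) {L : ℕ} (hL : BaseRule A q lam gam Δ L)
    (hLmin : ∀ l, BaseRule A q lam gam Δ l → L ≤ l)
    (hsmall : 2 * (C * (L : ℝ) ^ (-r)) / A.varMin ≤ 1 / 2) :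
    P {ω | t < |adaptiveEstimate A lam gam Δ G (fun l c i => W (l, c, i) ω)
        - ∫ u, G u ∂unifCube q|}
      ≤ ENNReal.ofReal (2 * (C * ((L : ℝ) ^ q) ^ (-((q + r) / q)) / t ^ 2)) := by
  have hL1 := hL.1
  have hL0 : (0 : ℝ) < L := by exact_mod_cast hL1
  have hn : 2 ≤ A.nbar := A.two_le_nbar
  have hn1 : (1 : ℝ) ≤ A.nbar := by exact_mod_cast (by omega : 1 ≤ A.nbar)
  have hvm := A.varMin_pos
  set f0 := ∫ u, G u ∂unifCube q with hf0
  have hpow : ∀ l, L ≤ l → (l : ℝ) ^ (-r) ≤ (L : ℝ) ^ (-r) := fun l hl =>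
    Real.rpow_le_rpow_of_nonpos hL0 (by exact_mod_cast hl) (by linarith)
  have hbound := measure_stopped_le hW hWi
    (measurableSet_splitSigma_error hGm A.nbar · t f0)
    (measurableSet_splitSigma_var hGm A.nbar · A.varMin) (L := L)
    (b := ENNReal.ofReal (C * ((L : ℝ) ^ q) ^ (-((q + r) / q)) / t ^ 2))
    (E := {ω | t < |adaptiveEstimate A lam gam Δ G (fun l c i => W (l, c, i) ω) - f0|})
    (fun l hl => ?_) (fun l hl => ?_) (fun ω hω => ?_)
  · refine hbound.trans (le_of_eq ?_)
    rw [ENNReal.ofReal_mul (by norm_num : (0 : ℝ) ≤ 2)]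
    simp
  · refine (prob_stratVar_gt_le hW hWu hGm hG hn (hL1.trans hl) hvm).trans ?_
    rw [show (2⁻¹ : ENNReal) = ENNReal.ofReal (1 / 2) by
      rw [one_div, ENNReal.ofReal_inv_of_pos two_pos]; simp]
    refine ENNReal.ofReal_le_ofReal (le_trans ?_ hsmall)
    have h1 := hvar l (hL1.trans hl)
    have h2 := hpow l hl
    gcongr
    exact h1.trans (by gcongr)
  · refine (prob_stratMean_error_le hW hWu hWi hGm hG (by omega) (hL1.trans hl) ht).trans ?_
    refine ENNReal.ofReal_le_ofReal ?_
    have hl0 : (0 : ℝ) < l := by exact_mod_cast hL1.trans hl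
    have hLl : (L : ℝ) ≤ l := by exact_mod_cast hl
    have h1 := hvar l (hL1.trans hl)
    have e : ((L : ℝ) ^ q) ^ (-((q + r) / q)) = (L : ℝ) ^ (-r) / (L : ℝ) ^ q := by
      have hq0 : (0 : ℝ) < q := by exact_mod_cast hq
      rw [← Real.rpow_natCast, ← Real.rpow_mul hL0.le, ← Real.rpow_sub hL0]
      congr 1
      field_simp
      ring
    rw [e, mul_div_assoc']
    have h3 : avgVar G l ≤ C * (L : ℝ) ^ (-r) :=
      h1.trans (mul_le_mul_of_nonneg_left (hpow l hl) hC)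
    have h4 : (L : ℝ) ^ q ≤ A.nbar * (l : ℝ) ^ q := by
      have : (L : ℝ) ^ q ≤ (l : ℝ) ^ q := by gcongr
      nlinarith [pow_pos hl0 q]
    gcongr
  · simp only [Set.mem_ofPred_eq] at hω ⊢
    exact adaptiveEstimate_error_cases (v := fun l c i => W (l, c, i) ω) hL hLmin hω

end Stopping

/-! ### A bound on the deviation probabilities, uniform in the point and the radius -/

/-- With `s = (q + r) / q`, Chebyshev gives order `(L ^ q) ^ (-s) / Δ ^ 4`, and the base rule makes
`L ^ q` at least of order `k ^ e * Δ ^ (-2γ)`. Since `2γs ≥ 4`, the powers of `Δ` are bounded on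
`(0, D]`. -/
theorem Regime.Holds.exists_deviation_bound {d q : ℕ} (hq : 1 ≤ q) {p : Problem d q}
    (hp : p.Standing) {reg : Regime q} (hreg : reg.Holds p) {δ : ℝ} (hδ : 0 < δ) (A : Params)
    {a D : ℝ} (ha : 0 < a) (hD : 0 < D) :
    ∃ (C e : ℝ) (k0 : ℕ), 1 < e ∧ ∀ k : ℕ, k0 ≤ k → ∀ θ ∈ p.Θ, ∀ Δ : ℝ, 0 < Δ → Δ ≤ D →
      ∀ {Ω : Type*} [MeasurableSpace Ω] (P : Measure Ω) [IsProbabilityMeasure P]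
        (W : CellIdx q → Ω → Fin q → ℝ), (∀ t, Measurable (W t)) →
        (∀ t, P.map (W t) = unifCube q) → iIndepFun W P →
        P {ω | a * Δ ^ 2 < |adaptiveEstimate A (reg.lam δ k) reg.gam Δ (p.G θ)
          (fun l c i => W (l, c, i) ω) - p.f θ|} ≤ ENNReal.ofReal (C * (k : ℝ) ^ (-e)) := by
  obtain ⟨r, e, C, hr, he, hlam, hes, hgs, hvar⟩ := hreg.exists_rate hq hp hδ
  have hq0 : (0 : ℝ) < q := by exact_mod_cast hq
  have hn : (0 : ℝ) < A.nbar := by exact_mod_cast (by have := A.two_le_nbar; omega : 0 < A.nbar)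
  have hv := A.varMin_pos
  have hκ := A.κas_pos
  set s : ℝ := (q + r) / q with hs
  have hs0 : 0 < s := by positivity
  set g : ℝ := reg.gam with hg
  set Z : ℝ := A.varMin / (A.nbar * A.κas ^ 2) with hZ
  have hZ0 : 0 < Z := by positivity
  -- Since `λ_k → ∞`, even the least admissible strata eventually become fine enough for a trial to
  -- fail with probability at most 1/2.
  have hsmall : ∀ᶠ k : ℕ in atTop,
      2 * (|C| * ((k : ℝ) ^ e / A.nbar) ^ (-(r / q))) / A.varMin ≤ 1 / 2 := by
    have h1 : Tendsto (fun k : ℕ => (k : ℝ) ^ e / A.nbar) atTop atTop :=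
      ((tendsto_rpow_atTop he).comp tendsto_natCast_atTop_atTop).atTop_div_const hn
    have h2 := (tendsto_rpow_neg_atTop (by positivity : 0 < r / q)).comp h1
    have h3 : Tendsto (fun k : ℕ => 2 * (|C| * ((k : ℝ) ^ e / A.nbar) ^ (-(r / q))) / A.varMin)
        atTop (𝓝 (2 * (|C| * 0) / A.varMin)) := ((h2.const_mul |C|).const_mul 2).div_const _
    exact h3.eventually_le_const (by norm_num)
  obtain ⟨k1, hk1⟩ := eventually_atTop.mp hsmall
  -- The 2 comes from the geometric series, `Z` from the rule, `a ^ 2` from Chebyshev. Excluding `k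
  -- = 0` makes `λ_k` positive.
  refine ⟨2 * (|C| * (Z ^ (-s) * D ^ (2 * g * s - 4)) / a ^ 2), e * s, max k1 1, hes, ?_⟩
  intro k hk θ hθ Δ hΔ hΔD Ω _ P _ W hW hWu hWi
  have hk0 : (0 : ℝ) < k := by exact_mod_cast (le_max_right k1 1).trans hk
  have hlam0 : 0 < reg.lam δ k := by rw [hlam]; positivity
  classical
  have hex := exists_baseRule (q := q) A hq (lam := reg.lam δ k) (gam := g) hΔ
  have hL := Nat.find_spec hex
  set L := Nat.find hex with hLdef
  have hLmin : ∀ l, BaseRule A q (reg.lam δ k) g Δ l → L ≤ l := fun l hl => Nat.find_min' hex hl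
  have hL0 : (0 : ℝ) < L := by exact_mod_cast hL.1
  clear_value L
  have hvar' : ∀ l : ℕ, 1 ≤ l → avgVar (p.G θ) l ≤ |C| * (l : ℝ) ^ (-r) := fun l hl =>
    (hvar θ hθ l hl).trans (by gcongr; exact le_abs_self C)
  have hLr : (L : ℝ) ^ (-r) ≤ ((k : ℝ) ^ e / A.nbar) ^ (-(r / q)) := by
    have h1 : (k : ℝ) ^ e / A.nbar ≤ (L : ℝ) ^ q := by
      rw [div_le_iff₀ hn, ← hlam, mul_comm]
      exact hL.2.1
    have h2 : (L : ℝ) ^ (-r) = ((L : ℝ) ^ q) ^ (-(r / q)) := by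
      rw [← Real.rpow_natCast, ← Real.rpow_mul hL0.le]
      congr 1
      field_simp
    rw [h2]
    exact Real.rpow_le_rpow_of_nonpos (by positivity) h1 (by
      have : 0 < r / q := by positivity
      linarith)
  have h := prob_adaptiveEstimate_error_le (P := P) hq hW hWu hWi (hp.measurable_G θ)
    (hp.memLp_G hθ) (abs_nonneg C) hr hvar' A (t := a * Δ ^ 2) (by positivity) hL hLmin
    (le_trans (by gcongr) (hk1 k ((le_max_left _ _).trans hk)))
  rw [hp.integral_G hθ] at h
  refine h.trans (ENNReal.ofReal_le_ofReal ?_)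
  have h1 : ((L : ℝ) ^ q) ^ (-s) ≤ Z ^ (-s) * (k : ℝ) ^ (-(e * s)) * Δ ^ (2 * g * s) := by
    have h2 := hL.le_pow hlam0 hΔ
    have h3 := Real.rpow_le_rpow_of_nonpos (by positivity) h2 (by linarith : -s ≤ 0)
    refine h3.trans (le_of_eq ?_)
    have e1 : reg.lam δ k * A.varMin / (A.nbar * (A.κas * Δ ^ g) ^ 2)
        = Z * (k : ℝ) ^ e * (Δ ^ (-(2 * g))) := by
      rw [hlam, hZ, Real.rpow_neg hΔ.le, show (2 : ℝ) * g = g * (2 : ℕ) by push_cast; ring,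
        Real.rpow_mul_natCast hΔ.le]
      field_simp
    rw [e1, Real.mul_rpow (by positivity) (by positivity), Real.mul_rpow (by positivity)
      (by positivity), ← Real.rpow_mul hk0.le, ← Real.rpow_mul hΔ.le]
    congr 2 <;> ring_nf
  -- The factor `Δ ^ 4` cancels against the squared threshold `(a * Δ ^ 2) ^ 2`.
  have h4 : Δ ^ (2 * g * s) ≤ D ^ (2 * g * s - 4) * Δ ^ 4 := by
    have e2 : Δ ^ (2 * g * s) = Δ ^ (2 * g * s - 4) * Δ ^ 4 := by
      rw [← Real.rpow_natCast Δ 4, ← Real.rpow_add hΔ]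
      congr 1
      push_cast
      ring
    rw [e2]
    have : 0 ≤ 2 * g * s - 4 := by linarith
    gcongr
  calc 2 * (|C| * ((L : ℝ) ^ q) ^ (-s) / (a * Δ ^ 2) ^ 2)
      ≤ 2 * (|C| * (Z ^ (-s) * (k : ℝ) ^ (-(e * s)) * (D ^ (2 * g * s - 4) * Δ ^ 4))
        / (a * Δ ^ 2) ^ 2) := by
        gcongr
        exact h1.trans (by gcongr)
    _ = _ := by field_simp

/-! ### Adaptedness of the iterates -/

section Adapted

variable {Ω : Type*} {d q : ℕ}

/-- The information in the draws with labels in `S`. -/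
abbrev drawSigma (V : DrawIdx d q → Ω → Fin q → ℝ) (S : Set (DrawIdx d q)) : MeasurableSpace Ω :=
  ⨆ t ∈ S, MeasurableSpace.comap (V t) inferInstance

theorem drawSigma_mono (V : DrawIdx d q → Ω → Fin q → ℝ) {S T : Set (DrawIdx d q)} (h : S ⊆ T) :
    drawSigma V S ≤ drawSigma V T :=
  biSup_mono fun _ ht => h ht

theorem measurable_drawSigma (V : DrawIdx d q → Ω → Fin q → ℝ) {S : Set (DrawIdx d q)}
    {t : DrawIdx d q} (ht : t ∈ S) : Measurable[drawSigma V S] (V t) :=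
  (comap_measurable (V t)).mono (le_iSup₂_of_le (f := fun (t : DrawIdx d q) (_ : t ∈ S) =>
    MeasurableSpace.comap (V t) inferInstance) t ht le_rfl) le_rfl

variable {R : Iterates Ω d} {p : Problem d q} {A : Params} {lam : ℕ → ℝ} {gam : ℝ}
  {V : DrawIdx d q → Ω → Fin q → ℝ} {θ0 : Vec d}

theorem measurable_pos [MeasurableSpace Ω] {k : ℕ} (hθ : Measurable (R.θ k))
    (hΔ : Measurable (R.Δ k)) (hs : Measurable (R.s k)) (i : Pt d) :
    Measurable fun ω => i.pos (R.θ k ω) (R.Δ k ω) (R.s k ω) := by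
  cases i <;> simp only [Pt.pos]
  · exact hθ
  · exact hθ.add (hΔ.smul_const _)
  · exact hθ.sub (hΔ.smul_const _)
  · exact hs

theorem measurable_est [MeasurableSpace Ω] (hp : p.Standing) {k : ℕ} {i : Pt d}
    (hpos : Measurable fun ω => i.pos (R.θ k ω) (R.Δ k ω) (R.s k ω)) (hΔ : Measurable (R.Δ k))
    (hV : ∀ l c r, Measurable (V ⟨k, i, l, c, r⟩)) :
    Measurable (R.est p A lam gam V k i) :=
  measurable_adaptiveEstimate A (lam k) gam hΔ
    (H := fun ω u => p.G (i.pos (R.θ k ω) (R.Δ k ω) (R.s k ω)) u)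
    (hp.measurable_G2.comp ((hpos.comp measurable_fst).prodMk measurable_snd)) hV

/-- Measurability of the coefficients is not part of `IsRun`; it follows because interpolation
determines them. -/
theorem Iterates.IsRun.coeffs_eq (hR : R.IsRun p A lam gam V θ0) (k : ℕ) (ω : Ω) :
    R.c k ω = R.est p A lam gam V k Pt.center ω ∧
    (∀ j, R.g k ω j = (R.est p A lam gam V k (Pt.plus j) ω
      - R.est p A lam gam V k (Pt.minus j) ω) / (2 * R.Δ k ω)) ∧
    ∀ j, R.h k ω j = (R.est p A lam gam V k (Pt.plus j) ω
      + R.est p A lam gam V k (Pt.minus j) ω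
      - 2 * R.est p A lam gam V k Pt.center ω) / R.Δ k ω ^ 2 := by
  have hΔ := (hR.radius_pos k ω).ne'
  have h0 := hR.interpolates k ω Pt.center (by simp)
  simp only [Pt.pos, Iterates.M, dqModel_center] at h0
  refine ⟨h0, fun j => ?_, fun j => ?_⟩ <;>
  · have hp := hR.interpolates k ω (Pt.plus j) (by simp)
    have hm := hR.interpolates k ω (Pt.minus j) (by simp)
    simp only [Pt.pos, Iterates.M, dqModel_plus, dqModel_minus] at hp hm
    rw [← hp, ← hm]
    try rw [← h0]
    field_simp
    ring

theorem Iterates.success_iff (R : Iterates Ω d) (k : ℕ) (ω : Ω) :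
    R.Success p A lam gam V k ω ↔
      A.η ≤ (R.est p A lam gam V k Pt.center ω - R.est p A lam gam V k Pt.cand ω) /
        (-(∑ j, R.g k ω j * (R.s k ω j - R.θ k ω j)
          + ∑ j, R.h k ω j * ((R.s k ω j - R.θ k ω j) ^ 2 / 2))) ∧
      R.Δ k ω ≤ A.ηg * ‖(WithLp.toLp 2 (R.g k ω) : Vec d)‖ := by
  rw [Iterates.Success, Iterates.M, gradient_dqModel, dqModel_center]
  have : R.c k ω - dqModel (R.θ k ω) (R.c k ω) (R.g k ω) (R.h k ω) (R.s k ω)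
      = -(∑ j, R.g k ω j * (R.s k ω j - R.θ k ω j)
          + ∑ j, R.h k ω j * ((R.s k ω j - R.θ k ω j) ^ 2 / 2)) := by
    rw [dqModel]; ring
  rw [this]

/-- The σ-algebra on `Ω` is arbitrary, so that the one generated by the draws of the first `k + 1`
iterations can be inserted. -/
theorem Iterates.IsRun.measurable_next [MeasurableSpace Ω] (hp : p.Standing)
    (hR : R.IsRun p A lam gam V θ0) {k : ℕ} (hθ : Measurable (R.θ k)) (hΔ : Measurable (R.Δ k))
    (hs : Measurable (R.s k)) (hV : ∀ i l c r, Measurable (V ⟨k, i, l, c, r⟩)) :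
    Measurable (R.θ (k + 1)) ∧ Measurable (R.Δ (k + 1)) := by
  classical
  have hest : ∀ i, Measurable (R.est p A lam gam V k i) := fun i =>
    measurable_est hp (measurable_pos hθ hΔ hs i) hΔ (hV i)
  have hg : ∀ j, Measurable fun ω => R.g k ω j := by
    intro j
    simp_rw [fun ω => (hR.coeffs_eq k ω).2.1 j]
    exact ((hest _).sub (hest _)).div (hΔ.const_mul 2)
  have hh : ∀ j, Measurable fun ω => R.h k ω j := by
    intro j
    simp_rw [fun ω => (hR.coeffs_eq k ω).2.2 j]
    exact (((hest _).add (hest _)).sub ((hest _).const_mul 2)).div (hΔ.pow_const 2)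
  have hcoord : ∀ j, Measurable fun x : Vec d => x j := fun j => by fun_prop
  have hθj : ∀ j, Measurable fun ω => R.θ k ω j := fun j => (hcoord j).comp hθ
  have hsj : ∀ j, Measurable fun ω => R.s k ω j := fun j => (hcoord j).comp hs
  have hS : MeasurableSet {ω | R.Success p A lam gam V k ω} := by
    simp only [R.success_iff, Set.ofPred_and]
    have hc := hest Pt.center
    have hcand := hest Pt.cand
    refine MeasurableSet.inter (measurableSet_le measurable_const ?_) (measurableSet_le hΔ ?_)
    · exact (hc.sub hcand).div ((Finset.measurable_sum _ fun j _ =>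
        (hg j).mul ((hsj j).sub (hθj j))).add (Finset.measurable_sum _ fun j _ =>
        (hh j).mul ((((hsj j).sub (hθj j)).pow_const 2).div_const 2))).neg
    · have h1 : Measurable fun ω => R.g k ω := measurable_pi_iff.mpr hg
      have h2 : Measurable fun x : Fin d → ℝ => ‖(WithLp.toLp 2 x : Vec d)‖ := by fun_prop
      exact (h2.comp h1).const_mul _
  have e1 : R.θ (k + 1) = fun ω => if R.Success p A lam gam V k ω then R.s k ω else R.θ k ω := by
    ext1 ω
    split_ifs with h
    · exact (hR.success k ω h).1
    · exact (hR.failure k ω h).1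
  have e2 : R.Δ (k + 1) = fun ω => if R.Success p A lam gam V k ω
      then min (A.expand * R.Δ k ω) A.Δmax else A.shrink * R.Δ k ω := by
    ext1 ω
    split_ifs with h
    · exact (hR.success k ω h).2
    · exact (hR.failure k ω h).2
  rw [e1, e2]
  exact ⟨Measurable.ite hS hs hθ,
    Measurable.ite hS ((hΔ.const_mul _).min measurable_const) (hΔ.const_mul _)⟩

theorem Iterates.IsRun.measurable_past (hp : p.Standing) (hR : R.IsRun p A lam gam V θ0) (k : ℕ) :
    Measurable[drawSigma V {t | t.iter < k}] (R.θ k) ∧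
      Measurable[drawSigma V {t | t.iter < k}] (R.Δ k) := by
  induction k with
  | zero =>
    rw [show R.θ 0 = fun _ => θ0 from funext hR.θ_zero,
      show R.Δ 0 = fun _ => A.Δ0 from funext hR.Δ_zero]
    exact ⟨measurable_const, measurable_const⟩
  | succ k ih =>
    have hle : drawSigma V {t | t.iter < k} ≤ drawSigma V {t | t.iter < k + 1} :=
      drawSigma_mono V fun t ht => by
        simp only [Set.mem_ofPred_eq] at ht ⊢
        omega
    have hle' : history V k ≤ drawSigma V {t | t.iter < k + 1} :=
      drawSigma_mono V fun t ht => by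
        simp only [Set.mem_ofPred_eq] at ht ⊢
        omega
    exact @Iterates.IsRun.measurable_next Ω d q R p A lam gam V θ0
      (drawSigma V {t | t.iter < k + 1}) hp hR k (ih.1.mono hle le_rfl) (ih.2.mono hle le_rfl)
      ((hR.cand_measurable k).mono hle' le_rfl)
      fun i l c r => measurable_drawSigma V (by simp)

/-- The σ-algebra leaves out exactly the current draws at `i` and all later ones. For the candidate
it is `history V k`; the other points need only past iterations. -/
theorem Iterates.IsRun.measurable_pos_history (hp : p.Standing) (hR : R.IsRun p A lam gam V θ0)
    (k : ℕ) (i : Pt d) :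
    Measurable[drawSigma V {t | t.iter < k ∨ (t.iter = k ∧ t.pt ≠ i)}]
      fun ω => (i.pos (R.θ k ω) (R.Δ k ω) (R.s k ω), R.Δ k ω) := by
  obtain ⟨hθ, hΔ⟩ := hR.measurable_past hp k
  have hle : drawSigma V {t | t.iter < k}
      ≤ drawSigma V {t | t.iter < k ∨ (t.iter = k ∧ t.pt ≠ i)} :=
    drawSigma_mono V fun t ht => Or.inl ht
  have hθ := hθ.mono hle le_rfl
  have hΔ := hΔ.mono hle le_rfl
  refine Measurable.prodMk ?_ hΔ
  cases i <;> simp only [Pt.pos]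
  · exact hθ
  · exact hθ.add (hΔ.smul_const _)
  · exact hθ.sub (hΔ.smul_const _)
  · exact hR.cand_measurable k

end Adapted

/-! ### Accuracy of all late estimates -/

/-- Freezing: by independence the joint law is a product, and Fubini integrates the bounds for fixed
values of `Y`. -/
theorem measure_fresh_le {Ω α β : Type*} [MeasurableSpace Ω] [MeasurableSpace α]
    [MeasurableSpace β] {P : Measure Ω} [IsProbabilityMeasure P] {Y : Ω → α} {X : Ω → β}
    (hY : Measurable Y) (hX : Measurable X) (hind : IndepFun Y X P) {S : Set (α × β)}
    (hS : MeasurableSet S) {b : ENNReal} (hb : ∀ ω, P {ω' | (Y ω, X ω') ∈ S} ≤ b) :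
    P {ω | (Y ω, X ω) ∈ S} ≤ b := by
  have h1 := (indepFun_iff_map_prod_eq_prod_map_map hY.aemeasurable hX.aemeasurable).mp hind
  have := Measure.isProbabilityMeasure_map (μ := P) hX.aemeasurable
  calc P {ω | (Y ω, X ω) ∈ S} = P.map (fun ω => (Y ω, X ω)) S :=
        (Measure.map_apply (hY.prodMk hX) hS).symm
    _ = ∫⁻ ω, P.map X (Prod.mk (Y ω) ⁻¹' S) ∂P := by
        rw [h1, Measure.prod_apply hS, lintegral_map (measurable_measure_prodMk_left hS) hY]
    _ ≤ ∫⁻ _, b ∂P := by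
        refine lintegral_mono fun ω => ?_
        rw [Measure.map_apply hX (measurable_prodMk_left hS)]
        exact hb ω
    _ = b := by simp

/-- The integral replaces `p.f`, which equals it on `p.Θ` but need not be measurable elsewhere. -/
theorem Problem.Standing.measurableSet_deviation {d q : ℕ} {p : Problem d q} (hp : p.Standing)
    (A : Params) (lam gam a : ℝ) :
    MeasurableSet {z : (Vec d × ℝ) × (CellIdx q → Fin q → ℝ) | a * z.1.2 ^ 2 <
      |adaptiveEstimate A lam gam z.1.2 (p.G z.1.1) (fun l c r => z.2 (l, c, r))
        - ∫ u, p.G z.1.1 u ∂unifCube q|} := by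
  have hw : ∀ (l : ℕ) (c : Fin q → ℕ) (r : ℕ),
      Measurable fun z : (Vec d × ℝ) × (CellIdx q → Fin q → ℝ) => z.2 (l, c, r) :=
    fun l c r => (measurable_pi_apply _).comp measurable_snd
  have hΔ : Measurable fun z : (Vec d × ℝ) × (CellIdx q → Fin q → ℝ) => z.1.2 :=
    measurable_snd.comp measurable_fst
  have hθ : Measurable fun z : (Vec d × ℝ) × (CellIdx q → Fin q → ℝ) => z.1.1 :=
    measurable_fst.comp measurable_fst
  have hH : Measurable fun y : ((Vec d × ℝ) × (CellIdx q → Fin q → ℝ)) × (Fin q → ℝ) =>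
      p.G y.1.1.1 y.2 :=
    hp.measurable_G2.comp ((hθ.comp measurable_fst).prodMk measurable_snd)
  have h1 := measurable_adaptiveEstimate A lam gam hΔ
    (H := fun (z : (Vec d × ℝ) × (CellIdx q → Fin q → ℝ)) u => p.G z.1.1 u) hH
    (w := fun l c r (z : (Vec d × ℝ) × (CellIdx q → Fin q → ℝ)) => z.2 (l, c, r)) hw
  have h2 : Measurable fun θ => ∫ u, p.G θ u ∂unifCube q :=
    (hp.measurable_G2.stronglyMeasurable.integral_prod_right (ν := unifCube q)).measurable
  have h4 : Measurable fun x : ℝ => |x| := by fun_prop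
  exact measurableSet_lt ((hΔ.pow_const 2).const_mul a) (h4.comp (h1.sub (h2.comp hθ)))

/-- The draws at a point of an iteration are independent of what determines the point. -/
theorem Iterates.IsRun.indepFun_fresh {Ω : Type*} [MeasurableSpace Ω] {P : Measure Ω} {d q : ℕ}
    {p : Problem d q} (hp : p.Standing) {A : Params} {lam : ℕ → ℝ} {gam : ℝ} {θ0 : Vec d}
    {V : DrawIdx d q → Ω → Fin q → ℝ} (hVmeas : ∀ t, Measurable (V t)) (hVindep : iIndepFun V P)
    {R : Iterates Ω d} (hR : R.IsRun p A lam gam V θ0) (k : ℕ) (i : Pt d) :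
    Measurable (fun ω => (i.pos (R.θ k ω) (R.Δ k ω) (R.s k ω), R.Δ k ω)) ∧
    IndepFun (fun ω => (i.pos (R.θ k ω) (R.Δ k ω) (R.s k ω), R.Δ k ω))
      (fun ω (t : CellIdx q) => V ⟨k, i, t.1, t.2.1, t.2.2⟩ ω) P := by
  have hle : ∀ t, MeasurableSpace.comap (V t) inferInstance ≤ ‹MeasurableSpace Ω› :=
    fun t => (hVmeas t).comap_le
  have hYh := hR.measurable_pos_history hp k i
  refine ⟨hYh.mono (iSup₂_le fun t _ => hle t) le_rfl, ?_⟩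
  have hXh : Measurable[drawSigma V {t | t.iter = k ∧ t.pt = i}]
      (fun ω (t : CellIdx q) => V ⟨k, i, t.1, t.2.1, t.2.2⟩ ω) :=
    @measurable_pi_iff _ _ _ (drawSigma V {t | t.iter = k ∧ t.pt = i}) _ _ |>.mpr
      fun t => measurable_drawSigma V ⟨rfl, rfl⟩
  have hdisj : Disjoint {t : DrawIdx d q | t.iter < k ∨ (t.iter = k ∧ t.pt ≠ i)}
      {t : DrawIdx d q | t.iter = k ∧ t.pt = i} := by
    rw [Set.disjoint_left]
    rintro t (h1 | h1) ⟨h2, h3⟩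
    · omega
    · exact h1.2 h3
  rw [IndepFun_iff_Indep]
  exact indep_of_indep_of_le_left (indep_of_indep_of_le_right
    (indep_iSup_of_disjoint hle hVindep.iIndep hdisj) hXh.comap_le) hYh.comap_le

/-- Deviation probabilities of an estimate of the algorithm, from those at fixed points. -/
theorem Iterates.IsRun.prob_deviation_le {Ω : Type*} [MeasurableSpace Ω] {P : Measure Ω}
    [IsProbabilityMeasure P] {d q : ℕ} {p : Problem d q} (hp : p.Standing) {A : Params}
    {lam : ℕ → ℝ} {gam : ℝ} {θ0 : Vec d} {V : DrawIdx d q → Ω → Fin q → ℝ}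
    (hVmeas : ∀ t, Measurable (V t)) (hVindep : iIndepFun V P)
    {R : Iterates Ω d} (hR : R.IsRun p A lam gam V θ0) (k : ℕ) (i : Pt d) {a : ℝ} {b : ENNReal}
    (hb : ∀ θ ∈ p.Θ, ∀ Δ : ℝ, 0 < Δ → Δ ≤ max A.Δ0 A.Δmax →
      P {ω | a * Δ ^ 2 < |adaptiveEstimate A (lam k) gam Δ (p.G θ)
        (fun l c r => V ⟨k, i, l, c, r⟩ ω) - p.f θ|} ≤ b) :
    P {ω | a * R.Δ k ω ^ 2 < |R.est p A lam gam V k i ω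
        - p.f (i.pos (R.θ k ω) (R.Δ k ω) (R.s k ω))|} ≤ b := by
  obtain ⟨hY, hind⟩ := hR.indepFun_fresh hp hVmeas hVindep k i
  have hX : Measurable (fun ω (t : CellIdx q) => V ⟨k, i, t.1, t.2.1, t.2.2⟩ ω) :=
    measurable_pi_iff.mpr fun t => hVmeas _
  have hmem : ∀ ω, i.pos (R.θ k ω) (R.Δ k ω) (R.s k ω) ∈ p.Θ := fun ω => hR.pos_mem k ω i
  have h := measure_fresh_le hY hX hind (hp.measurableSet_deviation A (lam k) gam a)
    (b := b) fun ω => by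
      simp only [Set.mem_ofPred_eq, hp.integral_G (hmem ω)]
      exact hb _ (hmem ω) _ (hR.radius_pos k ω) (hR.radius_le k ω)
  simp only [Set.mem_ofPred_eq, fun ω => hp.integral_G (hmem ω)] at h
  exact h

/-- Borel–Cantelli for each of the finitely many labels: the deviation probabilities are of order `k
^ (-e)` with `e > 1`. -/
theorem Iterates.IsRun.ae_eventually_accurate {Ω : Type*} [MeasurableSpace Ω] {P : Measure Ω}
    [IsProbabilityMeasure P] {d q : ℕ} (hq : 1 ≤ q) {p : Problem d q} (hp : p.Standing)
    {reg : Regime q} (hreg : reg.Holds p) {A : Params} {δ : ℝ} (hδ : 0 < δ) {θ0 : Vec d}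
    {V : DrawIdx d q → Ω → Fin q → ℝ} (hVmeas : ∀ t, Measurable (V t))
    (hVunif : ∀ t, P.map (V t) = unifCube q) (hVindep : iIndepFun V P) {R : Iterates Ω d}
    (hR : R.IsRun p A (fun k => reg.lam δ k) reg.gam V θ0) {a : ℝ} (ha : 0 < a) :
    ∀ᵐ ω ∂P, ∀ᶠ k in atTop, ∀ i : Pt d,
      |R.est p A (fun k => reg.lam δ k) reg.gam V k i ω
        - p.f (i.pos (R.θ k ω) (R.Δ k ω) (R.s k ω))| ≤ a * R.Δ k ω ^ 2 := by
  obtain ⟨C, e, k0, he, hdev⟩ := hreg.exists_deviation_bound hq hp hδ A ha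
    (lt_max_of_lt_left A.Δ0_pos : 0 < max A.Δ0 A.Δmax)
  have hpt : ∀ (i : Pt d) (k : ℕ), k0 ≤ k →
      P {ω | a * R.Δ k ω ^ 2 < |R.est p A (fun k => reg.lam δ k) reg.gam V k i ω
        - p.f (i.pos (R.θ k ω) (R.Δ k ω) (R.s k ω))|} ≤ ENNReal.ofReal (C * (k : ℝ) ^ (-e)) := by
    intro i k hk
    have hinj : Function.Injective fun t : CellIdx q =>
        (⟨k, i, t.1, t.2.1, t.2.2⟩ : DrawIdx d q) := by
      rintro ⟨l, c, r⟩ ⟨l', c', r'⟩ h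
      simp only [DrawIdx.mk.injEq, true_and] at h
      obtain ⟨rfl, rfl, rfl⟩ := h
      rfl
    exact hR.prob_deviation_le hp hVmeas hVindep k i fun θ hθ Δ hΔ hΔm =>
      hdev k hk θ hθ Δ hΔ hΔm P (fun t => V ⟨k, i, t.1, t.2.1, t.2.2⟩) (fun t => hVmeas _)
        (fun t => hVunif _) (hVindep.precomp hinj)
  have hBC : ∀ i : Pt d, ∀ᵐ ω ∂P, ∀ᶠ k in atTop,
      |R.est p A (fun k => reg.lam δ k) reg.gam V k i ω
        - p.f (i.pos (R.θ k ω) (R.Δ k ω) (R.s k ω))| ≤ a * R.Δ k ω ^ 2 := by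
    intro i
    have hsum : Summable fun k : ℕ => C * (k : ℝ) ^ (-e) :=
      (Real.summable_nat_rpow.mpr (by linarith)).mul_left C
    -- Putting `k0 ≤ k` into the event empties the early terms, for which no bound is available.
    have h := ae_eventually_notMem (μ := P) (s := fun k => {ω | k0 ≤ k ∧
      a * R.Δ k ω ^ 2 < |R.est p A (fun k => reg.lam δ k) reg.gam V k i ω
        - p.f (i.pos (R.θ k ω) (R.Δ k ω) (R.s k ω))|})
      (ne_top_of_le_ne_top hsum.tsum_ofReal_ne_top (ENNReal.tsum_le_tsum fun k => ?_))
    · filter_upwards [h] with ω hω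
      filter_upwards [hω, eventually_ge_atTop k0] with k h1 h2
      exact not_lt.mp fun h3 => h1 ⟨h2, h3⟩
    · by_cases hk : k0 ≤ k
      · refine le_trans (measure_mono ?_) (hpt i k hk)
        exact fun ω hω => hω.2
      · simp [hk]
  have hplus := ae_all_iff.mpr fun j : Fin d => hBC (Pt.plus j)
  have hminus := ae_all_iff.mpr fun j : Fin d => hBC (Pt.minus j)
  filter_upwards [hBC Pt.center, hBC Pt.cand, hplus, hminus] with ω h1 h2 h3 h4
  filter_upwards [h1, h2, eventually_all.mpr h3, eventually_all.mpr h4] with k g1 g2 g3 g4 i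
  cases i with
  | center => exact g1
  | plus j => exact g3 j
  | minus j => exact g4 j
  | cand => exact g2

end SASTRO

theorem mainTheorem5 {Ω : Type*} [MeasurableSpace Ω] (P : Measure Ω) [IsProbabilityMeasure P]
    {d q : ℕ} (hq : 1 ≤ q)
    (p : SASTRO.Problem d q) (hp : p.Standing)
    (reg : SASTRO.Regime q) (hreg : reg.Holds p)
    (A : SASTRO.Params) (δ : ℝ) (hδ : 0 < δ) (θ0 : SASTRO.Vec d)
    (V : SASTRO.DrawIdx d q → Ω → Fin q → ℝ)
    (hVmeas : ∀ t, Measurable (V t))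
    (hVunif : ∀ t, P.map (V t) = SASTRO.unifCube q)
    (hVindep : iIndepFun V P)
    (R : SASTRO.Iterates Ω d)
    (hR : R.IsRun p A (fun k => reg.lam δ k) reg.gam V θ0) :
    ∀ᵐ ω ∂P,
      (∀ᶠ ε in 𝓝[>] (0 : ℝ), SASTRO.firstHit R p ε ω ≠ ⊤) ∧
      (fun ε : ℝ => ((SASTRO.firstHit R p ε ω).toNat : ℝ)) =O[𝓝[>] (0 : ℝ)]
        (fun ε : ℝ => ε ^ (-2 : ℤ)) := by
  obtain ⟨a, ha, h⟩ := SASTRO.exists_accuracy_complexity hp hR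
  filter_upwards [hR.ae_eventually_accurate hq hp hreg hδ hVmeas hVunif hVindep ha] with ω hω
  exact h ω hω
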